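/- **Conventions.** Let $D$ be the Scott domain given by the (bilimit) solution of $D=(\mathrm{Nil}+\mathrm{Left}\,D+\mathrm{Right}\,D+\mathrm{Pair}\,D\,D+\mathrm{Amb}\,D\,D+\mathrm{Fun}(D\to D))_\perp$ with continuous function space. Programs are the terms of the $\lambda$-calculus with these constructors, recursion, case distinction on the outermost constructor, and the parallel test $\mathrm{case}\ \mathrm{Pair}(a,b)\ \mathrm{of}\ \{\mathrm{Pair}(\mathrm{Nil},\_)\to\mathrm{Nil};\ \mathrm{Pair}(\_,\mathrm{Nil})\to\mathrm{Nil}\}$; closed programs denote elements of $D$. Every formula $A$ has a classical truth value, a type $\tau(A)\subseteq D$ of potential realisers, and a set of realisers, given by the following clauses. Non-computational formulas $p$ are realised, when true, by $\mathrm{Nil}$; in conjunctions $p\wedge A$ and implications $p\to A$ they carry no realiser ($b$ realises $p\to A$ iff $b\in\tau(A)$ and $p$ implies that $b$ realises $A$). For computational $A,B$: $A\wedge B$ is realised by $\mathrm{Pair}(a,b)$, $A\vee B$ by $\mathrm{Left}(a)$ or $\mathrm{Right}(b)$, where $a$, $b$ realise $A$, $B$; $c$ realises $A\to B$ iff $c\in\tau(A)\Rightarrow\tau(B)$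 and $c\,a$ realises $B$ for every realiser $a$ of $A$. The type of a non-computational formula standing alone is $\{\bot,\mathrm{Nil}\}$; the types of the compound formulas are formed in the same way as their realisers, from potential realisers of the parts, together with $\bot$. Quantifiers are uniform ($a$ realises $\forall x\,A(x)$, resp. $\exists x\,A(x)$, iff it realises $A(x)$ for all, resp. some, $x$). $c$ realises $\Downarrow\! A$ iff $c=\mathrm{Amb}(a,b)$ with $a,b\in\tau(A)$, at least one of $a,b$ is not $\bot$, and each of $a,b$ that is not $\bot$ realises $A$; classically $\Downarrow\! A$ means $A$. Truth and realisability of inductive (co-inductive) predicates are least (greatest) fixed points; their types are recursive types, consisting of all finite and infinite elements of the given shape. $\Downarrow^*\!A$ is defined inductively by $\Downarrow^*\!A=\Downarrow(A\vee\Downarrow^*\!A)$. **Predicates.** For $x,d\in\mathbb R$ and $K,E\subseteq\mathbb R$ let $\mathrm{SD}(d)$ be $(d=-1\vee d=1)\vee d=0$, $\mathrm{GC}(d)$ be $d=-1\vee d=1$, $\mathrm{II}_d=\{x:|2x-d|\le1\}$, $K_d=K\cap \mathrm{II}_d$, $t(x)=1-2|x|$. Let $P_{\mathrm{fin}}(\mathrm{SD})$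 be defined inductively: $P_{\mathrm{fin}}(\mathrm{SD})(E)$ iff $E=\{x\}$ for some $x$ with $\mathrm{SD}(x)$, or $E=v\cup\{y\}$ for some $v$ with $P_{\mathrm{fin}}(\mathrm{SD})(v)$ and some $y$ with $\mathrm{SD}(y)$. Let $\mathbf K(K)$ say (non-computationally) that $K$ is a non-empty compact subset of $[-1,1]$. Define co-inductively (largest predicates) $$G^*(x)\;\overset{\nu}{=}\;-1\le x\le 1\ \wedge\ \bigl(x\ne0\to\Downarrow^*(x\le0\vee x\ge0)\bigr)\ \wedge\ G^*(t(x)),$$ $$S^*_{\mathcal K}(K)\;\overset{\nu}{=}\;\mathbf K(K)\ \wedge\ \Downarrow^*\,\exists E\,\Bigl(P_{\mathrm{fin}}(\mathrm{SD})(E)\ \wedge\ K\subseteq\bigcup_{d\in E}\mathrm{II}_d\ \wedge\ \forall d\,\bigl(\mathrm{SD}(d)\to d\in E\to K_d\neq\emptyset\wedge S^*_{\mathcal K}(\{2x-d:x\in K_d\})\bigr)\Bigr),$$ $$G^*_{\mathcal K}(K)\;\overset{\nu}{=}\;\mathbf K(K)\ \wedge\ G^*(\min K)\ \wedge\ G^*(\max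 K)\ \wedge\ \forall d\,\bigl(\mathrm{GC}(d)\to K_d\neq\emptyset\to G^*_{\mathcal K}(t[K_d])\bigr).$$ **Theorem.** $S^*_{\mathcal K}=G^*_{\mathcal K}$, constructively in the sense of realisability: 1. $S^*_{\mathcal K}$ and $G^*_{\mathcal K}$ hold (classically) of the same sets $K$; 2. there is a closed program that realises $S^*_{\mathcal K}\subseteq G^*_{\mathcal K}$, i.e. $\forall K\,(S^*_{\mathcal K}(K)\to G^*_{\mathcal K}(K))$; 3. there is a closed program that realises $G^*_{\mathcal K}\subseteq S^*_{\mathcal K}$. -/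

import Mathlib

/-! ## The domain of realisers

The domain `D` with `D = (Nil + Left D + Right D + Pair D D + Amb D D + Fun (D → D))_⊥` is built as
the bilimit of its finite approximations `Stage 0 = {⊥}`, `Stage (n+1) = Step (Stage n)`. -/

namespace CFP

/-- One application of the functor of the domain equation to a (finite) partial order. -/
inductive Step (α : Type) [PartialOrder α] : Type
  | bot
  | nil
  | left (a : α)
  | right (a : α)
  | pair (a b : α)
  | amb (a b : α)
  | fn (f : α →o α)

namespace Step

variable {α β : Type} [PartialOrder α] [PartialOrder β]

/-- The information order: `bot` is least, different constructors are incomparable, and the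
arguments of a constructor are compared componentwise. -/
def le : Step α → Step α → Prop
  | bot, _ => True
  | nil, nil => True
  | left a, left b => a ≤ b
  | right a, right b => a ≤ b
  | pair a b, pair c d => a ≤ c ∧ b ≤ d
  | amb a b, amb c d => a ≤ c ∧ b ≤ d
  | fn f, fn g => f ≤ g
  | _, _ => False

instance : PartialOrder (Step α) where
  le := le
  le_refl x := by cases x <;> simp [le]
  le_trans x y z h k := by
    cases x <;> cases y <;> cases z <;> simp_all [le] <;>
      first
        | exact le_trans h k
        | exact ⟨le_trans h.1 k.1, le_trans h.2 k.2⟩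
  le_antisymm x y h k := by
    cases x <;> cases y <;> simp_all [le] <;>
      first
        | exact le_antisymm h k
        | exact ⟨le_antisymm h.1 k.1, le_antisymm h.2 k.2⟩

/-- The action of the functor on a pair of maps in opposite directions. -/
def map (e : α →o β) (p : β →o α) : Step α →o Step β where
  toFun
    | bot => bot
    | nil => nil
    | left a => left (e a)
    | right a => right (e a)
    | pair a b => pair (e a) (e b)
    | amb a b => amb (e a) (e b)
    | fn f => fn (e.comp (f.comp p))
  monotone' x y h := by
    cases x <;> cases y <;> first | exact h.elim | exact trivial | skip
    · exact e.monotone h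
    · exact e.monotone h
    · exact ⟨e.monotone h.1, e.monotone h.2⟩
    · exact ⟨e.monotone h.1, e.monotone h.2⟩
    · exact fun b => e.monotone (h (p b))

end Step

/-- The `n`-th approximation of the domain, as a bundled partial order. -/
def stage : ℕ → (α : Type) × PartialOrder α
  | 0 => ⟨Unit, inferInstance⟩
  | n + 1 => letI := (stage n).2; ⟨Step (stage n).1, inferInstance⟩

/-- The `n`-th approximation of the domain. -/
abbrev Stage (n : ℕ) : Type := (stage n).1

instance (n : ℕ) : PartialOrder (Stage n) := (stage n).2

/-- The least element of `Stage n`. -/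
def Stage.bot : (n : ℕ) → Stage n
  | 0 => ()
  | n + 1 => (Step.bot : Step (Stage n))

/-- The canonical maps `Stage n → Stage m` and `Stage m → Stage n`, the functor being applied to
the maps one level below; for `n ≤ m` they are an embedding and its projection. -/
def transPair : (n m : ℕ) → (Stage n →o Stage m) × (Stage m →o Stage n)
  | 0, m => (⟨fun _ => Stage.bot m, fun _ _ _ => le_rfl⟩, ⟨fun _ => (), fun _ _ _ => le_rfl⟩)
  | n + 1, 0 =>
      (⟨fun _ => (), fun _ _ _ => le_rfl⟩, ⟨fun _ => Stage.bot (n + 1), fun _ _ _ => le_rfl⟩)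
  | n + 1, m + 1 =>
      (Step.map (transPair n m).1 (transPair n m).2, Step.map (transPair n m).2 (transPair n m).1)

/-- The canonical map `Stage n → Stage m`. -/
def trans (n m : ℕ) : Stage n →o Stage m := (transPair n m).1

theorem transPair_swap : ∀ n m, (transPair n m).2 = (transPair m n).1
  | 0, 0 => by ext; rfl
  | 0, m + 1 => by ext; rfl
  | n + 1, 0 => by ext; rfl
  | n + 1, m + 1 => by simp only [transPair]; rw [transPair_swap n m, transPair_swap m n]
termination_by n m => n + m

theorem trans_succ (n m : ℕ) :
    trans (n + 1) (m + 1) = Step.map (trans n m) (trans m n) := by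
  simp only [trans, transPair]; rw [transPair_swap n m]

theorem trans_zero (m : ℕ) (a : Stage 0) : trans 0 m a = Stage.bot m := by
  cases m <;> rfl

theorem trans_bot (n m : ℕ) : trans n m (Stage.bot n) = Stage.bot m := by
  cases n <;> cases m <;> rfl

theorem trans_trans : ∀ (n m k : ℕ), min n k ≤ m → ∀ a : Stage n,
    trans m k (trans n m a) = trans n k a
  | 0, m, k, _, a => by rw [trans_zero, trans_zero, trans_bot]
  | n + 1, m, 0, _, a => rfl
  | n + 1, 0, k + 1, h, a => by omega
  | n + 1, m + 1, k + 1, h, a => by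
    have h1 : min n k ≤ m := by omega
    have h2 : min k n ≤ m := by omega
    rw [trans_succ, trans_succ, trans_succ]
    rcases a with _ | _ | a | a | ⟨a, b⟩ | ⟨a, b⟩ | f
    · rfl
    · rfl
    · exact congrArg Step.left (trans_trans n m k h1 a)
    · exact congrArg Step.right (trans_trans n m k h1 a)
    · exact congrArg₂ Step.pair (trans_trans n m k h1 a) (trans_trans n m k h1 b)
    · exact congrArg₂ Step.amb (trans_trans n m k h1 a) (trans_trans n m k h1 b)
    · refine congrArg Step.fn (OrderHom.ext _ _ (funext fun c => ?_))
      change trans m k (trans n m (f (trans m n (trans k m c)))) = trans n k (f (trans k n c))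
      rw [trans_trans n m k h1, trans_trans k m n h2]

/-- The domain of realisers: the coherent sequences of finite approximations. -/
def D : Type := {x : (n : ℕ) → Stage n // ∀ n m, n ≤ m → trans m n (x m) = x n}

namespace D

/-- The information order, taken at all finite approximations. -/
instance : PartialOrder D := inferInstanceAs (PartialOrder (Subtype _))

/-- A compatible choice of elements of `Step (Stage n)` defines an element of `D`. -/
def ofStep (x : (n : ℕ) → Step (Stage n))
    (h : ∀ n m, n ≤ m → Step.map (trans m n) (trans n m) (x m) = x n) : D :=
  ⟨fun | 0 => () | n + 1 => x n, by
    rintro (_ | n) (_ | m) hnm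
    · rfl
    · rfl
    · omega
    · rw [trans_succ]; exact h n m (by omega)⟩

instance : OrderBot D where
  bot := ofStep (fun _ => .bot) (fun _ _ _ => rfl)
  bot_le _ := by
    rintro (_ | n)
    · exact le_rfl
    · exact trivial

def nil : D := ofStep (fun _ => .nil) (fun _ _ _ => rfl)

def left (x : D) : D :=
  ofStep (fun n => .left (x.1 n)) (fun n m h => congrArg Step.left (x.2 n m h))

def right (x : D) : D :=
  ofStep (fun n => .right (x.1 n)) (fun n m h => congrArg Step.right (x.2 n m h))

def pair (x y : D) : D :=
  ofStep (fun n => .pair (x.1 n) (y.1 n)) (fun n m h => congrArg₂ Step.pair (x.2 n m h) (y.2 n m h))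

def amb (x y : D) : D :=
  ofStep (fun n => .amb (x.1 n) (y.1 n)) (fun n m h => congrArg₂ Step.amb (x.2 n m h) (y.2 n m h))

/-- The embedding of the `n`-th approximation into the domain. -/
def emb (n : ℕ) (a : Stage n) : D :=
  ⟨fun m => trans n m a, fun m k h => trans_trans n k m (by omega) a⟩

theorem emb_mono (n : ℕ) : Monotone (emb n) := fun _ _ h m => (trans n m).monotone h

theorem emb_trans {n m : ℕ} (h : n ≤ m) (a : Stage n) : emb m (trans n m a) = emb n a :=
  Subtype.ext (funext fun k => trans_trans n m k (by omega) a)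

open Classical in
/-- `Fun f`, for a continuous map `f` (and `⊥` for other maps): its `n`-th approximation is
`f` restricted to the `n`-th approximations of arguments and values. -/
noncomputable def fn (f : D → D) : D :=
  if h : ScottContinuous f then
    ofStep (fun n => .fn ⟨fun a => (f (emb n a)).1 n, fun _ _ hab => h.monotone (emb_mono n hab) n⟩)
      (fun n m hnm => congrArg Step.fn (OrderHom.ext _ _ (funext fun a => by
        change trans m n ((f (emb m (trans n m a))).1 m) = _
        rw [emb_trans hnm, (f (emb n a)).2 n m hnm]; rfl)))
  else ⊥

open Classical in
/-- Application: `a b = f b` if `a = Fun f`, and `⊥` otherwise. -/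
noncomputable def app (a b : D) : D :=
  if h : ∃ f, ScottContinuous f ∧ a = fn f then h.choose b else ⊥

open Classical in
/-- The least fixed point of `b ↦ a b`. -/
noncomputable def fix (a : D) : D :=
  if h : ∃ x, IsLeast {x | app a x = x} x then h.choose else ⊥

open Classical in
/-- Case distinction on the outermost constructor, with value `⊥` at `⊥`. -/
noncomputable def cases (d : D) (cnil : D) (cleft cright : D → D) (cpair camb : D → D → D)
    (cfun : D → D) : D :=
  if d = nil then cnil
  else if h : ∃ a, d = left a then cleft h.choose
  else if h : ∃ a, d = right a then cright h.choose
  else if h : ∃ p : D × D, d = pair p.1 p.2 then cpair h.choose.1 h.choose.2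
  else if h : ∃ p : D × D, d = amb p.1 p.2 then camb h.choose.1 h.choose.2
  else if ∃ f, ScottContinuous f ∧ d = fn f then cfun d
  else ⊥

open Classical in
/-- The parallel test `case Pair(a, b) of {Pair(Nil, _) → Nil; Pair(_, Nil) → Nil}`. -/
noncomputable def parNil (a b : D) : D := if a = nil ∨ b = nil then nil else ⊥

end D
/-! ## Programs -/

/-- Programs with free variables among `n`, variable `0` being the innermost one. Binders: `lam M`
and the branches of `cases`, which bind the arguments of the constructor (`Nnil` none, `Nleft`,
`Nright`, `Nfun` one, `Npair`, `Namb` two, the second argument being variable `0`; `Nfun` binds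
the function itself). The language is the λ-calculus with constructors, recursion, sequential case
distinction (a missing clause is the clause with body `bot`) and, as the only case distinction with
overlapping patterns, the parallel test
`parNil M N = case Pair(M, N) of {Pair(Nil, _) → Nil; Pair(_, Nil) → Nil}`. -/
inductive Program : ℕ → Type
  | var {n : ℕ} (i : Fin n) : Program n
  | bot {n : ℕ} : Program n
  | nil {n : ℕ} : Program n
  | left {n : ℕ} (M : Program n) : Program n
  | right {n : ℕ} (M : Program n) : Program n
  | pair {n : ℕ} (M N : Program n) : Program n
  | amb {n : ℕ} (M N : Program n) : Program n
  | lam {n : ℕ} (M : Program (n + 1)) : Program n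
  | app {n : ℕ} (M N : Program n) : Program n
  | fix {n : ℕ} (M : Program n) : Program n
  | cases {n : ℕ} (M : Program n) (Nnil : Program n) (Nleft Nright : Program (n + 1))
      (Npair Namb : Program (n + 2)) (Nfun : Program (n + 1)) : Program n
  | parNil {n : ℕ} (M N : Program n) : Program n

/-- Extension of an environment by a value for the new variable `0`. -/
def extend {n : ℕ} (η : Fin n → D) (d : D) : Fin (n + 1) → D := Fin.cons d η

/-- The denotation of a program in an environment. -/
noncomputable def Program.den : {n : ℕ} → Program n → (Fin n → D) → D
  | _, .var i, η => η i
  | _, .bot, _ => ⊥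
  | _, .nil, _ => D.nil
  | _, .left M, η => D.left (M.den η)
  | _, .right M, η => D.right (M.den η)
  | _, .pair M N, η => D.pair (M.den η) (N.den η)
  | _, .amb M N, η => D.amb (M.den η) (N.den η)
  | _, .lam M, η => D.fn fun d => M.den (extend η d)
  | _, .app M N, η => D.app (M.den η) (N.den η)
  | _, .fix M, η => D.fix (M.den η)
  | _, .cases M Nnil Nleft Nright Npair Namb Nfun, η =>
      D.cases (M.den η) (Nnil.den η) (fun a => Nleft.den (extend η a))
        (fun a => Nright.den (extend η a)) (fun a b => Npair.den (extend (extend η a) b))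
        (fun a b => Namb.den (extend (extend η a) b)) (fun a => Nfun.den (extend η a))
  | _, .parNil M N, η => D.parNil (M.den η) (N.den η)

/-- The denotation of a closed program. -/
noncomputable def Program.val (M : Program 0) : D := M.den Fin.elim0

/-! ## Formulas and realisability

A formula is interpreted by its classical truth value, its type, i.e. the set of its potential
realisers, and the set of its realisers. The connectives below are given by the clauses of the
uniform realisability interpretation; non-computational formulas are written as propositions and
carry no realiser in conjunctions and as premises of implications. A predicate on `α` is a map
`α → Formula`. -/

/-- The interpretation of a formula. -/
structure Formula where
  /-- classical truth -/
  tr : Prop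
  /-- potential realisers -/
  ty : Set D
  /-- realisers -/
  rz : Set D

namespace Formula

/-- A non-computational formula standing alone; its only realiser is `Nil`. -/
def nc (p : Prop) : Formula where
  tr := p
  ty := {⊥, D.nil}
  rz := {a | a = D.nil ∧ p}

/-- `p ∧ A` with `p` non-computational. -/
def ncAnd (p : Prop) (A : Formula) : Formula where
  tr := p ∧ A.tr
  ty := A.ty
  rz := {a | p ∧ a ∈ A.rz}

/-- `p → A` with `p` non-computational. -/
def ncImp (p : Prop) (A : Formula) : Formula where
  tr := p → A.tr
  ty := A.ty
  rz := {b | b ∈ A.ty ∧ (p → b ∈ A.rz)}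

/-- `A ∧ B` with computational content on both sides. -/
def and (A B : Formula) : Formula where
  tr := A.tr ∧ B.tr
  ty := {⊥} ∪ {c | ∃ a ∈ A.ty, ∃ b ∈ B.ty, c = D.pair a b}
  rz := {c | ∃ a ∈ A.rz, ∃ b ∈ B.rz, c = D.pair a b}

/-- `A ∨ B`. -/
def or (A B : Formula) : Formula where
  tr := A.tr ∨ B.tr
  ty := {⊥} ∪ {c | (∃ a ∈ A.ty, c = D.left a) ∨ ∃ b ∈ B.ty, c = D.right b}
  rz := {c | (∃ a ∈ A.rz, c = D.left a) ∨ ∃ b ∈ B.rz, c = D.right b}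

/-- The function type `A ⇒ B`. -/
def funTy (s t : Set D) : Set D :=
  {⊥} ∪ {c | ∃ f, ScottContinuous f ∧ c = D.fn f ∧ ∀ a ∈ s, f a ∈ t}

/-- `A → B` with computational content on both sides. -/
def imp (A B : Formula) : Formula where
  tr := A.tr → B.tr
  ty := funTy A.ty B.ty
  rz := {c | c ∈ funTy A.ty B.ty ∧ ∀ a ∈ A.rz, D.app c a ∈ B.rz}

/-- `∀ x, A x`; one realiser has to work for all `x`. -/
def all {ι : Type} (A : ι → Formula) : Formula where
  tr := ∀ i, (A i).tr
  ty := ⋃ i, (A i).ty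
  rz := {a | ∀ i, a ∈ (A i).rz}

/-- `∃ x, A x`; the realiser does not contain a witness. -/
def ex {ι : Type} (A : ι → Formula) : Formula where
  tr := ∃ i, (A i).tr
  ty := ⋃ i, (A i).ty
  rz := {a | ∃ i, a ∈ (A i).rz}

/-- The concurrency modality `⇊ A`: a pair of candidate realisers, to be computed concurrently,
at least one of which is defined and all of whose defined components realise `A`. -/
def conc (A : Formula) : Formula where
  tr := A.tr
  ty := {⊥} ∪ {c | ∃ a ∈ A.ty, ∃ b ∈ A.ty, c = D.amb a b}
  rz := {c | ∃ a ∈ A.ty, ∃ b ∈ A.ty, c = D.amb a b ∧ (a ≠ ⊥ ∨ b ≠ ⊥) ∧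
    (a ≠ ⊥ → a ∈ A.rz) ∧ (b ≠ ⊥ → b ∈ A.rz)}

variable {α : Type}

/-- The recursive type `fix τ(Φ)` of a fixed point of the operator `Φ`, consisting of all finite
and infinite elements of the domain of the shape described by `Φ`. (The type of a predicate does
not depend on its argument, nor does the type of `Φ X` depend on anything but the type of `X`.) -/
def fixTy (Φ : (α → Formula) → α → Formula) : Set D :=
  ⋃₀ {t | t ⊆ ⋃ x, (Φ (fun _ => ⟨True, t, ∅⟩) x).ty}

/-- The inductively defined predicate `μ Φ`: truth and realisability are least fixed points. -/
def mu (Φ : (α → Formula) → α → Formula) (x : α) : Formula where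
  tr := ∀ p : α → Prop, (∀ y, (Φ (fun z => ⟨p z, fixTy Φ, ∅⟩) y).tr → p y) → p x
  ty := fixTy Φ
  rz := {a | ∀ r : α → Set D, (∀ y, (Φ (fun z => ⟨True, fixTy Φ, r z⟩) y).rz ⊆ r y) → a ∈ r x}

/-- The co-inductively defined predicate `ν Φ`: truth and realisability are greatest fixed
points. -/
def nu (Φ : (α → Formula) → α → Formula) (x : α) : Formula where
  tr := ∃ p : α → Prop, (∀ y, p y → (Φ (fun z => ⟨p z, fixTy Φ, ∅⟩) y).tr) ∧ p x
  ty := fixTy Φ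
  rz := {a | ∃ r : α → Set D,
    (∀ y, r y ⊆ (Φ (fun z => ⟨True, fixTy Φ, r z⟩) y).rz) ∧ a ∈ r x}

/-- The iterated concurrency modality `⇊* A`, inductively defined by `⇊* A = ⇊ (A ∨ ⇊* A)`. -/
def concStar (A : Formula) : Formula :=
  mu (fun (X : Unit → Formula) _ => conc (or A (X ()))) ()

/-- Inclusion `P ⊆ Q` of predicates, i.e. `∀ x, P x → Q x`. -/
def incl (P Q : α → Formula) : Formula := all fun x => imp (P x) (Q x)

end Formula

open Formula

/-! ## The predicates -/

/-- The non-empty compact subsets of `[-1, 1]`. -/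
def IsNonemptyCompact (K : Set ℝ) : Prop := K.Nonempty ∧ IsCompact K ∧ K ⊆ Set.Icc (-1) 1

/-- The signed digits `(d = -1 ∨ d = 1) ∨ d = 0`. -/
def SD (d : ℝ) : Formula := or (or (nc (d = -1)) (nc (d = 1))) (nc (d = 0))

/-- The Gray digits `d = -1 ∨ d = 1`. -/
def GC (d : ℝ) : Formula := or (nc (d = -1)) (nc (d = 1))

/-- The range `{x | |2x - d| ≤ 1}` of the digit map `x ↦ (x + d) / 2` on `[-1, 1]`. -/
def digitRange (d : ℝ) : Set ℝ := {x | |2 * x - d| ≤ 1}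

/-- `K_d`, the part of `K` in the range of the digit `d`. -/
def cut (K : Set ℝ) (d : ℝ) : Set ℝ := K ∩ digitRange d

/-- The tent map. -/
noncomputable def tent (x : ℝ) : ℝ := 1 - 2 * |x|

/-- The non-empty finite subsets of a predicate, inductively: a singleton, or a smaller set with
one more element. -/
def PFin (P : ℝ → Formula) : Set ℝ → Formula :=
  mu fun Z E =>
    or (ex fun x => ncAnd (E = {x}) (P x))
      (ex fun v => and (Z v) (ex fun y => ncAnd (E = v ∪ {y}) (P y)))

/-- `⇊*(x ≤ 0 ∨ x ≥ 0)`. -/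
def Bstar (x : ℝ) : Formula := concStar (or (nc (x ≤ 0)) (nc (x ≥ 0)))

/-- `x ≠ 0 → ⇊*(x ≤ 0 ∨ x ≥ 0)`. -/
def Dstar (x : ℝ) : Formula := ncImp (x ≠ 0) (Bstar x)

/-- The concurrent Gray-code predicate on real numbers, co-inductively:
`G*(x) = -1 ≤ x ≤ 1 ∧ (x ≠ 0 → ⇊*(x ≤ 0 ∨ x ≥ 0)) ∧ G*(t x)`. -/
noncomputable def Gstar : ℝ → Formula :=
  nu fun Y x => ncAnd (-1 ≤ x ∧ x ≤ 1) (and (Dstar x) (Y (tent x)))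

/-- The concurrent signed-digit tree predicate on sets of reals, co-inductively: `S*_K(K)` holds if
`K` is a non-empty compact subset of `[-1, 1]` and, concurrently, there is a non-empty finite set
`E` of signed digits whose ranges cover `K` such that for every signed digit `d` in `E` the set
`K_d` is non-empty and `S*_K` holds of the image of `K_d` under the inverse `x ↦ 2x - d` of the
digit map. -/
def SKstar : Set ℝ → Formula :=
  nu fun Y K => ncAnd (IsNonemptyCompact K) (concStar (ex fun E : Set ℝ =>
    and (PFin SD E) (ncAnd (K ⊆ ⋃ d ∈ E, digitRange d)
      (all fun d => imp (SD d) (ncImp (d ∈ E)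
        (ncAnd (cut K d).Nonempty (Y ((fun x => 2 * x - d) '' cut K d))))))))

/-- The concurrent Gray-code predicate on sets of reals, co-inductively: `G*_K(K)` holds if `K` is
a non-empty compact subset of `[-1, 1]`, `G*` holds of `min K` and `max K`, and for every Gray digit
`d` with `K_d` non-empty `G*_K` holds of the image of `K_d` under the tent map. -/
noncomputable def GKstar : Set ℝ → Formula :=
  nu fun Y K => ncAnd (IsNonemptyCompact K)
    (and (Gstar (sInf K)) (and (Gstar (sSup K))
      (all fun d => imp (GC d) (ncImp (cut K d).Nonempty (Y (tent '' cut K d))))))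

end CFP

namespace CFP

/-! ## The domain -/

namespace Step
variable {α : Type} [PartialOrder α]

/-! Classically both predicates hold of exactly the non-empty compact subsets of [-1, 1], because
that property is itself a post-fixed point of both operators (`SKstar_tr_iff`, `GKstar_tr_iff`). The
content lies in the programs.

Both translations pass through an intermediate object without concurrency: a function κ that answers
queries. A query asks whether `tent^[k]` of the minimum or maximum of L is ≤ 0, or whether it is ≥
0, where L arises from K by repeatedly taking the tent image of the non-positive or the non-negative
half. `Valid` says that an answer `nil` is always true, and that of two opposite questions at least
one gets `nil` unless the number is 0. Concurrency is removed by running a test at all leaves of an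
`Amb` tree with the parallel test (`signTests_search`), and restored by an `Amb` tree of guarded
candidates, at least one of whose guards succeeds (`choice_mem_rz`).

Signed digits to answers (`valid_treeQ`): let d be the least digit in E. Since the ranges cover K
and K_d is non-empty, min K lies in II_d, and 2 min K - d is the minimum of the next set; so queries
about min K become shorter queries there. Only the sign question at d = 0 keeps its length, but it
doubles the number, and a non-zero number cannot be doubled forever within [-1, 1]
(`ok_treeQ_sign`). For the negative half, d = -1 gives the next set itself; d = 1 leaves at most the
point 0, with tent image {1}; and d = 0 is handled by t(2x) = 2t(x) - 1 (`grayPart_digitPart_zero`).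
The maximum and the positive half are symmetric.

Gray code and answers carry the same information almost literally (`grayTree_mem_rz`,
`valid_grayTreeAns`).

Answers to signed digits (`digitTree_mem_rz`): the six candidates for E are the sets of one or two
neighbouring digits and {-1, 1}. An end of K equal to 0 may never reveal a sign, but t(0) = 1 > 0 is
detected and licenses the digit 0 (`exists_digitChoice`). Answers about 2K_0 then come either from
an end of K lying in K_0, or from two successive tent images (`valid_midQ`).

Two obligations accompany all this. Application behaves as expected only for continuous functions,
so denotations of programs are shown to be continuous (`Program.envCont_den`). And a realiser of an
implication must map every potential realiser into the target type, so the constructed trees must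
have the right type even when the answers are meaningless. -/

instance [Finite α] : Finite (Step α) := by
  have : Finite (α →o α) := Finite.of_injective _ DFunLike.coe_injective
  let g : (Unit ⊕ Unit ⊕ α ⊕ α ⊕ (α × α) ⊕ (α × α) ⊕ (α →o α)) → Step α := fun s =>
    match s with
    | .inl _ => bot
    | .inr (.inl _) => nil
    | .inr (.inr (.inl a)) => left a
    | .inr (.inr (.inr (.inl a))) => right a
    | .inr (.inr (.inr (.inr (.inl a)))) => pair a.1 a.2
    | .inr (.inr (.inr (.inr (.inr (.inl a))))) => amb a.1 a.2
    | .inr (.inr (.inr (.inr (.inr (.inr a))))) => fn a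
  refine Finite.of_surjective g fun x => ?_
  cases x with
  | bot => exact ⟨.inl (), rfl⟩
  | nil => exact ⟨.inr (.inl ()), rfl⟩
  | left a => exact ⟨.inr (.inr (.inl a)), rfl⟩
  | right a => exact ⟨.inr (.inr (.inr (.inl a))), rfl⟩
  | pair a b => exact ⟨.inr (.inr (.inr (.inr (.inl (a, b))))), rfl⟩
  | amb a b => exact ⟨.inr (.inr (.inr (.inr (.inr (.inl (a, b)))))), rfl⟩
  | fn a => exact ⟨.inr (.inr (.inr (.inr (.inr (.inr a))))), rfl⟩

end Step

instance Stage.finite : (n : ℕ) → Finite (Stage n)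
  | 0 => inferInstanceAs (Finite Unit)
  | n + 1 => by
    have := Stage.finite n
    exact inferInstanceAs (Finite (Step (Stage n)))

/-- The second half of being an embedding-projection pair. In the function case the argument and the
value are both lowered, so monotonicity of the function is needed. -/
theorem trans_trans_le : ∀ (n m : ℕ), n ≤ m → ∀ a : Stage m, trans n m (trans m n a) ≤ a
  | 0, 0, _, _ => le_rfl
  | 0, m + 1, _, a => by rw [trans_zero]; exact trivial
  | n + 1, 0, h, _ => by omega
  | n + 1, m + 1, h, a => by
    have ih := trans_trans_le n m (by omega)
    rw [trans_succ, trans_succ]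
    rcases a with _ | _ | a | a | ⟨a, b⟩ | ⟨a, b⟩ | f
    · exact trivial
    · exact trivial
    · exact ih a
    · exact ih a
    · exact ⟨ih a, ih b⟩
    · exact ⟨ih a, ih b⟩
    · intro c
      exact (ih _).trans (f.monotone (ih c))

namespace D

/-! ### Finite approximations, directed suprema and Scott continuity. -/

theorem ext_succ {x y : D} (h : ∀ n, x.1 (n + 1) = y.1 (n + 1)) : x = y := by
  refine Subtype.ext (funext fun n => ?_)
  rw [← x.2 n (n + 1) (by omega), ← y.2 n (n + 1) (by omega), h]

theorem le_succ {x y : D} (h : ∀ n, x.1 (n + 1) ≤ y.1 (n + 1)) : x ≤ y := by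
  intro n
  rw [← x.2 n (n + 1) (by omega), ← y.2 n (n + 1) (by omega)]
  exact (trans _ _).monotone (h n)

/-- The projection of an element to its `n`-th approximation. -/
def pr (n : ℕ) (x : D) : D := emb n (x.1 n)

theorem pr_apply_of_le {m n : ℕ} (h : m ≤ n) (x : D) : (pr n x).1 m = x.1 m := x.2 m n h

theorem pr_apply_self (n : ℕ) (x : D) : (pr n x).1 n = x.1 n := pr_apply_of_le le_rfl x

theorem pr_le (n : ℕ) (x : D) : pr n x ≤ x := by
  intro m
  rcases le_total m n with h | h
  · exact (pr_apply_of_le h x).le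
  · change trans n m (x.1 n) ≤ x.1 m
    rw [← x.2 n m h]
    exact trans_trans_le n m h _

theorem pr_le_pr {m n : ℕ} (h : m ≤ n) (x : D) : pr m x ≤ pr n x := by
  have : pr m (pr n x) = pr m x := by
    unfold pr
    exact congrArg (emb m) (pr_apply_of_le h x)
  rw [← this]
  exact pr_le _ _

theorem apply_le_of_le {x y : D} {m n : ℕ} (h : m ≤ n) (hxy : x.1 n ≤ y.1 n) : x.1 m ≤ y.1 m := by
  rw [← x.2 m n h, ← y.2 m n h]
  exact (trans _ _).monotone hxy

/-- Each stage is finite, so a directed set has a maximal value there, and directedness makes it the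
greatest. -/
theorem exists_max {S : Set D} (hS : S.Nonempty) (hd : DirectedOn (· ≤ ·) S) (n : ℕ) :
    ∃ x ∈ S, ∀ y ∈ S, y.1 n ≤ x.1 n := by
  have hfin : ((fun x : D => x.1 n) '' S).Finite := Set.toFinite _
  obtain ⟨a, ⟨x, hx, rfl⟩, hmax⟩ := hfin.exists_maximal (hS.image _)
  refine ⟨x, hx, fun y hy => ?_⟩
  obtain ⟨z, hz, hxz, hyz⟩ := hd x hx y hy
  exact (hyz n).trans (hmax ⟨z, hz, rfl⟩ (hxz n))

/-- The supremum is formed stage by stage from the greatest values. That each stage is attained in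
`S` is the compactness of finite approximations, on which all continuity arguments rest. -/
theorem exists_isLUB {S : Set D} (hS : S.Nonempty) (hd : DirectedOn (· ≤ ·) S) :
    ∃ d, IsLUB S d ∧ ∀ n, ∃ x ∈ S, d.1 n = x.1 n := by
  choose x hx hmax using exists_max hS hd
  refine ⟨⟨fun n => (x n).1 n, fun n m h => ?_⟩, ⟨fun y hy n => hmax n y hy, fun u hu n => hu (hx n) n⟩,
    fun n => ⟨x n, hx n, rfl⟩⟩
  change trans m n ((x m).1 m) = _
  rw [(x m).2 n m h]
  refine le_antisymm (hmax n _ (hx m)) ?_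
  exact apply_le_of_le h (hmax m _ (hx n))

theorem exists_apply_eq {S : Set D} (hS : S.Nonempty) (hd : DirectedOn (· ≤ ·) S) {d : D}
    (h : IsLUB S d) (n : ℕ) : ∃ x ∈ S, d.1 n = x.1 n := by
  obtain ⟨e, he, h'⟩ := exists_isLUB hS hd
  rw [h.unique he]
  exact h' n

theorem isLUB_of_apply {S : Set D} {d : D} (h : d ∈ upperBounds S)
    (h' : ∀ n, ∃ x ∈ S, d.1 n ≤ x.1 n) : IsLUB S d :=
  ⟨h, fun u hu n => by
    obtain ⟨x, hx, hn⟩ := h' n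
    exact hn.trans (hu hx n)⟩

theorem isLUB_pr (x : D) : IsLUB (Set.range fun n => pr n x) x :=
  isLUB_of_apply (by rintro _ ⟨n, rfl⟩; exact pr_le n x)
    fun n => ⟨_, ⟨n, rfl⟩, (pr_apply_self n x).ge⟩

/-- The working form of continuity: a finite part of the value depends only on a finite part of the
argument. -/
theorem scottContinuous_iff {f : D → D} : ScottContinuous f ↔
    Monotone f ∧ ∀ x n, ∃ m, (f x).1 n ≤ (f (pr m x)).1 n := by
  constructor
  · intro h
    refine ⟨h.monotone, fun x n => ?_⟩
    have hdir : DirectedOn (· ≤ ·) (Set.range fun n => pr n x) := by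
      rintro _ ⟨m, rfl⟩ _ ⟨k, rfl⟩
      exact ⟨_, ⟨max m k, rfl⟩, pr_le_pr (le_max_left _ _) x, pr_le_pr (le_max_right _ _) x⟩
    have hne : (Set.range fun n => pr n x).Nonempty := ⟨_, 0, rfl⟩
    obtain ⟨_, ⟨_, ⟨m, rfl⟩, rfl⟩, hm⟩ := exists_apply_eq (hne.image f)
      (hdir.mono_comp (fun _ _ hab => h.monotone hab)) (h hne hdir (isLUB_pr x)) n
    exact ⟨m, hm.le⟩
  · rintro ⟨hmono, h⟩ S hS hd d hlub
    refine isLUB_of_apply ?_ fun n => ?_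
    · rintro _ ⟨x, hx, rfl⟩
      exact hmono (hlub.1 hx)
    · obtain ⟨m, hm⟩ := h d n
      obtain ⟨x, hx, hxm⟩ := exists_apply_eq hS hd hlub m
      refine ⟨_, ⟨x, hx, rfl⟩, hm.trans (hmono ?_ n)⟩
      have : pr m d = pr m x := congrArg (emb m) hxm
      exact this ▸ pr_le m x

/-! ### Constructors -/

theorem fn_apply {f : D → D} (hf : ScottContinuous f) (n : ℕ) : ∃ g : Stage n →o Stage n,
    (∀ a, g a = (f (emb n a)).1 n) ∧ (fn f).1 (n + 1) = (Step.fn g : Step (Stage n)) := by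
  rw [fn, dif_pos hf]
  exact ⟨_, fun _ => rfl, rfl⟩

theorem left_le {x y : D} : left x ≤ left y ↔ x ≤ y :=
  ⟨fun h n => h (n + 1), fun h => le_succ fun n => h n⟩
theorem right_le {x y : D} : right x ≤ right y ↔ x ≤ y :=
  ⟨fun h n => h (n + 1), fun h => le_succ fun n => h n⟩
theorem pair_le {x y z w : D} : pair x y ≤ pair z w ↔ x ≤ z ∧ y ≤ w :=
  ⟨fun h => ⟨fun n => (h (n + 1)).1, fun n => (h (n + 1)).2⟩,
    fun h => le_succ fun n => ⟨h.1 n, h.2 n⟩⟩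
theorem amb_le {x y z w : D} : amb x y ≤ amb z w ↔ x ≤ z ∧ y ≤ w :=
  ⟨fun h => ⟨fun n => (h (n + 1)).1, fun n => (h (n + 1)).2⟩,
    fun h => le_succ fun n => ⟨h.1 n, h.2 n⟩⟩

theorem fn_le {f g : D → D} (hf : ScottContinuous f) (hg : ScottContinuous g) :
    fn f ≤ fn g ↔ f ≤ g := by
  constructor
  · intro h x n
    -- Stage `n` of `f x` is reached at a finite argument; at the common stage `max m n` the two
    -- function tables can be compared.
    obtain ⟨m, hm⟩ := (scottContinuous_iff.1 hf).2 x n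
    refine hm.trans ?_
    obtain ⟨f', hf', hf''⟩ := fn_apply hf (max m n)
    obtain ⟨g', hg', hg''⟩ := fn_apply hg (max m n)
    have h1 := h (max m n + 1)
    rw [hf'', hg''] at h1
    have h2 : f' (x.1 (max m n)) ≤ g' (x.1 (max m n)) := h1 _
    rw [hf', hg'] at h2
    refine le_trans (hf.monotone (pr_le_pr (le_max_left m n) x) n) ?_
    exact (apply_le_of_le (le_max_right m n) h2).trans (hg.monotone (pr_le _ x) n)
  · intro h
    refine le_succ fun n => ?_
    obtain ⟨f', hf', hf''⟩ := fn_apply hf n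
    obtain ⟨g', hg', hg''⟩ := fn_apply hg n
    rw [hf'', hg'']
    intro a
    rw [hf', hg']
    exact h _ n

theorem left_inj {x y : D} : left x = left y ↔ x = y := by
  simp only [le_antisymm_iff, left_le]
theorem right_inj {x y : D} : right x = right y ↔ x = y := by
  simp only [le_antisymm_iff, right_le]
theorem pair_inj {x y z w : D} : pair x y = pair z w ↔ x = z ∧ y = w := by
  simp only [le_antisymm_iff, pair_le]; tauto
theorem amb_inj {x y z w : D} : amb x y = amb z w ↔ x = z ∧ y = w := by
  simp only [le_antisymm_iff, amb_le]; tauto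
theorem fn_inj {f g : D → D} (hf : ScottContinuous f) (hg : ScottContinuous g) :
    fn f = fn g ↔ f = g := by
  simp only [le_antisymm_iff, fn_le hf hg, fn_le hg hf]

/-! ### Every element is `⊥` or has a unique outermost constructor. -/

/-- The outermost constructor, numbered. -/
def tag {α : Type} [PartialOrder α] : Step α → ℕ
  | .bot => 0
  | .nil => 1
  | .left _ => 2
  | .right _ => 3
  | .pair _ _ => 4
  | .amb _ _ => 5
  | .fn _ => 6

/-- The outermost constructor of an element of the domain, numbered. -/
def head (x : D) : ℕ := tag (α := Stage 0) (x.1 1)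

@[simp] theorem head_bot : head ⊥ = 0 := rfl
@[simp] theorem head_nil : head nil = 1 := rfl
@[simp] theorem head_left (x : D) : head (left x) = 2 := rfl
@[simp] theorem head_right (x : D) : head (right x) = 3 := rfl
@[simp] theorem head_pair (x y : D) : head (pair x y) = 4 := rfl
@[simp] theorem head_amb (x y : D) : head (amb x y) = 5 := rfl
theorem head_fn {f : D → D} (hf : ScottContinuous f) : head (fn f) = 6 := by
  obtain ⟨g, _, h⟩ := fn_apply hf 0
  rw [head, h]; rfl

theorem ne_of_head {x y : D} (h : head x ≠ head y) : x ≠ y := fun e => h (e ▸ rfl)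

theorem head_mono {x y : D} (h : x ≤ y) : x = ⊥ ∨ head x = head y := by
  have h1 : Step.le (α := Stage 0) (x.1 1) (y.1 1) := h 1
  have key : ∀ a b : Step (Stage 0), Step.le a b → tag a = 0 ∨ tag a = tag b := by
    intro a b hab
    cases a <;> cases b <;> simp_all [Step.le, tag]
  rcases key _ _ h1 with h0 | h0
  · left
    refine ext_succ fun n => ?_
    have hx := x.2 1 (n + 1) (by omega)
    rw [trans_succ] at hx
    -- Projection to stage 1 keeps the outermost constructor, so `⊥` at stage 1 forces `⊥` at every
    -- later stage.
    have : ∀ (a : Step (Stage n)) (b : Step (Stage 0)),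
        Step.map (trans n 0) (trans 0 n) a = b → tag b = 0 → a = Step.bot := by
      rintro a b rfl hb
      cases a <;> simp_all [Step.map, tag]
    exact this _ _ hx h0
  · exact Or.inr h0

theorem tag_apply (x : D) (n : ℕ) : tag (α := Stage n) (x.1 (n + 1)) = head x := by
  have hx := x.2 1 (n + 1) (by omega)
  rw [trans_succ] at hx
  rw [head, ← hx]
  generalize x.1 (n + 1) = a
  change tag a = tag (Step.map (trans n 0) (trans 0 n) a)
  cases a <;> rfl

theorem eq_of_tag {α : Type} [PartialOrder α] (b : Step α) :
    (tag b = 0 → b = .bot) ∧ (tag b = 1 → b = .nil) ∧ (tag b = 2 → ∃ a, b = .left a) ∧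
    (tag b = 3 → ∃ a, b = .right a) ∧ (tag b = 4 → ∃ a c, b = .pair a c) ∧
    (tag b = 5 → ∃ a c, b = .amb a c) ∧ (tag b = 6 → ∃ a, b = .fn a) := by
  cases b <;> simp [tag]

theorem eq_left_of_head {x : D} (h : head x = 2) : ∃ a, x = left a := by
  have : ∀ n, ∃ a : Stage n, x.1 (n + 1) = (Step.left a : Step (Stage n)) :=
    fun n => (eq_of_tag _).2.2.1 ((tag_apply x n).trans h)
  choose a ha using this
  refine ⟨⟨a, fun n m hnm => ?_⟩, ext_succ ha⟩
  have hx := x.2 (n + 1) (m + 1) (by omega)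
  rw [trans_succ, ha, ha] at hx
  exact Step.left.inj hx

theorem eq_right_of_head {x : D} (h : head x = 3) : ∃ a, x = right a := by
  have : ∀ n, ∃ a : Stage n, x.1 (n + 1) = (Step.right a : Step (Stage n)) :=
    fun n => (eq_of_tag _).2.2.2.1 ((tag_apply x n).trans h)
  choose a ha using this
  refine ⟨⟨a, fun n m hnm => ?_⟩, ext_succ ha⟩
  have hx := x.2 (n + 1) (m + 1) (by omega)
  rw [trans_succ, ha, ha] at hx
  exact Step.right.inj hx

theorem eq_pair_of_head {x : D} (h : head x = 4) : ∃ a b, x = pair a b := by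
  have : ∀ n, ∃ a b : Stage n, x.1 (n + 1) = (Step.pair a b : Step (Stage n)) :=
    fun n => (eq_of_tag _).2.2.2.2.1 ((tag_apply x n).trans h)
  choose a b ha using this
  refine ⟨⟨a, fun n m hnm => ?_⟩, ⟨b, fun n m hnm => ?_⟩, ext_succ ha⟩ <;>
  · have hx := x.2 (n + 1) (m + 1) (by omega)
    rw [trans_succ, ha, ha] at hx
    first
      | exact (Step.pair.inj hx).1
      | exact (Step.pair.inj hx).2

theorem eq_amb_of_head {x : D} (h : head x = 5) : ∃ a b, x = amb a b := by
  have : ∀ n, ∃ a b : Stage n, x.1 (n + 1) = (Step.amb a b : Step (Stage n)) :=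
    fun n => (eq_of_tag _).2.2.2.2.2.1 ((tag_apply x n).trans h)
  choose a b ha using this
  refine ⟨⟨a, fun n m hnm => ?_⟩, ⟨b, fun n m hnm => ?_⟩, ext_succ ha⟩ <;>
  · have hx := x.2 (n + 1) (m + 1) (by omega)
    rw [trans_succ, ha, ha] at hx
    first
      | exact (Step.amb.inj hx).1
      | exact (Step.amb.inj hx).2

theorem eq_nil_of_head {x : D} (h : head x = 1) : x = nil := by
  refine ext_succ fun n => ?_
  exact (eq_of_tag _).2.1 ((tag_apply x n).trans h)

theorem eq_bot_of_head {x : D} (h : head x = 0) : x = ⊥ := by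
  refine ext_succ fun n => ?_
  exact (eq_of_tag _).1 ((tag_apply x n).trans h)

theorem eq_fn_of_head {x : D} (h : head x = 6) : ∃ f, ScottContinuous f ∧ x = fn f := by
  have : ∀ n, ∃ a : Stage n →o Stage n, x.1 (n + 1) = (Step.fn a : Step (Stage n)) :=
    fun n => (eq_of_tag _).2.2.2.2.2.2 ((tag_apply x n).trans h)
  choose g hg using this
  have hcoh : ∀ n m, n ≤ m → ∀ a, trans m n (g m (trans n m a)) = g n a := by
    intro n m hnm a
    have hx := x.2 (n + 1) (m + 1) (by omega)
    rw [trans_succ, hg, hg] at hx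
    exact DFunLike.congr_fun (Step.fn.inj hx) a
  -- The value at `b` as far as the table `g n` knows it. Coherence of the tables makes this
  -- increasing in `n`, and the function sought is its supremum.
  let c : D → ℕ → D := fun b n => emb n (g n (b.1 n))
  have hc : ∀ b, Monotone (c b) := by
    intro b n m hnm
    have h1 : g n (b.1 n) ≤ trans m n (g m (b.1 m)) := by
      rw [← hcoh n m hnm]
      exact (trans m n).monotone ((g m).monotone (pr_le n b m))
    refine (emb_mono n h1).trans ?_
    have h2 : trans m n (g m (b.1 m)) = (c b m).1 n := rfl
    rw [h2]
    exact pr_le n _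
  have hdir : ∀ b, DirectedOn (· ≤ ·) (Set.range (c b)) := by
    rintro b _ ⟨m, rfl⟩ _ ⟨k, rfl⟩
    exact ⟨_, ⟨max m k, rfl⟩, hc b (le_max_left _ _), hc b (le_max_right _ _)⟩
  choose f hf hf' using fun b => exists_isLUB (Set.range_nonempty (c b)) (hdir b)
  have hmono : Monotone f := by
    intro b b' hb
    refine (hf b).2 ?_
    rintro _ ⟨m, rfl⟩
    exact le_trans (emb_mono m ((g m).monotone (hb m))) ((hf b').1 ⟨m, rfl⟩)
  have hcont : ScottContinuous f := by
    refine scottContinuous_iff.2 ⟨hmono, fun b n => ?_⟩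
    obtain ⟨_, ⟨m, rfl⟩, hm⟩ := hf' b n
    refine ⟨m, ?_⟩
    rw [hm]
    have : c b m = c (pr m b) m := by
      change emb m (g m (b.1 m)) = emb m (g m ((pr m b).1 m))
      rw [pr_apply_self]
    rw [this]
    exact (hf (pr m b)).1 ⟨m, rfl⟩ n
  refine ⟨f, hcont, ext_succ fun n => ?_⟩
  obtain ⟨g', hg', h'⟩ := fn_apply hcont n
  rw [h', hg]
  congr 1
  ext a
  rw [hg']
  refine le_antisymm ?_ ?_
  · have h1 := (hf (emb n a)).1 ⟨n, rfl⟩ n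
    refine le_trans (le_of_eq ?_) h1
    change g n a = trans n n (g n (trans n n a))
    rw [hcoh n n le_rfl]
  · obtain ⟨_, ⟨m, rfl⟩, hm⟩ := hf' (emb n a) n
    rw [hm]
    refine (hc _ (le_max_left m n) n).trans (le_of_eq ?_)
    exact hcoh n _ (le_max_right m n) a

theorem eq_cases (x : D) : x = ⊥ ∨ x = nil ∨ (∃ a, x = left a) ∨ (∃ a, x = right a) ∨
    (∃ a b, x = pair a b) ∨ (∃ a b, x = amb a b) ∨ ∃ f, ScottContinuous f ∧ x = fn f := by
  have h : head x ≤ 6 := by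
    unfold head
    generalize x.1 1 = b
    change Step (Stage 0) at b
    change tag b ≤ 6
    cases b <;> simp [tag]
  interval_cases hx : head x
  · exact .inl (eq_bot_of_head hx)
  · exact .inr (.inl (eq_nil_of_head hx))
  · exact .inr (.inr (.inl (eq_left_of_head hx)))
  · exact .inr (.inr (.inr (.inl (eq_right_of_head hx))))
  · exact .inr (.inr (.inr (.inr (.inl (eq_pair_of_head hx)))))
  · exact .inr (.inr (.inr (.inr (.inr (.inl (eq_amb_of_head hx))))))
  · exact .inr (.inr (.inr (.inr (.inr (.inr (eq_fn_of_head hx))))))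

end D
end CFP

namespace CFP
namespace D

/-! ### Projections of constructors, and elements above a constructor. -/

theorem head_pr_succ (m : ℕ) (x : D) : head (pr (m + 1) x) = head x :=
  congrArg (tag (α := Stage 0)) (pr_apply_of_le (m := 1) (n := m + 1) (by omega) x)

theorem pr_succ_nil (m : ℕ) : pr (m + 1) nil = nil := eq_nil_of_head (head_pr_succ m nil)

theorem pr_succ_left (m : ℕ) (x : D) : pr (m + 1) (left x) = left (pr m x) :=
  ext_succ fun n => by change trans (m + 1) (n + 1) _ = _; rw [trans_succ]; rfl

theorem pr_succ_right (m : ℕ) (x : D) : pr (m + 1) (right x) = right (pr m x) :=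
  ext_succ fun n => by change trans (m + 1) (n + 1) _ = _; rw [trans_succ]; rfl

theorem pr_succ_pair (m : ℕ) (x y : D) : pr (m + 1) (pair x y) = pair (pr m x) (pr m y) :=
  ext_succ fun n => by change trans (m + 1) (n + 1) _ = _; rw [trans_succ]; rfl

theorem pr_succ_amb (m : ℕ) (x y : D) : pr (m + 1) (amb x y) = amb (pr m x) (pr m y) :=
  ext_succ fun n => by change trans (m + 1) (n + 1) _ = _; rw [trans_succ]; rfl

theorem head_eq_of_le {x y : D} (h : x ≤ y) (hx : head x ≠ 0) : head y = head x := by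
  rcases head_mono h with rfl | h
  · exact absurd head_bot hx
  · exact h.symm

theorem nil_le_iff {y : D} : nil ≤ y ↔ y = nil :=
  ⟨fun h => eq_nil_of_head (head_eq_of_le h (by simp)), fun h => h.ge⟩

theorem exists_of_left_le {x y : D} (h : left x ≤ y) : ∃ z, y = left z ∧ x ≤ z := by
  obtain ⟨z, rfl⟩ := eq_left_of_head (head_eq_of_le h (by simp))
  exact ⟨z, rfl, left_le.1 h⟩

theorem exists_of_right_le {x y : D} (h : right x ≤ y) : ∃ z, y = right z ∧ x ≤ z := by
  obtain ⟨z, rfl⟩ := eq_right_of_head (head_eq_of_le h (by simp))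
  exact ⟨z, rfl, right_le.1 h⟩

theorem exists_of_pair_le {x x' y : D} (h : pair x x' ≤ y) :
    ∃ z z', y = pair z z' ∧ x ≤ z ∧ x' ≤ z' := by
  obtain ⟨z, z', rfl⟩ := eq_pair_of_head (head_eq_of_le h (by simp))
  exact ⟨z, z', rfl, pair_le.1 h⟩

theorem exists_of_amb_le {x x' y : D} (h : amb x x' ≤ y) :
    ∃ z z', y = amb z z' ∧ x ≤ z ∧ x' ≤ z' := by
  obtain ⟨z, z', rfl⟩ := eq_amb_of_head (head_eq_of_le h (by simp))
  exact ⟨z, z', rfl, amb_le.1 h⟩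

theorem exists_of_fn_le {f : D → D} (hf : ScottContinuous f) {y : D} (h : fn f ≤ y) :
    ∃ g, ScottContinuous g ∧ y = fn g ∧ f ≤ g := by
  obtain ⟨g, hg, rfl⟩ := eq_fn_of_head ((head_eq_of_le h (by simp [head_fn hf])).trans (head_fn hf))
  exact ⟨g, hg, rfl, (fn_le hf hg).1 h⟩

/-! ### Application, recursion and case distinction -/

theorem app_fn {f : D → D} (hf : ScottContinuous f) (x : D) : app (fn f) x = f x := by
  have h : ∃ g, ScottContinuous g ∧ fn f = fn g := ⟨f, hf, rfl⟩
  rw [app, dif_pos h]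
  exact congrFun ((fn_inj h.choose_spec.1 hf).1 h.choose_spec.2.symm) x

theorem app_of_head_ne {x : D} (h : head x ≠ 6) (y : D) : app x y = ⊥ := by
  rw [app, dif_neg]
  rintro ⟨f, hf, rfl⟩
  exact h (head_fn hf)

theorem app_mono {x x' y y' : D} (h : x ≤ x') (h' : y ≤ y') : app x y ≤ app x' y' := by
  by_cases hx : head x = 6
  · obtain ⟨f, hf, rfl⟩ := eq_fn_of_head hx
    obtain ⟨g, hg, rfl, hfg⟩ := exists_of_fn_le hf h
    rw [app_fn hf, app_fn hg]
    exact (hfg y).trans (hg.monotone h')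
  · rw [app_of_head_ne hx]
    exact bot_le

theorem app_approx (x y : D) (n : ℕ) : ∃ m, (app x y).1 n ≤ (app (pr m x) (pr m y)).1 n := by
  by_cases hx : head x = 6
  · obtain ⟨f, hf, rfl⟩ := eq_fn_of_head hx
    obtain ⟨m, hm⟩ := (scottContinuous_iff.1 hf).2 y n
    set k := max m n
    -- One stage more than `k`: stage `k + 1` of a function is its table on stage `k`.
    refine ⟨k + 1, ?_⟩
    obtain ⟨g, hg, hgx⟩ := eq_fn_of_head ((head_pr_succ k (fn f)).trans (head_fn hf))
    rw [hgx, app_fn hf, app_fn hg]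
    obtain ⟨f', hf', hf''⟩ := fn_apply hf k
    obtain ⟨g', hg', hg''⟩ := fn_apply hg k
    have h1 : (fn g).1 (k + 1) = (fn f).1 (k + 1) := by rw [← hgx, pr_apply_self]
    rw [hf'', hg''] at h1
    have h2 : (f (emb k (y.1 k))).1 k = (g (emb k (y.1 k))).1 k := by
      rw [← hf', ← hg', Step.fn.inj h1]
    have h3 : (f (pr k y)).1 n ≤ (g (pr k y)).1 n := apply_le_of_le (le_max_right m n) h2.le
    exact hm.trans ((hf.monotone (pr_le_pr (le_max_left m n) y) n).trans
      (h3.trans (hg.monotone (pr_le_pr (Nat.le_succ k) y) n)))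
  · rw [app_of_head_ne hx]
    exact ⟨0, (bot_le : (⊥ : D) ≤ _) n⟩

theorem scottContinuous_app (x : D) : ScottContinuous (app x) := by
  refine scottContinuous_iff.2 ⟨fun _ _ h => app_mono le_rfl h, fun y n => ?_⟩
  obtain ⟨m, hm⟩ := app_approx x y n
  exact ⟨m, hm.trans (app_mono (pr_le m x) le_rfl n)⟩

/-- The Kleene chain of `app x`. -/
noncomputable def iter (x : D) (k : ℕ) : D := (app x)^[k] ⊥

theorem iter_succ (x : D) (k : ℕ) : iter x (k + 1) = app x (iter x k) :=
  Function.iterate_succ_apply' _ _ _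

theorem iter_mono (x : D) : Monotone (iter x) := by
  refine monotone_nat_of_le_succ fun k => ?_
  induction k with
  | zero => exact bot_le
  | succ k ih =>
    rw [iter_succ x k, iter_succ x (k + 1)]
    exact app_mono le_rfl ih

theorem iter_le {x y z : D} (h : x ≤ y) (hz : app y z ≤ z) (k : ℕ) : iter x k ≤ z := by
  induction k with
  | zero => exact bot_le
  | succ k ih =>
    rw [iter_succ]
    exact (app_mono h ih).trans hz

/-- Kleene's theorem: the least fixed point is the supremum of the iterates from `⊥`. That every
stage is reached by some iterate later reduces continuity of `fix` to that of `iter`. -/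
theorem exists_fix (x : D) : ∃ d, IsLeast {y | app x y = y} d ∧ ∀ n, ∃ k, d.1 n = (iter x k).1 n := by
  have hdir : DirectedOn (· ≤ ·) (Set.range (iter x)) := by
    rintro _ ⟨m, rfl⟩ _ ⟨k, rfl⟩
    exact ⟨_, ⟨max m k, rfl⟩, iter_mono x (le_max_left _ _), iter_mono x (le_max_right _ _)⟩
  obtain ⟨d, hd, hd'⟩ := exists_isLUB (Set.range_nonempty (iter x)) hdir
  have h1 := scottContinuous_app x (Set.range_nonempty (iter x)) hdir hd
  refine ⟨d, ⟨h1.unique ⟨?_, fun u hu => hd.2 ?_⟩, fun z hz => hd.2 ?_⟩, fun n => ?_⟩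
  · rintro _ ⟨_, ⟨k, rfl⟩, rfl⟩
    exact hd.1 ⟨k + 1, iter_succ x k⟩
  · rintro _ ⟨k, rfl⟩
    exact (iter_mono x (Nat.le_succ k)).trans (hu ⟨_, ⟨k, rfl⟩, (iter_succ x k).symm⟩)
  · rintro _ ⟨k, rfl⟩
    exact iter_le le_rfl (le_of_eq hz) k
  · obtain ⟨_, ⟨k, rfl⟩, hk⟩ := hd' n
    exact ⟨k, hk⟩

theorem isLeast_fix (x : D) : IsLeast {y | app x y = y} (fix x) := by
  have h : ∃ d, IsLeast {y | app x y = y} d := (exists_fix x).imp fun _ h => h.1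
  rw [fix, dif_pos h]
  exact h.choose_spec

theorem app_fix (x : D) : app x (fix x) = fix x := (isLeast_fix x).1

theorem exists_fix_apply (x : D) (n : ℕ) : ∃ k, (fix x).1 n = (iter x k).1 n := by
  obtain ⟨d, hd, h⟩ := exists_fix x
  rw [(isLeast_fix x).unique hd]
  exact h n

theorem iter_le_fix {x y : D} (h : x ≤ y) (k : ℕ) : iter x k ≤ fix y := iter_le h (app_fix y).le k

theorem fix_mono : Monotone fix := fun x y h n => by
  obtain ⟨k, hk⟩ := exists_fix_apply x n
  rw [hk]
  exact iter_le_fix h k n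

section cases
variable (cnil : D) (cleft cright : D → D) (cpair camb : D → D → D) (cfun : D → D)

@[simp] theorem cases_bot : cases ⊥ cnil cleft cright cpair camb cfun = ⊥ := by
  have h1 : (⊥ : D) ≠ nil := ne_of_head (by simp)
  have h2 : ¬ ∃ a, (⊥ : D) = left a := by rintro ⟨a, h⟩; exact ne_of_head (by simp) h
  have h3 : ¬ ∃ a, (⊥ : D) = right a := by rintro ⟨a, h⟩; exact ne_of_head (by simp) h
  have h4 : ¬ ∃ p : D × D, (⊥ : D) = pair p.1 p.2 := by
    rintro ⟨a, h⟩; exact ne_of_head (by simp) h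
  have h5 : ¬ ∃ p : D × D, (⊥ : D) = amb p.1 p.2 := by
    rintro ⟨a, h⟩; exact ne_of_head (by simp) h
  have h6 : ¬ ∃ f, ScottContinuous f ∧ (⊥ : D) = fn f := by
    rintro ⟨f, hf, h⟩; exact ne_of_head (by simp [head_fn hf]) h
  rw [cases, if_neg h1, dif_neg h2, dif_neg h3, dif_neg h4, dif_neg h5, if_neg h6]

@[simp] theorem cases_nil : cases nil cnil cleft cright cpair camb cfun = cnil := by
  rw [cases, if_pos rfl]

@[simp] theorem cases_left (x : D) : cases (left x) cnil cleft cright cpair camb cfun = cleft x := by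
  have h1 : left x ≠ nil := ne_of_head (by simp)
  have h2 : ∃ a, left x = left a := ⟨x, rfl⟩
  rw [cases, if_neg h1, dif_pos h2, ← left_inj.1 h2.choose_spec]

@[simp] theorem cases_right (x : D) :
    cases (right x) cnil cleft cright cpair camb cfun = cright x := by
  have h1 : right x ≠ nil := ne_of_head (by simp)
  have h2 : ¬ ∃ a, right x = left a := by rintro ⟨a, h⟩; exact ne_of_head (by simp) h
  have h3 : ∃ a, right x = right a := ⟨x, rfl⟩
  rw [cases, if_neg h1, dif_neg h2, dif_pos h3, ← right_inj.1 h3.choose_spec]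

@[simp] theorem cases_pair (x y : D) :
    cases (pair x y) cnil cleft cright cpair camb cfun = cpair x y := by
  have h1 : pair x y ≠ nil := ne_of_head (by simp)
  have h2 : ¬ ∃ a, pair x y = left a := by rintro ⟨a, h⟩; exact ne_of_head (by simp) h
  have h3 : ¬ ∃ a, pair x y = right a := by rintro ⟨a, h⟩; exact ne_of_head (by simp) h
  have h4 : ∃ p : D × D, pair x y = pair p.1 p.2 := ⟨(x, y), rfl⟩
  rw [cases, if_neg h1, dif_neg h2, dif_neg h3, dif_pos h4, ← (pair_inj.1 h4.choose_spec).1,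
    ← (pair_inj.1 h4.choose_spec).2]

@[simp] theorem cases_amb (x y : D) :
    cases (amb x y) cnil cleft cright cpair camb cfun = camb x y := by
  have h1 : amb x y ≠ nil := ne_of_head (by simp)
  have h2 : ¬ ∃ a, amb x y = left a := by rintro ⟨a, h⟩; exact ne_of_head (by simp) h
  have h3 : ¬ ∃ a, amb x y = right a := by rintro ⟨a, h⟩; exact ne_of_head (by simp) h
  have h4 : ¬ ∃ p : D × D, amb x y = pair p.1 p.2 := by
    rintro ⟨a, h⟩; exact ne_of_head (by simp) h
  have h5 : ∃ p : D × D, amb x y = amb p.1 p.2 := ⟨(x, y), rfl⟩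
  rw [cases, if_neg h1, dif_neg h2, dif_neg h3, dif_neg h4, dif_pos h5,
    ← (amb_inj.1 h5.choose_spec).1, ← (amb_inj.1 h5.choose_spec).2]

theorem cases_fn {f : D → D} (hf : ScottContinuous f) :
    cases (fn f) cnil cleft cright cpair camb cfun = cfun (fn f) := by
  have hh := head_fn hf
  have h1 : fn f ≠ nil := ne_of_head (by simp [hh])
  have h2 : ¬ ∃ a, fn f = left a := by rintro ⟨a, h⟩; exact ne_of_head (by simp [hh]) h
  have h3 : ¬ ∃ a, fn f = right a := by rintro ⟨a, h⟩; exact ne_of_head (by simp [hh]) h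
  have h4 : ¬ ∃ p : D × D, fn f = pair p.1 p.2 := by
    rintro ⟨a, h⟩; exact ne_of_head (by simp [hh]) h
  have h5 : ¬ ∃ p : D × D, fn f = amb p.1 p.2 := by
    rintro ⟨a, h⟩; exact ne_of_head (by simp [hh]) h
  rw [cases, if_neg h1, dif_neg h2, dif_neg h3, dif_neg h4, dif_neg h5, if_pos ⟨f, hf, rfl⟩]

end cases

theorem cases_mono {x x' : D} {cnil cnil' : D} {cleft cleft' cright cright' : D → D}
    {cpair cpair' camb camb' : D → D → D} {cfun cfun' : D → D} (h : x ≤ x') (h1 : cnil ≤ cnil')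
    (h2 : ∀ a b, a ≤ b → cleft a ≤ cleft' b) (h3 : ∀ a b, a ≤ b → cright a ≤ cright' b)
    (h4 : ∀ a b c d, a ≤ b → c ≤ d → cpair a c ≤ cpair' b d)
    (h5 : ∀ a b c d, a ≤ b → c ≤ d → camb a c ≤ camb' b d) (h6 : ∀ a b, a ≤ b → cfun a ≤ cfun' b) :
    cases x cnil cleft cright cpair camb cfun ≤ cases x' cnil' cleft' cright' cpair' camb' cfun' := by
  rcases eq_cases x with rfl | rfl | ⟨a, rfl⟩ | ⟨a, rfl⟩ | ⟨a, b, rfl⟩ | ⟨a, b, rfl⟩ | ⟨f, hf, rfl⟩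
  · rw [cases_bot]; exact bot_le
  · rw [nil_le_iff.1 h, cases_nil, cases_nil]; exact h1
  · obtain ⟨z, rfl, hz⟩ := exists_of_left_le h
    rw [cases_left, cases_left]; exact h2 _ _ hz
  · obtain ⟨z, rfl, hz⟩ := exists_of_right_le h
    rw [cases_right, cases_right]; exact h3 _ _ hz
  · obtain ⟨z, z', rfl, hz, hz'⟩ := exists_of_pair_le h
    rw [cases_pair, cases_pair]; exact h4 _ _ _ _ hz hz'
  · obtain ⟨z, z', rfl, hz, hz'⟩ := exists_of_amb_le h
    rw [cases_amb, cases_amb]; exact h5 _ _ _ _ hz hz'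
  · obtain ⟨g, hg, rfl, _⟩ := exists_of_fn_le hf h
    rw [cases_fn _ _ _ _ _ _ hf, cases_fn _ _ _ _ _ _ hg]; exact h6 _ _ h

/-! ### Continuity of the denotation of programs -/

/-- The projection of an environment. -/
def prEnv {k : ℕ} (m : ℕ) (η : Fin k → D) : Fin k → D := fun i => pr m (η i)

/-- Continuity of maps from environments to the domain. -/
structure EnvCont {k : ℕ} (f : (Fin k → D) → D) : Prop where
  mono : Monotone f
  approx : ∀ η n, ∃ m, (f η).1 n ≤ (f (prEnv m η)).1 n

section EnvCont
variable {k : ℕ} {f g : (Fin k → D) → D}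

theorem prEnv_le (m : ℕ) (η : Fin k → D) : prEnv m η ≤ η := fun i => pr_le m (η i)

theorem prEnv_le_prEnv {m n : ℕ} (h : m ≤ n) (η : Fin k → D) : prEnv m η ≤ prEnv n η :=
  fun i => pr_le_pr h (η i)

theorem extend_mono {η η' : Fin k → D} (h : η ≤ η') {d d' : D} (hd : d ≤ d') :
    extend η d ≤ extend η' d' := by
  intro i
  refine Fin.cases ?_ (fun i => ?_) i
  · exact hd
  · exact h i

theorem prEnv_extend (m : ℕ) (η : Fin k → D) (d : D) :
    prEnv m (extend η d) = extend (prEnv m η) (pr m d) := by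
  funext i
  refine Fin.cases ?_ (fun i => ?_) i <;> rfl

theorem EnvCont.pr_le (hf : EnvCont f) (η : Fin k → D) (n : ℕ) :
    ∃ m, ∀ m' ≥ m, pr n (f η) ≤ f (prEnv m' η) := by
  obtain ⟨m, hm⟩ := hf.approx η n
  refine ⟨m, fun m' h => ?_⟩
  exact (emb_mono n (hm.trans (hf.mono (prEnv_le_prEnv h η) n))).trans (D.pr_le n _)

/-- The finite parts of both arguments that `op` needs are themselves reached from a finite part of
the environment; the larger of the two bounds serves for both. -/
theorem EnvCont.comp₂ {op : D → D → D} (hop : ∀ x x' y y', x ≤ x' → y ≤ y' → op x y ≤ op x' y')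
    (happ : ∀ x y n, ∃ m, (op x y).1 n ≤ (op (pr m x) (pr m y)).1 n)
    (hf : EnvCont f) (hg : EnvCont g) : EnvCont fun η => op (f η) (g η) := by
  refine ⟨fun _ _ h => hop _ _ _ _ (hf.mono h) (hg.mono h), fun η n => ?_⟩
  obtain ⟨m, hm⟩ := happ (f η) (g η) n
  obtain ⟨m1, h1⟩ := hf.pr_le η m
  obtain ⟨m2, h2⟩ := hg.pr_le η m
  exact ⟨max m1 m2, hm.trans (hop _ _ _ _ (h1 _ (le_max_left _ _)) (h2 _ (le_max_right _ _)) n)⟩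

theorem EnvCont.comp₁ {op : D → D} (hop : Monotone op)
    (happ : ∀ x n, ∃ m, (op x).1 n ≤ (op (pr m x)).1 n) (hf : EnvCont f) :
    EnvCont fun η => op (f η) :=
  EnvCont.comp₂ (op := fun x _ => op x) (fun _ _ _ _ h _ => hop h) (fun x _ n => happ x n) hf hf

theorem envCont_const (d : D) : EnvCont fun _ : Fin k → D => d :=
  ⟨fun _ _ _ => le_rfl, fun _ _ => ⟨0, le_rfl⟩⟩

theorem envCont_var (i : Fin k) : EnvCont fun η : Fin k → D => η i :=
  ⟨fun _ _ h => h i, fun η n => ⟨n, (pr_apply_self n (η i)).ge⟩⟩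

theorem EnvCont.scottContinuous {f : (Fin (k + 1) → D) → D} (hf : EnvCont f) (η : Fin k → D) :
    ScottContinuous fun d => f (extend η d) := by
  refine scottContinuous_iff.2 ⟨fun _ _ h => hf.mono (extend_mono le_rfl h), fun d n => ?_⟩
  obtain ⟨m, hm⟩ := hf.approx (extend η d) n
  rw [prEnv_extend] at hm
  exact ⟨m, hm.trans (hf.mono (extend_mono (prEnv_le m η) le_rfl) n)⟩

theorem EnvCont.lam {f : (Fin (k + 1) → D) → D} (hf : EnvCont f) :
    EnvCont fun η => fn fun d => f (extend η d) := by
  refine ⟨fun η η' h => (fn_le (hf.scottContinuous _) (hf.scottContinuous _)).2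
    fun d => hf.mono (extend_mono h le_rfl), ?_⟩
  rintro η (_ | n)
  · exact ⟨0, trivial⟩
  -- A table at stage `n + 1` has finitely many entries, one for each element of stage `n`, so a
  -- single bound `M` works for all of them.
  · choose m hm using fun a => hf.approx (extend η (emb n a)) n
    obtain ⟨M, hM⟩ := (Set.finite_range m).bddAbove
    refine ⟨M, ?_⟩
    obtain ⟨g, hg, hg'⟩ := fn_apply (hf.scottContinuous η) n
    obtain ⟨g1, hg1, hg1'⟩ := fn_apply (hf.scottContinuous (prEnv M η)) n
    rw [hg', hg1']
    intro a
    rw [hg, hg1]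
    refine (hm a).trans (hf.mono ?_ n)
    rw [prEnv_extend]
    exact extend_mono (prEnv_le_prEnv (hM ⟨a, rfl⟩) η) (D.pr_le _ _)

theorem EnvCont.iter (hf : EnvCont f) (j : ℕ) : EnvCont fun η => iter (f η) j := by
  induction j with
  | zero => exact envCont_const ⊥
  | succ j ih =>
    simp only [iter_succ]
    exact hf.comp₂ (fun _ _ _ _ => app_mono) app_approx ih

theorem EnvCont.fix (hf : EnvCont f) : EnvCont fun η => fix (f η) := by
  refine ⟨fun _ _ h => fix_mono (hf.mono h), fun η n => ?_⟩
  obtain ⟨j, hj⟩ := exists_fix_apply (f η) n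
  obtain ⟨m, hm⟩ := (hf.iter j).approx η n
  rw [hj]
  exact ⟨m, hm.trans (iter_le_fix le_rfl j n)⟩

theorem EnvCont.cases {cnil : (Fin k → D) → D} {cleft cright cfun : (Fin (k + 1) → D) → D}
    {cpair camb : (Fin (k + 2) → D) → D} (hf : EnvCont f) (h1 : EnvCont cnil) (h2 : EnvCont cleft)
    (h3 : EnvCont cright) (h4 : EnvCont cpair) (h5 : EnvCont camb) (h6 : EnvCont cfun) :
    EnvCont fun η => cases (f η) (cnil η) (fun a => cleft (extend η a)) (fun a => cright (extend η a))
      (fun a b => cpair (extend (extend η a) b)) (fun a b => camb (extend (extend η a) b))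
      (fun a => cfun (extend η a)) := by
  have hmono : ∀ {η η' : Fin k → D} {x x' : D}, η ≤ η' → x ≤ x' →
      D.cases x (cnil η) (fun a => cleft (extend η a)) (fun a => cright (extend η a))
        (fun a b => cpair (extend (extend η a) b)) (fun a b => camb (extend (extend η a) b))
        (fun a => cfun (extend η a)) ≤
      D.cases x' (cnil η') (fun a => cleft (extend η' a)) (fun a => cright (extend η' a))
        (fun a b => cpair (extend (extend η' a) b)) (fun a b => camb (extend (extend η' a) b))
        (fun a => cfun (extend η' a)) := fun h hx => cases_mono hx (h1.mono h)
      (fun _ _ h' => h2.mono (extend_mono h h')) (fun _ _ h' => h3.mono (extend_mono h h'))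
      (fun _ _ _ _ h' h'' => h4.mono (extend_mono (extend_mono h h') h''))
      (fun _ _ _ _ h' h'' => h5.mono (extend_mono (extend_mono h h') h''))
      (fun _ _ h' => h6.mono (extend_mono h h'))
  refine ⟨fun _ _ h => hmono h (hf.mono h), fun η n => ?_⟩
  -- The scrutinee is projected one stage later than the environment, since projecting a constructor
  -- at `m + 1` projects its arguments at `m`.
  have key : ∃ m, (D.cases (f η) (cnil η) (fun a => cleft (extend η a))
      (fun a => cright (extend η a)) (fun a b => cpair (extend (extend η a) b))
      (fun a b => camb (extend (extend η a) b)) (fun a => cfun (extend η a))).1 n ≤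
      (D.cases (pr (m + 1) (f η)) (cnil (prEnv m η)) (fun a => cleft (extend (prEnv m η) a))
      (fun a => cright (extend (prEnv m η) a)) (fun a b => cpair (extend (extend (prEnv m η) a) b))
      (fun a b => camb (extend (extend (prEnv m η) a) b))
      (fun a => cfun (extend (prEnv m η) a))).1 n := by
    rcases eq_cases (f η) with h | h | ⟨a, h⟩ | ⟨a, h⟩ | ⟨a, b, h⟩ | ⟨a, b, h⟩ | ⟨g, hg, h⟩ <;> rw [h]
    · rw [cases_bot]
      exact ⟨0, (bot_le : (⊥ : D) ≤ _) n⟩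
    · obtain ⟨m, hm⟩ := h1.approx η n
      refine ⟨m, ?_⟩
      rwa [pr_succ_nil, cases_nil, cases_nil]
    · obtain ⟨m, hm⟩ := h2.approx (extend η a) n
      refine ⟨m, ?_⟩
      rwa [pr_succ_left, cases_left, cases_left, ← prEnv_extend]
    · obtain ⟨m, hm⟩ := h3.approx (extend η a) n
      refine ⟨m, ?_⟩
      rwa [pr_succ_right, cases_right, cases_right, ← prEnv_extend]
    · obtain ⟨m, hm⟩ := h4.approx (extend (extend η a) b) n
      refine ⟨m, ?_⟩
      rwa [pr_succ_pair, cases_pair, cases_pair, ← prEnv_extend, ← prEnv_extend]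
    · obtain ⟨m, hm⟩ := h5.approx (extend (extend η a) b) n
      refine ⟨m, ?_⟩
      rwa [pr_succ_amb, cases_amb, cases_amb, ← prEnv_extend, ← prEnv_extend]
    · obtain ⟨m, hm⟩ := h6.approx (extend η (fn g)) n
      refine ⟨m, ?_⟩
      obtain ⟨g', hg', h'⟩ := eq_fn_of_head ((head_pr_succ m (fn g)).trans (head_fn hg))
      rw [h', cases_fn _ _ _ _ _ _ hg, cases_fn _ _ _ _ _ _ hg', ← h']
      rw [prEnv_extend] at hm
      exact hm.trans (h6.mono (extend_mono le_rfl (pr_le_pr (Nat.le_succ m) _)) n)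
  obtain ⟨m, hm⟩ := key
  obtain ⟨m1, h1'⟩ := hf.pr_le η (m + 1)
  exact ⟨max m m1, hm.trans (hmono (prEnv_le_prEnv (le_max_left _ _) η) (h1' _ (le_max_right _ _)) n)⟩

end EnvCont

theorem parNil_mono {x x' y y' : D} (h : x ≤ x') (h' : y ≤ y') : parNil x y ≤ parNil x' y' := by
  unfold parNil
  by_cases hx : x = nil ∨ y = nil
  · have : x' = nil ∨ y' = nil := by
      rcases hx with rfl | rfl
      · exact .inl (nil_le_iff.1 h)
      · exact .inr (nil_le_iff.1 h')
    rw [if_pos hx, if_pos this]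
  · rw [if_neg hx]
    exact bot_le

theorem parNil_approx (x y : D) (n : ℕ) : ∃ m, (parNil x y).1 n ≤ (parNil (pr m x) (pr m y)).1 n := by
  refine ⟨1, ?_⟩
  unfold parNil
  by_cases hx : x = nil ∨ y = nil
  · have : pr 1 x = nil ∨ pr 1 y = nil := by
      rcases hx with rfl | rfl
      · exact .inl (pr_succ_nil 0)
      · exact .inr (pr_succ_nil 0)
    rw [if_pos hx, if_pos this]
  · rw [if_neg hx]
    exact (bot_le : (⊥ : D) ≤ _) n

end D

-- This is what makes `lam` meaningful: `D.fn` sends a discontinuous map to `⊥`.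
open D in
theorem Program.envCont_den : {k : ℕ} → (M : Program k) → EnvCont M.den
  | _, .var i => envCont_var i
  | _, .bot => envCont_const ⊥
  | _, .nil => envCont_const D.nil
  | _, .left M => M.envCont_den.comp₁ (fun _ _ h => left_le.2 h) fun x n =>
      ⟨n + 1, (pr_apply_of_le (Nat.le_succ n) (D.left x)).ge.trans (by
        rw [pr_succ_left]
        exact left_le.2 (pr_le_pr (Nat.le_succ n) x) n)⟩
  | _, .right M => M.envCont_den.comp₁ (fun _ _ h => right_le.2 h) fun x n =>
      ⟨n + 1, (pr_apply_of_le (Nat.le_succ n) (D.right x)).ge.trans (by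
        rw [pr_succ_right]
        exact right_le.2 (pr_le_pr (Nat.le_succ n) x) n)⟩
  | _, .pair M N => M.envCont_den.comp₂ (fun _ _ _ _ h h' => pair_le.2 ⟨h, h'⟩) (fun x y n =>
      ⟨n + 1, (pr_apply_of_le (Nat.le_succ n) (D.pair x y)).ge.trans (by
        rw [pr_succ_pair]
        exact pair_le.2 ⟨pr_le_pr (Nat.le_succ n) x, pr_le_pr (Nat.le_succ n) y⟩ n)⟩)
      N.envCont_den
  | _, .amb M N => M.envCont_den.comp₂ (fun _ _ _ _ h h' => amb_le.2 ⟨h, h'⟩) (fun x y n =>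
      ⟨n + 1, (pr_apply_of_le (Nat.le_succ n) (D.amb x y)).ge.trans (by
        rw [pr_succ_amb]
        exact amb_le.2 ⟨pr_le_pr (Nat.le_succ n) x, pr_le_pr (Nat.le_succ n) y⟩ n)⟩)
      N.envCont_den
  | _, .lam M => M.envCont_den.lam
  | _, .app M N => M.envCont_den.comp₂ (fun _ _ _ _ => app_mono) app_approx N.envCont_den
  | _, .fix M => M.envCont_den.fix
  | _, .cases M N1 N2 N3 N4 N5 N6 => M.envCont_den.cases N1.envCont_den N2.envCont_den
      N3.envCont_den N4.envCont_den N5.envCont_den N6.envCont_den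
  | _, .parNil M N => M.envCont_den.comp₂ (fun _ _ _ _ => parNil_mono) parNil_approx N.envCont_den

end CFP

namespace CFP

/-! ## Definability -/

/-- Contexts: types whose elements provide an environment for programs. -/
class Ctx (Γ : Type) where
  /-- the number of variables -/
  size : ℕ
  /-- the environment -/
  env : Γ → Fin size → D

instance : Ctx Unit := ⟨0, fun _ => Fin.elim0⟩

instance {Γ : Type} [Ctx Γ] : Ctx (Γ × D) := ⟨Ctx.size Γ + 1, fun γ => extend (Ctx.env γ.1) γ.2⟩

/-- A context with one more variable. -/
abbrev Push (Γ : Type) : Type := Γ × D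

/-- Maps on a context that are denoted by a program. -/
def Def {Γ : Type} [Ctx Γ] (f : Γ → D) : Prop :=
  ∃ M : Program (Ctx.size Γ), ∀ γ, M.den (Ctx.env γ) = f γ

/-- Elements of the domain that are denoted by a closed program, used in any context. -/
abbrev Closed (d : D) : Prop := ∀ (Γ : Type) [Ctx Γ], Def fun _ : Γ => d

theorem Closed.exists_val {d : D} (h : Closed d) : ∃ M : Program 0, M.val = d :=
  (h Unit).imp fun _ hM => hM ()

theorem Closed.def_const {d : D} (h : Closed d) {Γ : Type} [Ctx Γ] : Def fun _ : Γ => d := h Γ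

namespace Def
variable {Γ : Type} [Ctx Γ]

theorem var0 : Def fun γ : Push Γ => γ.2 :=
  ⟨.var (0 : Fin (Ctx.size Γ + 1)), fun _ => rfl⟩
theorem var1 : Def fun γ : Push (Push Γ) => γ.1.2 :=
  ⟨.var (1 : Fin (Ctx.size Γ + 2)), fun _ => rfl⟩
theorem var2 : Def fun γ : Push (Push (Push Γ)) => γ.1.1.2 :=
  ⟨.var (2 : Fin (Ctx.size Γ + 3)), fun _ => rfl⟩
theorem var3 : Def fun γ : Push (Push (Push (Push Γ))) => γ.1.1.1.2 :=
  ⟨.var (3 : Fin (Ctx.size Γ + 4)), fun _ => rfl⟩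
theorem var4 : Def fun γ : Push (Push (Push (Push (Push Γ)))) => γ.1.1.1.1.2 :=
  ⟨.var (4 : Fin (Ctx.size Γ + 5)), fun _ => rfl⟩
theorem var5 : Def fun γ : Push (Push (Push (Push (Push (Push Γ))))) => γ.1.1.1.1.1.2 :=
  ⟨.var (5 : Fin (Ctx.size Γ + 6)), fun _ => rfl⟩
theorem var6 : Def fun γ : Push (Push (Push (Push (Push (Push (Push Γ)))))) => γ.1.1.1.1.1.1.2 :=
  ⟨.var (6 : Fin (Ctx.size Γ + 7)), fun _ => rfl⟩
theorem var7 : Def fun γ : Push (Push (Push (Push (Push (Push (Push (Push Γ))))))) => γ.1.1.1.1.1.1.1.2 :=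
  ⟨.var (7 : Fin (Ctx.size Γ + 8)), fun _ => rfl⟩
theorem var8 : Def fun γ : Push (Push (Push (Push (Push (Push (Push (Push (Push Γ)))))))) => γ.1.1.1.1.1.1.1.1.2 :=
  ⟨.var (8 : Fin (Ctx.size Γ + 9)), fun _ => rfl⟩
theorem var9 : Def fun γ : Push (Push (Push (Push (Push (Push (Push (Push (Push (Push Γ))))))))) => γ.1.1.1.1.1.1.1.1.1.2 :=
  ⟨.var (9 : Fin (Ctx.size Γ + 10)), fun _ => rfl⟩
theorem var10 : Def fun γ : Push (Push (Push (Push (Push (Push (Push (Push (Push (Push (Push Γ)))))))))) => γ.1.1.1.1.1.1.1.1.1.1.2 :=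
  ⟨.var (10 : Fin (Ctx.size Γ + 11)), fun _ => rfl⟩

theorem bot : Def fun _ : Γ => (⊥ : D) := ⟨.bot, fun _ => rfl⟩
theorem nil : Def fun _ : Γ => D.nil := ⟨.nil, fun _ => rfl⟩

variable {f g : Γ → D}

theorem left : Def f → Def fun γ => D.left (f γ)
  | ⟨M, hM⟩ => ⟨.left M, fun γ => congrArg D.left (hM γ)⟩
theorem right : Def f → Def fun γ => D.right (f γ)
  | ⟨M, hM⟩ => ⟨.right M, fun γ => congrArg D.right (hM γ)⟩
theorem pair : Def f → Def g → Def fun γ => D.pair (f γ) (g γ)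
  | ⟨M, hM⟩, ⟨N, hN⟩ => ⟨.pair M N, fun γ => congrArg₂ D.pair (hM γ) (hN γ)⟩
theorem amb : Def f → Def g → Def fun γ => D.amb (f γ) (g γ)
  | ⟨M, hM⟩, ⟨N, hN⟩ => ⟨.amb M N, fun γ => congrArg₂ D.amb (hM γ) (hN γ)⟩
theorem app : Def f → Def g → Def fun γ => D.app (f γ) (g γ)
  | ⟨M, hM⟩, ⟨N, hN⟩ => ⟨.app M N, fun γ => congrArg₂ D.app (hM γ) (hN γ)⟩
theorem parNil : Def f → Def g → Def fun γ => D.parNil (f γ) (g γ)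
  | ⟨M, hM⟩, ⟨N, hN⟩ => ⟨.parNil M N, fun γ => congrArg₂ D.parNil (hM γ) (hN γ)⟩
theorem fix : Def f → Def fun γ => D.fix (f γ)
  | ⟨M, hM⟩ => ⟨.fix M, fun γ => congrArg D.fix (hM γ)⟩
theorem lam {F : Γ → D → D} : Def (fun p : Γ × D => F p.1 p.2) → Def fun γ => D.fn (F γ)
  | ⟨M, hM⟩ => ⟨.lam M, fun γ => congrArg D.fn (funext fun d => hM (γ, d))⟩

theorem cases {cleft cright cfun : Γ → D → D} {cpair camb : Γ → D → D → D} :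
    Def f → Def g → Def (fun p : Γ × D => cleft p.1 p.2) → Def (fun p : Γ × D => cright p.1 p.2) →
    Def (fun p : (Γ × D) × D => cpair p.1.1 p.1.2 p.2) →
    Def (fun p : (Γ × D) × D => camb p.1.1 p.1.2 p.2) → Def (fun p : Γ × D => cfun p.1 p.2) →
    Def fun γ => D.cases (f γ) (g γ) (cleft γ) (cright γ) (cpair γ) (camb γ) (cfun γ)
  | ⟨M, hM⟩, ⟨M1, h1⟩, ⟨M2, h2⟩, ⟨M3, h3⟩, ⟨M4, h4⟩, ⟨M5, h5⟩, ⟨M6, h6⟩ => by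
    refine ⟨.cases M M1 M2 M3 M4 M5 M6, fun γ => ?_⟩
    have e2 : (fun a => M2.den (extend (Ctx.env γ) a)) = cleft γ := funext fun a => h2 (γ, a)
    have e3 : (fun a => M3.den (extend (Ctx.env γ) a)) = cright γ := funext fun a => h3 (γ, a)
    have e4 : (fun a b => M4.den (extend (extend (Ctx.env γ) a) b)) = cpair γ :=
      funext fun a => funext fun b => h4 ((γ, a), b)
    have e5 : (fun a b => M5.den (extend (extend (Ctx.env γ) a) b)) = camb γ :=
      funext fun a => funext fun b => h5 ((γ, a), b)
    have e6 : (fun a => M6.den (extend (Ctx.env γ) a)) = cfun γ := funext fun a => h6 (γ, a)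
    rw [Program.den, hM, h1, e2, e3, e4, e5, e6]

/-- Continuity of a concrete function is thus obtained by showing that a program denotes it; the
same `Def` proof yields the closed program in the end. -/
theorem scottContinuous {F : Γ → D → D} (h : Def fun p : Γ × D => F p.1 p.2) (γ : Γ) :
    ScottContinuous (F γ) := by
  obtain ⟨M, hM⟩ := h
  have : F γ = fun d => M.den (extend (Ctx.env γ) d) := funext fun d => (hM (γ, d)).symm
  rw [this]
  exact M.envCont_den.scottContinuous _

end Def

/-- A recursively defined function of one argument. -/
noncomputable def rec1 (F : D → D → D) : D := D.fix (D.fn fun s => D.fn fun x => F s x)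

/-- A recursively defined function of two arguments. -/
noncomputable def rec2 (F : D → D → D → D) : D :=
  D.fix (D.fn fun s => D.fn fun x => D.fn fun y => F s x y)

/-- Definability in every context of a function with one parameter. -/
abbrev Def1 (F : D → D → D) : Prop := ∀ (Γ : Type) [Ctx Γ], Def fun p : (Γ × D) × D => F p.1.2 p.2

/-- Definability in every context of a function with two parameters. -/
abbrev Def2 (F : D → D → D → D) : Prop :=
  ∀ (Γ : Type) [Ctx Γ], Def fun p : ((Γ × D) × D) × D => F p.1.1.2 p.1.2 p.2

theorem Def1.scottContinuous {F : D → D → D} (h : Def1 F) (x : D) : ScottContinuous (F x) :=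
  Def.scottContinuous (Γ := Unit × D) (F := fun p d => F p.2 d) (h Unit) ((), x)

theorem Def1.beta {F : D → D → D} (h : Def1 F) (x y : D) : D.app (D.fn (F x)) y = F x y :=
  D.app_fn (h.scottContinuous x) y

theorem Def2.scottContinuous {F : D → D → D → D} (h : Def2 F) (x y : D) :
    ScottContinuous (F x y) :=
  Def.scottContinuous (Γ := (Unit × D) × D) (F := fun p d => F p.1.2 p.2 d) (h Unit) (((), x), y)

theorem Def2.beta {F : D → D → D → D} (h : Def2 F) (x y z : D) :
    D.app (D.fn (F x y)) z = F x y z :=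
  D.app_fn (h.scottContinuous x y) z

theorem closed_rec1 {F : D → D → D} (h : Def1 F) : Closed (rec1 F) := fun Γ _ =>
  Def.fix (Def.lam (Def.lam (h Γ)))

theorem closed_rec2 {F : D → D → D → D} (h : Def2 F) : Closed (rec2 F) := fun Γ _ =>
  Def.fix (Def.lam (Def.lam (Def.lam (h Γ))))

/-- The fixed point equation for `rec1 F` followed by two β-steps, both licensed by definability. -/
theorem app_rec1 {F : D → D → D} (h : Def1 F) (x : D) : D.app (rec1 F) x = F (rec1 F) x := by
  have h1 : ScottContinuous fun s => D.fn fun x => F s x :=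
    Def.scottContinuous (Γ := Unit) (F := fun _ s => D.fn fun x => F s x) (Def.lam (h Unit)) ()
  have h2 : rec1 F = D.fn fun x => F (rec1 F) x := by
    conv_lhs => rw [rec1, ← D.app_fix, D.app_fn h1]
    rfl
  conv_lhs => rw [h2, h.beta]

theorem app_rec2 {F : D → D → D → D} (h : Def2 F) (x y : D) :
    D.app (D.app (rec2 F) x) y = F (rec2 F) x y := by
  have h1 : ScottContinuous fun s => D.fn fun x => D.fn fun y => F s x y :=
    Def.scottContinuous (Γ := Unit) (F := fun _ s => D.fn fun x => D.fn fun y => F s x y)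
      (Def.lam (Def.lam (h Unit))) ()
  have h2 : rec2 F = D.fn fun x => D.fn fun y => F (rec2 F) x y := by
    conv_lhs => rw [rec2, ← D.app_fix, D.app_fn h1]
    rfl
  have h3 : ScottContinuous fun x => D.fn fun y => F (rec2 F) x y :=
    Def.scottContinuous (Γ := Unit × D) (F := fun p x => D.fn fun y => F p.2 x y)
      (Def.lam (h Unit)) ((), rec2 F)
  conv_lhs => rw [h2, D.app_fn h3, h.beta]

/-! ## Programs -/

/-- Case distinction with only a clause for `nil`. -/
noncomputable def guard (t x : D) : D :=
  D.cases t x (fun _ => ⊥) (fun _ => ⊥) (fun _ _ => ⊥) (fun _ _ => ⊥) fun _ => ⊥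

/-- Case distinction on the constructors `left` and `right`. -/
noncomputable def caseLR (x : D) (l r : D → D) : D :=
  D.cases x ⊥ l r (fun _ _ => ⊥) (fun _ _ => ⊥) fun _ => ⊥

/-- Case distinction with only a clause for `pair`. -/
noncomputable def casePair (x : D) (f : D → D → D) : D :=
  D.cases x ⊥ (fun _ => ⊥) (fun _ => ⊥) f (fun _ _ => ⊥) fun _ => ⊥

/-- Case distinction with only a clause for `amb`. -/
noncomputable def caseAmb (x : D) (f : D → D → D) : D :=
  D.cases x ⊥ (fun _ => ⊥) (fun _ => ⊥) (fun _ _ => ⊥) f fun _ => ⊥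

/-- Case distinction on a signed digit: the values for `-1`, `0` and `1`. -/
noncomputable def caseD (d m z p : D) : D :=
  caseLR d (fun u => caseLR u (fun _ => m) fun _ => p) fun _ => z

/-! ### Queries

A query about a real number `x` asks whether `tent^[k] x ≤ 0` or `tent^[k] x ≥ 0`. A query about a
set asks such a question about the minimum or the maximum of a set obtained from it by taking the
tent map of its negative or non-negative part repeatedly. -/

/-- The query about the sign: `x ≤ 0` for `true`, `x ≥ 0` for `false`. -/
def qSgn : Bool → D
  | true => D.left D.nil
  | false => D.right D.nil

/-- The query about the tent map of the number. -/
def qTail (r : D) : D := D.pair r D.nil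

/-- The query about the minimum (`true`) or the maximum (`false`) of the set. -/
def qExt : Bool → D → D
  | true, r => D.left r
  | false, r => D.right r

/-- The query about the tent map of the non-positive (`true`) or non-negative (`false`) part. -/
def qSub : Bool → D → D
  | true, q => D.pair q D.nil
  | false, q => D.amb q D.nil

/-- For queries about numbers: `n` and `p` are the results for the questions "≤ 0" and "≥ 0", `t`
handles a query about the tent image. -/
noncomputable def caseR (r n p : D) (t : D → D) : D :=
  D.cases r ⊥ (fun _ => n) (fun _ => p) (fun a _ => t a) (fun _ _ => ⊥) fun _ => ⊥

/-- For queries about sets: minimum, maximum, and the images of the two halves. Here `amb` is merely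
a fourth tag and expresses no concurrency. -/
noncomputable def caseS (q : D) (mn mx sl sr : D → D) : D :=
  D.cases q ⊥ mn mx (fun a _ => sl a) (fun a _ => sr a) fun _ => ⊥

/-- The query about `x` that corresponds to a query about `-x`. -/
noncomputable def flipR (r : D) : D := caseR r (qSgn false) (qSgn true) qTail

/-- The query about `K` that corresponds to a query about `-K`. -/
noncomputable def flipS (q : D) : D :=
  caseS q (fun r => qExt false (flipR r)) (fun r => qExt true (flipR r)) (qSub false) (qSub true)

/-! ### Parallel search -/

/-- An undefined component of an `Amb` node cannot block the other one, because the two searches are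
joined by the parallel test. -/
noncomputable def searchF (s φ m : D) : D :=
  caseAmb m fun a b =>
    D.parNil (caseLR a (fun u => D.app φ u) fun m' => D.app (D.app s φ) m')
      (caseLR b (fun u => D.app φ u) fun m' => D.app (D.app s φ) m')

theorem def2_searchF : Def2 searchF := by
  intro Γ _
  simp only [searchF, caseAmb, caseLR]
  repeat' with_reducible first
    | exact Def.var0 | exact Def.var1 | exact Def.var2 | exact Def.var3 | exact Def.var4
    | exact Def.var5 | exact Def.bot | exact Def.nil | apply Def.cases | apply Def.app
    | apply Def.parNil

/-- `search φ m` is `nil` iff the test `φ` succeeds at some leaf of the tree `m` of candidates. -/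
noncomputable def search (φ m : D) : D := D.app (D.app (rec2 searchF) φ) m

theorem search_eq (φ m : D) : search φ m = caseAmb m fun a b =>
    D.parNil (caseLR a (fun u => D.app φ u) fun m' => search φ m')
      (caseLR b (fun u => D.app φ u) fun m' => search φ m') := app_rec2 def2_searchF φ m

end CFP

namespace CFP

/-! ### From signed-digit trees to answers to queries -/

/-- The smaller (`true`) or the larger (`false`) of two signed digits. -/
noncomputable def pick : Bool → D → D → D
  | true, a, c => caseD a a (caseD c c a a) c
  | false, a, c => caseD a c (caseD c a a c) a

noncomputable def digF (b : Bool) (s e : D) : D :=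
  caseLR e (fun d => d) fun u => casePair u fun e' d => pick b d (D.app s e')

theorem def1_digF (b : Bool) : Def1 (digF b) := by
  intro Γ _
  cases b <;>
  simp only [digF, pick, casePair, caseLR, caseD] <;>
  repeat' with_reducible first
    | exact Def.var0 | exact Def.var1 | exact Def.var2 | exact Def.var3 | exact Def.var4
    | exact Def.var5 | exact Def.var6 | exact Def.var7 | exact Def.var8 | exact Def.var9
    | exact Def.var10 | exact Def.bot | exact Def.nil
    | apply Def.cases | apply Def.app

/-- The least (`true`) or the greatest (`false`) element of a non-empty list of signed digits. -/
noncomputable def dig (b : Bool) (e : D) : D := D.app (rec1 (digF b)) e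

theorem dig_eq (b : Bool) (e : D) :
    dig b e = caseLR e (fun d => d) fun u => casePair u fun e' d => pick b d (dig b e') :=
  app_rec1 (def1_digF b) e

/-- Answers about `x` from a digit `d` and answers `κ` about `2 * x - d`. -/
noncomputable def nodeR (d : D) (κ : D → D) (r : D) : D :=
  caseD d (caseR r D.nil ⊥ fun r' => κ r')
    (caseR r (κ (qSgn true)) (κ (qSgn false)) fun r' =>
      caseR r' ⊥ D.nil fun r'' => κ (qTail (flipR r'')))
    (caseR r ⊥ D.nil fun r' => κ (flipR r'))

/-- Answers about `T` from answers `κ` about `2 * T - 1`, given answers `one` about `{1}`. -/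
noncomputable def nodeS (one κ : D → D) (q : D) : D :=
  caseS q (fun r => caseR r ⊥ D.nil fun r' => κ (qExt true (flipR r')))
    (fun r => caseR r ⊥ D.nil fun r' => κ (qExt false (flipR r')))
    one fun q' => κ (flipS q')

/-- The set {1} reproduces itself under x ↦ 2x - 1, so its answers can be defined by recursion from
`nodeS` alone. -/
noncomputable def oneF (s q : D) : D := nodeS (D.app s) (D.app s) q

theorem def1_oneF : Def1 oneF := by
  intro Γ _
  simp only [oneF, nodeS, caseS, caseR, flipS, flipR, qExt, qSub, qSgn, qTail]
  repeat' with_reducible first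
    | exact Def.var0 | exact Def.var1 | exact Def.var2 | exact Def.var3 | exact Def.var4
    | exact Def.var5 | exact Def.var6 | exact Def.var7 | exact Def.var8 | exact Def.var9
    | exact Def.var10 | exact Def.bot | exact Def.nil
    | apply Def.cases | apply Def.left | apply Def.right | apply Def.pair | apply Def.amb
    | apply Def.app

/-- Answers to queries about `{1}`. -/
noncomputable def one (q : D) : D := D.app (rec1 oneF) q

theorem one_eq (q : D) : one q = nodeS one one q := app_rec1 def1_oneF q

/-- Answers from a set of digits `e` and trees `h` for the corresponding parts of the set. -/
noncomputable def leafQ (s : D) (q u : D) : D :=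
  casePair u fun e h => caseS q
    (fun r => nodeR (dig true e)
      (fun r' => D.app (D.app s (D.app h (dig true e))) (qExt true r')) r)
    (fun r => nodeR (dig false e)
      (fun r' => D.app (D.app s (D.app h (dig false e))) (qExt false r')) r)
    (fun q' => caseD (dig true e)
      (D.app (D.app s (D.app h (dig true e))) q')
      (nodeS one (fun z => D.app (D.app s (D.app h (dig true e))) (qSub true z)) q')
      (one q'))
    (fun q' => caseD (dig false e)
      (one q')
      (nodeS one (fun z => D.app (D.app s (D.app h (dig false e))) (qSub false z)) q')
      (D.app (D.app s (D.app h (dig false e))) (flipS q')))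

theorem def2_leafQ : Def2 leafQ := by
  intro Γ _
  simp only [leafQ, dig, one, nodeS, nodeR, casePair, caseD, caseLR, caseS, caseR, flipS,
    flipR, qExt, qSub, qSgn, qTail]
  repeat' with_reducible first
    | exact Def.var0 | exact Def.var1 | exact Def.var2 | exact Def.var3 | exact Def.var4
    | exact Def.var5 | exact Def.var6 | exact Def.var7 | exact Def.var8 | exact Def.var9
    | exact Def.var10 | exact Def.bot | exact Def.nil
    | exact (closed_rec1 (def1_digF _)).def_const | exact (closed_rec1 def1_oneF).def_const
    | apply Def.cases | apply Def.left | apply Def.right | apply Def.pair | apply Def.amb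
    | apply Def.app

/-- The function `leafQ`, as an element of the domain. -/
noncomputable def leafV : D := D.fn fun s => D.fn fun q => D.fn fun u => leafQ s q u

theorem closed_leafV : Closed leafV := fun Γ _ => Def.lam (Def.lam (Def.lam (def2_leafQ Γ)))

theorem app_leafV (s q u : D) : D.app (D.app (D.app leafV s) q) u = leafQ s q u := by
  have h1 : ScottContinuous fun s => D.fn fun q => D.fn fun u => leafQ s q u :=
    Def.scottContinuous (Γ := Unit) (F := fun _ s => D.fn fun q => D.fn fun u => leafQ s q u)
      (Def.lam (Def.lam (def2_leafQ Unit))) ()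
  have h2 : ScottContinuous fun q => D.fn fun u => leafQ s q u :=
    Def.scottContinuous (Γ := Unit × D) (F := fun p q => D.fn fun u => leafQ p.2 q u)
      (Def.lam (def2_leafQ Unit)) ((), s)
  rw [leafV, D.app_fn h1, D.app_fn h2, def2_leafQ.beta]

noncomputable def treeF (s m q : D) : D := search (D.app (D.app leafV s) q) m

theorem def2_treeF : Def2 treeF := by
  intro Γ _
  simp only [treeF, search]
  repeat' with_reducible first
    | exact Def.var0 | exact Def.var1 | exact Def.var2 | exact closed_leafV.def_const
    | exact (closed_rec2 def2_searchF).def_const | apply Def.app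

/-- Answers to the query `q` from a signed-digit tree `m`. -/
noncomputable def treeQ (m q : D) : D := D.app (D.app (rec2 treeF) m) q

theorem treeQ_eq (m q : D) : treeQ m q = search (D.app (D.app leafV (rec2 treeF)) q) m :=
  app_rec2 def2_treeF m q

/-! ### From answers to queries to Gray code trees -/

/-- Each `Amb` component remains `⊥` until its sign test succeeds, so no wrong sign is ever offered.
-/
noncomputable def grayF (s ρ : D) : D :=
  D.pair
    (D.amb (guard (D.app ρ (qSgn true)) (D.left (D.left D.nil)))
      (guard (D.app ρ (qSgn false)) (D.left (D.right D.nil))))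
    (D.app s (D.fn fun r => D.app ρ (qTail r)))

theorem def1_grayF : Def1 grayF := by
  intro Γ _
  simp only [grayF, guard, qSgn, qTail]
  repeat' with_reducible first
    | exact Def.var0 | exact Def.var1 | exact Def.var2 | exact Def.bot | exact Def.nil
    | apply Def.cases | apply Def.left | apply Def.right | apply Def.pair | apply Def.amb
    | apply Def.app | apply Def.lam

/-- The Gray code of a real number from answers `ρ`. -/
noncomputable def gray (ρ : D) : D := D.app (rec1 grayF) ρ

theorem gray_eq (ρ : D) : gray ρ = D.pair
    (D.amb (guard (D.app ρ (qSgn true)) (D.left (D.left D.nil)))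
      (guard (D.app ρ (qSgn false)) (D.left (D.right D.nil))))
    (gray (D.fn fun r => D.app ρ (qTail r))) := app_rec1 def1_grayF ρ

/-- The function on Gray digits whose values are given by the answers `κ` for the two parts. -/
noncomputable def grayFun (s κ d : D) : D :=
  caseLR d (fun _ => D.app s (D.fn fun q => D.app κ (qSub true q)))
    fun _ => D.app s (D.fn fun q => D.app κ (qSub false q))

noncomputable def grayTreeF (s κ : D) : D :=
  D.pair (gray (D.fn fun r => D.app κ (qExt true r)))
    (D.pair (gray (D.fn fun r => D.app κ (qExt false r))) (D.fn fun d => grayFun s κ d))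

theorem def2_grayFun : Def2 grayFun := by
  intro Γ _
  simp only [grayFun, caseLR, qSub]
  repeat' with_reducible first
    | exact Def.var0 | exact Def.var1 | exact Def.var2 | exact Def.var3 | exact Def.var4
    | exact Def.bot | exact Def.nil | apply Def.cases | apply Def.pair | apply Def.amb
    | apply Def.app | apply Def.lam

theorem def1_grayTreeF : Def1 grayTreeF := by
  intro Γ _
  simp only [grayTreeF, gray, qExt]
  repeat' with_reducible first
    | exact Def.var0 | exact Def.var1 | exact Def.var2 | exact (closed_rec1 def1_grayF).def_const
    | exact Def.lam (def2_grayFun _) | apply Def.left | apply Def.right | apply Def.pair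
    | apply Def.app | apply Def.lam

/-- The Gray code tree of a set from answers `κ`. -/
noncomputable def grayTree (κ : D) : D := D.app (rec1 grayTreeF) κ

theorem grayTree_eq (κ : D) : grayTree κ = D.pair (gray (D.fn fun r => D.app κ (qExt true r)))
    (D.pair (gray (D.fn fun r => D.app κ (qExt false r)))
      (D.fn fun d => grayFun (rec1 grayTreeF) κ d)) := app_rec1 def1_grayTreeF κ

/-! ### From Gray code trees to answers to queries -/

/-- The test whether a sign candidate is the given sign. -/
noncomputable def isSgn : Bool → D → D
  | true, u => caseLR u (fun _ => D.nil) fun _ => ⊥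
  | false, u => caseLR u (fun _ => ⊥) fun _ => D.nil

noncomputable def grayAnsF (s g r : D) : D :=
  casePair g fun m g' => caseR r (search (D.fn fun u => isSgn true u) m)
    (search (D.fn fun u => isSgn false u) m) fun r' => D.app (D.app s g') r'

theorem def2_grayAnsF : Def2 grayAnsF := by
  intro Γ _
  simp only [grayAnsF, casePair, caseR, search, isSgn, caseLR]
  repeat' with_reducible first
    | exact Def.var0 | exact Def.var1 | exact Def.var2 | exact Def.var3 | exact Def.var4
    | exact Def.var5 | exact Def.var6 | exact Def.bot | exact Def.nil
    | exact (closed_rec2 def2_searchF).def_const | apply Def.cases | apply Def.app | apply Def.lam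

/-- Answers to queries about a real number from its Gray code. -/
noncomputable def grayAns (g r : D) : D := D.app (D.app (rec2 grayAnsF) g) r

theorem grayAns_eq (g r : D) : grayAns g r = casePair g fun m g' =>
    caseR r (search (D.fn fun u => isSgn true u) m) (search (D.fn fun u => isSgn false u) m)
      fun r' => grayAns g' r' := app_rec2 def2_grayAnsF g r

noncomputable def grayTreeAnsF (s g q : D) : D :=
  casePair g fun a w => casePair w fun b f => caseS q (fun r => grayAns a r) (fun r => grayAns b r)
    (fun q' => D.app (D.app s (D.app f (D.left D.nil))) q')
    fun q' => D.app (D.app s (D.app f (D.right D.nil))) q'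

theorem def2_grayTreeAnsF : Def2 grayTreeAnsF := by
  intro Γ _
  simp only [grayTreeAnsF, casePair, caseS, grayAns]
  repeat' with_reducible first
    | exact Def.var0 | exact Def.var1 | exact Def.var2 | exact Def.var3 | exact Def.var4
    | exact Def.var5 | exact Def.var6 | exact Def.var7 | exact Def.var8 | exact Def.bot
    | exact Def.nil | exact (closed_rec2 def2_grayAnsF).def_const | apply Def.cases
    | apply Def.left | apply Def.right | apply Def.app

/-- Answers to queries about a set from its Gray code tree. -/
noncomputable def grayTreeAns (g q : D) : D := D.app (D.app (rec2 grayTreeAnsF) g) q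

theorem grayTreeAns_eq (g q : D) : grayTreeAns g q = casePair g fun a w => casePair w fun b f =>
    caseS q (fun r => grayAns a r) (fun r => grayAns b r) (fun q' => grayTreeAns (D.app f (D.left D.nil)) q')
      fun q' => grayTreeAns (D.app f (D.right D.nil)) q' := app_rec2 def2_grayTreeAnsF g q

theorem grayAns_pair (m g r : D) : grayAns (D.pair m g) r =
    caseR r (search (D.fn fun u => isSgn true u) m) (search (D.fn fun u => isSgn false u) m)
      fun r' => grayAns g r' := by
  rw [grayAns_eq, casePair, D.cases_pair]

theorem grayTreeAns_pair (a b f q : D) : grayTreeAns (D.pair a (D.pair b f)) q =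
    caseS q (fun r => grayAns a r) (fun r => grayAns b r)
      (fun q' => grayTreeAns (D.app f (D.left D.nil)) q')
      fun q' => grayTreeAns (D.app f (D.right D.nil)) q' := by
  rw [grayTreeAns_eq, casePair, D.cases_pair, casePair, D.cases_pair]

/-! ### From answers to queries to signed-digit trees -/

/-- The parallel disjunction of the tests of a list. -/
noncomputable def anyNil : List (D × D) → D
  | [] => ⊥
  | p :: l => D.parNil p.1 (anyNil l)

/-- The concurrent choice between the second components of a list, guarded by the first ones. -/
noncomputable def choice : List (D × D) → D
  | [] => ⊥
  | p :: l => D.amb (guard p.1 (D.left p.2)) (guard (anyNil l) (D.right (choice l)))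

/-- The code of the signed digit `-1`. -/
def dNeg : D := D.left (D.left D.nil)
/-- The code of the signed digit `0`. -/
def dZero : D := D.right D.nil
/-- The code of the signed digit `1`. -/
def dPos : D := D.left (D.right D.nil)

/-- Answers about `2 * x` from answers `ρ` about `x`, for `|x| ≤ 1 / 2`. -/
noncomputable def dblR (ρ : D → D) (r : D) : D :=
  caseR r (ρ (qSgn true)) (ρ (qSgn false)) fun r' => ρ (qTail (qTail (flipR r')))

/-- Answers about `2 * K_0` from answers `κ` about `K`. The flags tell whether the minimum and the
maximum of `K` belong to `K_0`; otherwise those of `K_0` belong to the non-positive and the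
non-negative part. -/
noncomputable def midQ (bmin bmax : Bool) (κ q : D) : D :=
  caseS q
    (fun r => match bmin with
      | true => dblR (fun z => D.app κ (qExt true z)) r
      | false => caseR r D.nil ⊥ fun r' =>
          D.app κ (qSub true (qSub false (qExt false (flipR r')))))
    (fun r => match bmax with
      | true => dblR (fun z => D.app κ (qExt false z)) r
      | false => caseR r ⊥ D.nil fun r' =>
          D.app κ (qSub false (qSub false (qExt false (flipR r')))))
    (fun q' => D.app κ (qSub true (qSub false (flipS q'))))
    fun q' => D.app κ (qSub false (qSub false (flipS q')))

theorem def1_midQ (bmin bmax : Bool) : Def1 (midQ bmin bmax) := by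
  intro Γ _
  cases bmin <;> cases bmax <;>
  simp only [midQ, dblR, caseS, caseR, flipS, flipR, qExt, qSub, qSgn, qTail]
  all_goals
    repeat' with_reducible first
      | exact Def.var0 | exact Def.var1 | exact Def.var2 | exact Def.var3 | exact Def.var4
      | exact Def.var5 | exact Def.var6 | exact Def.var7 | exact Def.bot | exact Def.nil
      | apply Def.cases | apply Def.left | apply Def.right | apply Def.pair | apply Def.amb
      | apply Def.app

/-- The function `midQ`, as an element of the domain. -/
noncomputable def midV (bmin bmax : Bool) : D := D.fn fun κ => D.fn fun q => midQ bmin bmax κ q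

theorem closed_midV (bmin bmax : Bool) : Closed (midV bmin bmax) := fun Γ _ =>
  Def.lam (Def.lam (def1_midQ bmin bmax Γ))

theorem app_midV (bmin bmax : Bool) (κ q : D) :
    D.app (D.app (midV bmin bmax) κ) q = midQ bmin bmax κ q := by
  have h1 : ScottContinuous fun κ => D.fn fun q => midQ bmin bmax κ q :=
    Def.scottContinuous (Γ := Unit) (F := fun _ κ => D.fn fun q => midQ bmin bmax κ q)
      (Def.lam (def1_midQ bmin bmax Unit)) ()
  rw [midV, D.app_fn h1, (def1_midQ bmin bmax).beta]

/-- The function on signed digits whose values are given by the answers `κ` for the parts. -/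
noncomputable def digitFun (bmin bmax : Bool) (s κ d : D) : D :=
  caseD d (D.app s (D.fn fun q => D.app κ (qSub true q)))
    (D.app s (D.app (midV bmin bmax) κ))
    (D.app s (D.fn fun q => D.app κ (qSub false (flipS q))))

/-- The possible choices for the set of digits, with the condition for making them. -/
noncomputable def digitChoices (s κ : D) : List (D × D) :=
  [(D.app κ (qExt false (qSgn true)),
      D.pair (D.left dNeg) (D.fn fun d => digitFun true true s κ d)),
    (D.app κ (qExt true (qSgn false)),
      D.pair (D.left dPos) (D.fn fun d => digitFun true true s κ d)),
    (guard (D.app κ (qExt true (qSgn true))) (D.app κ (qExt false (qSgn false))),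
      D.pair (D.right (D.pair (D.left dNeg) dPos)) (D.fn fun d => digitFun true true s κ d)),
    (guard (D.app κ (qExt true (qTail (qSgn false)))) (D.app κ (qExt false (qTail (qSgn false)))),
      D.pair (D.left dZero) (D.fn fun d => digitFun true true s κ d)),
    (guard (D.app κ (qExt true (qSgn true))) (guard (D.app κ (qExt false (qTail (qSgn false))))
        (D.app κ (qSub true (qExt false (qSgn false))))),
      D.pair (D.right (D.pair (D.left dNeg) dZero)) (D.fn fun d => digitFun false true s κ d)),
    (guard (D.app κ (qExt false (qSgn false))) (guard (D.app κ (qExt true (qTail (qSgn false))))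
        (D.app κ (qSub false (qExt false (qSgn false))))),
      D.pair (D.right (D.pair (D.left dZero) dPos)) (D.fn fun d => digitFun true false s κ d))]

theorem def2_digitFun (bmin bmax : Bool) : Def2 (digitFun bmin bmax) := by
  intro Γ _
  simp only [digitFun, caseD, caseLR, caseS, caseR, flipS, flipR, qExt, qSub, qSgn, qTail]
  repeat' with_reducible first
    | exact Def.var0 | exact Def.var1 | exact Def.var2 | exact Def.var3 | exact Def.var4
    | exact Def.var5 | exact Def.var6 | exact Def.var7 | exact Def.bot | exact Def.nil
    | exact (closed_midV _ _).def_const | apply Def.cases | apply Def.left | apply Def.right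
    | apply Def.pair | apply Def.amb | apply Def.app | apply Def.lam

noncomputable def digitTreeF (s κ : D) : D := choice (digitChoices s κ)

theorem def1_digitTreeF : Def1 digitTreeF := by
  intro Γ _
  simp only [digitTreeF, digitChoices, choice, anyNil, guard, qExt, qSub, qSgn, qTail, dNeg, dZero,
    dPos]
  repeat' with_reducible first
    | exact Def.var0 | exact Def.var1 | exact Def.var2 | exact Def.var3 | exact Def.var4
    | exact Def.bot | exact Def.nil | exact Def.lam (def2_digitFun _ _ _)
    | apply Def.cases | apply Def.left | apply Def.right
    | apply Def.pair | apply Def.amb | apply Def.parNil | apply Def.app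

/-- The signed-digit tree of a set from answers `κ`. -/
noncomputable def digitTree (κ : D) : D := D.app (rec1 digitTreeF) κ

theorem digitTree_eq (κ : D) : digitTree κ = choice (digitChoices (rec1 digitTreeF) κ) :=
  app_rec1 def1_digitTreeF κ

/-- The translation of signed-digit trees into Gray code trees. -/
noncomputable def toGray : D := D.fn fun m => grayTree (D.fn fun q => treeQ m q)

/-- The translation of Gray code trees into signed-digit trees. -/
noncomputable def toDigit : D := D.fn fun g => digitTree (D.fn fun q => grayTreeAns g q)

theorem def1_treeQ : Def1 treeQ := by
  intro Γ _
  simp only [treeQ]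
  repeat' with_reducible first
    | exact Def.var0 | exact Def.var1 | exact (closed_rec2 def2_treeF).def_const | apply Def.app

theorem def1_grayTreeAns : Def1 grayTreeAns := by
  intro Γ _
  simp only [grayTreeAns]
  repeat' with_reducible first
    | exact Def.var0 | exact Def.var1 | exact (closed_rec2 def2_grayTreeAnsF).def_const
    | apply Def.app

theorem def_grayTree_treeQ {Γ : Type} [Ctx Γ] :
    Def fun γ : Γ × D => grayTree (D.fn fun q => treeQ γ.2 q) :=
  Def.app (closed_rec1 def1_grayTreeF).def_const (Def.lam (def1_treeQ Γ))

theorem def_digitTree_grayTreeAns {Γ : Type} [Ctx Γ] :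
    Def fun γ : Γ × D => digitTree (D.fn fun q => grayTreeAns γ.2 q) :=
  Def.app (closed_rec1 def1_digitTreeF).def_const (Def.lam (def1_grayTreeAns Γ))

theorem closed_toGray : Closed toGray := fun _ _ => Def.lam def_grayTree_treeQ

theorem closed_toDigit : Closed toDigit := fun _ _ => Def.lam def_digitTree_grayTreeAns

theorem scottContinuous_toGray : ScottContinuous fun m => grayTree (D.fn fun q => treeQ m q) :=
  Def.scottContinuous (Γ := Unit) (F := fun _ m => grayTree (D.fn fun q => treeQ m q))
    def_grayTree_treeQ ()

theorem scottContinuous_toDigit :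
    ScottContinuous fun g => digitTree (D.fn fun q => grayTreeAns g q) :=
  Def.scottContinuous (Γ := Unit) (F := fun _ g => digitTree (D.fn fun q => grayTreeAns g q))
    def_digitTree_grayTreeAns ()

end CFP

namespace CFP

/-! ## Realisers and types -/

open Formula

theorem subset_fixTy {α : Type} {Φ : (α → Formula) → α → Formula} {t : Set D}
    (h : t ⊆ ⋃ x, (Φ (fun _ => ⟨True, t, ∅⟩) x).ty) : t ⊆ fixTy Φ :=
  Set.subset_sUnion_of_mem h

theorem mem_nu_ty {α : Type} {Φ : (α → Formula) → α → Formula} {x : α} {t : Set D}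
    (h : t ⊆ ⋃ x, (Φ (fun _ => ⟨True, t, ∅⟩) x).ty) {a : D} (ha : a ∈ t) : a ∈ (nu Φ x).ty :=
  subset_fixTy h ha

/-- Knaster–Tarski: `fixTy Φ` is the largest post-fixed set, and for a monotone operator one more
application again gives a post-fixed set. -/
theorem fixTy_fold {α : Type} {Φ : (α → Formula) → α → Formula}
    (hm : ∀ s t : Set D, s ⊆ t → (⋃ x, (Φ (fun _ => ⟨True, s, ∅⟩) x).ty) ⊆
      ⋃ x, (Φ (fun _ => ⟨True, t, ∅⟩) x).ty) :
    (⋃ x, (Φ (fun _ => ⟨True, fixTy Φ, ∅⟩) x).ty) ⊆ fixTy Φ := by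
  have h : fixTy Φ ⊆ ⋃ x, (Φ (fun _ => ⟨True, fixTy Φ, ∅⟩) x).ty := by
    rintro a ⟨t, ht, ha⟩
    exact hm _ _ (subset_fixTy ht) (ht ha)
  exact subset_fixTy (hm _ _ h)

namespace D

@[simp] theorem bot_ne_nil : (⊥ : D) ≠ nil := ne_of_head (by simp)
@[simp] theorem left_ne_bot (x : D) : left x ≠ ⊥ := ne_of_head (by simp)
@[simp] theorem right_ne_bot (x : D) : right x ≠ ⊥ := ne_of_head (by simp)

@[simp] theorem parNil_eq_nil {x y : D} : parNil x y = nil ↔ x = nil ∨ y = nil := by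
  unfold parNil
  split_ifs with h <;> simp [h]

end D

@[simp] theorem guard_nil (x : D) : guard D.nil x = x := by simp [guard]

theorem guard_eq_bot_or (t x : D) : guard t x = ⊥ ∨ t = D.nil := by
  unfold guard
  rcases D.eq_cases t with rfl | rfl | ⟨a, rfl⟩ | ⟨a, rfl⟩ | ⟨a, b, rfl⟩ | ⟨a, b, rfl⟩ | ⟨f, hf, rfl⟩ <;>
    simp [D.cases_fn, *]

theorem guard_cases (t x : D) : guard t x = ⊥ ∨ t = D.nil ∧ guard t x = x := by
  rcases guard_eq_bot_or t x with h | h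
  · exact .inl h
  · exact .inr ⟨h, by rw [h, guard_nil]⟩

theorem guard_eq_nil {t x : D} : guard t x = D.nil ↔ t = D.nil ∧ x = D.nil := by
  constructor
  · intro h
    rcases guard_cases t x with h' | ⟨h1, h2⟩
    · rw [h'] at h
      exact absurd h D.bot_ne_nil
    · exact ⟨h1, h2 ▸ h⟩
  · rintro ⟨rfl, rfl⟩
    exact guard_nil _

@[simp] theorem caseLR_bot (l r : D → D) : caseLR ⊥ l r = ⊥ := by simp [caseLR]
@[simp] theorem caseLR_left (l r : D → D) (x : D) : caseLR (D.left x) l r = l x := by simp [caseLR]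
@[simp] theorem caseLR_right (l r : D → D) (x : D) : caseLR (D.right x) l r = r x := by
  simp [caseLR]
@[simp] theorem casePair_pair (f : D → D → D) (x y : D) : casePair (D.pair x y) f = f x y := by
  simp [casePair]
@[simp] theorem caseAmb_amb (f : D → D → D) (x y : D) : caseAmb (D.amb x y) f = f x y := by
  simp [caseAmb]

/-- A case distinction yields `⊥` or one of the values for its clauses. -/
theorem caseLR_cases (x : D) (l r : D → D) :
    caseLR x l r = ⊥ ∨ (∃ a, caseLR x l r = l a) ∨ ∃ a, caseLR x l r = r a := by
  rcases D.eq_cases x with rfl | rfl | ⟨a, rfl⟩ | ⟨a, rfl⟩ | ⟨a, b, rfl⟩ | ⟨a, b, rfl⟩ | ⟨f, hf, rfl⟩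
  · simp
  · simp [caseLR]
  · exact .inr (.inl ⟨a, by simp⟩)
  · exact .inr (.inr ⟨a, by simp⟩)
  · simp [caseLR]
  · simp [caseLR]
  · exact .inl (by rw [caseLR, D.cases_fn _ _ _ _ _ _ hf])

theorem caseD_cases (d m z p : D) :
    caseD d m z p = ⊥ ∨ caseD d m z p = m ∨ caseD d m z p = z ∨ caseD d m z p = p := by
  unfold caseD
  rcases caseLR_cases d (fun u => caseLR u (fun _ => m) fun _ => p) fun _ => z with
    h | ⟨a, h⟩ | ⟨a, h⟩
  · exact .inl h
  · rw [h]
    rcases caseLR_cases a (fun _ => m) fun _ => p with h | ⟨a, h⟩ | ⟨a, h⟩ <;> simp [h]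
  · simp [h]

@[simp] theorem caseD_dNeg (m z p : D) : caseD dNeg m z p = m := by simp [caseD, dNeg]
@[simp] theorem caseD_dZero (m z p : D) : caseD dZero m z p = z := by simp [caseD, dZero]
@[simp] theorem caseD_dPos (m z p : D) : caseD dPos m z p = p := by simp [caseD, dPos]

/-! ### The concurrency modality -/

theorem or_ty_mono {A B A' B' : Formula} (h : A.ty ⊆ A'.ty) (h' : B.ty ⊆ B'.ty) :
    (or A B).ty ⊆ (or A' B').ty := by
  rintro c (hc | ⟨a, ha, rfl⟩ | ⟨b, hb, rfl⟩)
  · exact .inl hc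
  · exact .inr (.inl ⟨a, h ha, rfl⟩)
  · exact .inr (.inr ⟨b, h' hb, rfl⟩)

theorem concStar_ty_amb {A : Formula} {a b : D} (ha : a ∈ (or A (concStar A)).ty)
    (hb : b ∈ (or A (concStar A)).ty) : D.amb a b ∈ (concStar A).ty := by
  refine fixTy_fold (Φ := fun (X : Unit → Formula) _ => conc (or A (X ()))) ?_
    (Set.mem_iUnion.2 ⟨(), .inr ⟨a, ha, b, hb, rfl⟩⟩)
  intro s t hst c hc
  obtain ⟨_, hc⟩ := Set.mem_iUnion.1 hc
  refine Set.mem_iUnion.2 ⟨(), ?_⟩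
  have hm : (or A ⟨True, s, ∅⟩).ty ⊆ (or A ⟨True, t, ∅⟩).ty := or_ty_mono le_rfl hst
  rcases hc with hc | ⟨a, ha, b, hb, rfl⟩
  · exact .inl hc
  · exact .inr ⟨a, hm ha, b, hm hb, rfl⟩

theorem bot_mem_concStar_ty (A : Formula) : (⊥ : D) ∈ (concStar A).ty :=
  subset_fixTy (Φ := fun (X : Unit → Formula) _ => conc (or A (X ()))) (t := {⊥})
    (fun _ hc => Set.mem_iUnion.2 ⟨(), .inl hc⟩) rfl

theorem concStar_rz_amb {A : Formula} {a b : D} (ha : a ∈ (or A (concStar A)).ty)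
    (hb : b ∈ (or A (concStar A)).ty) (hab : a ≠ ⊥ ∨ b ≠ ⊥)
    (ha' : a ≠ ⊥ → a ∈ (or A (concStar A)).rz) (hb' : b ≠ ⊥ → b ∈ (or A (concStar A)).rz) :
    D.amb a b ∈ (concStar A).rz := by
  intro r hr
  have key : ∀ c, c ∈ (or A (concStar A)).rz →
      c ∈ (or A ⟨True, (concStar A).ty, r ()⟩).rz := by
    rintro c (⟨u, hu, rfl⟩ | ⟨m, hm, rfl⟩)
    · exact .inl ⟨u, hu, rfl⟩
    · exact .inr ⟨m, hm r hr, rfl⟩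
  exact hr () ⟨a, ha, b, hb, rfl, hab, fun h => key a (ha' h), fun h => key b (hb' h)⟩

theorem concStar_induction {A : Formula} {p : D → Prop}
    (h : ∀ a b, (a ≠ ⊥ ∨ b ≠ ⊥) →
      (a ≠ ⊥ → (∃ u ∈ A.rz, a = D.left u) ∨ ∃ m, p m ∧ a = D.right m) →
      (b ≠ ⊥ → (∃ u ∈ A.rz, b = D.left u) ∨ ∃ m, p m ∧ b = D.right m) → p (D.amb a b))
    {m : D} (hm : m ∈ (concStar A).rz) : p m := by
  refine hm (fun _ => {m | p m}) ?_
  rintro _ c ⟨a, -, b, -, rfl, hab, ha, hb⟩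
  exact h a b hab ha hb

/-- Two tests `n` and `p` that decide `x ≤ 0` or `x ≥ 0`, at least when `x ≠ 0`. -/
structure SignTests (x : ℝ) (n p : D) : Prop where
  neg : n = D.nil → x ≤ 0
  pos : p = D.nil → 0 ≤ x
  total : x ≠ 0 → n = D.nil ∨ p = D.nil

/-- A success can only come from a defined component, all of which are correct; hence soundness. For
totality one defined component suffices, and each node has one. The least fixed point supplies the
induction, so the search is well-founded along defined components. -/
theorem signTests_search {A : Formula} {x : ℝ} {φ ψ m : D}
    (h : ∀ u ∈ A.rz, SignTests x (D.app φ u) (D.app ψ u)) (hm : m ∈ (concStar A).rz) :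
    SignTests x (search φ m) (search ψ m) := by
  refine concStar_induction (p := fun m => SignTests x (search φ m) (search ψ m)) ?_ hm
  intro a b hab ha hb
  rw [search_eq φ, search_eq ψ, caseAmb_amb, caseAmb_amb]
  have key : ∀ a : D, (a ≠ ⊥ → (∃ u ∈ A.rz, a = D.left u) ∨
      ∃ m, SignTests x (search φ m) (search ψ m) ∧ a = D.right m) → a ≠ ⊥ →
      SignTests x (caseLR a (fun u => D.app φ u) fun m' => search φ m')
        (caseLR a (fun u => D.app ψ u) fun m' => search ψ m') := by
    intro a ha h0
    rcases ha h0 with ⟨u, hu, rfl⟩ | ⟨m, hm, rfl⟩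
    · simpa using h u hu
    · simpa using hm
  have key' : ∀ a : D, (a ≠ ⊥ → (∃ u ∈ A.rz, a = D.left u) ∨
      ∃ m, SignTests x (search φ m) (search ψ m) ∧ a = D.right m) →
      (caseLR a (fun u => D.app φ u) (fun m' => search φ m') = D.nil → x ≤ 0) ∧
      (caseLR a (fun u => D.app ψ u) (fun m' => search ψ m') = D.nil → 0 ≤ x) := by
    intro a ha
    by_cases h0 : a = ⊥
    · simp [h0]
    · exact ⟨(key a ha h0).neg, (key a ha h0).pos⟩
  refine ⟨?_, ?_, ?_⟩
  · rw [D.parNil_eq_nil]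
    exact fun h => h.elim (key' a ha).1 (key' b hb).1
  · rw [D.parNil_eq_nil]
    exact fun h => h.elim (key' a ha).2 (key' b hb).2
  · intro hx
    rw [D.parNil_eq_nil, D.parNil_eq_nil]
    rcases hab with h0 | h0
    · exact ((key a ha h0).total hx).imp .inl .inl
    · exact ((key b hb h0).total hx).imp .inr .inr

/-! ### Guarded concurrent choice from a list. -/

theorem anyNil_eq_nil {l : List (D × D)} : anyNil l = D.nil ↔ ∃ p ∈ l, p.1 = D.nil := by
  induction l with
  | nil => simp [anyNil]
  | cons p l ih => simp [anyNil, ih]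

theorem choice_mem_ty {A : Formula} {l : List (D × D)} (h : ∀ p ∈ l, p.2 ∈ A.ty) :
    choice l ∈ (concStar A).ty := by
  induction l with
  | nil => exact bot_mem_concStar_ty A
  | cons p l ih =>
    refine concStar_ty_amb ?_ ?_
    · rcases guard_cases p.1 (D.left p.2) with h' | ⟨-, h'⟩ <;> rw [h']
      · exact .inl rfl
      · exact .inr (.inl ⟨_, h p (by simp), rfl⟩)
    · rcases guard_cases (anyNil l) (D.right (choice l)) with h' | ⟨-, h'⟩ <;> rw [h']
      · exact .inl rfl
      · exact .inr (.inr ⟨_, ih fun q hq => h q (by simp [hq]), rfl⟩)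

/-- A defined component must be a realiser. Therefore the remaining choice is guarded by the
parallel disjunction of the remaining tests: it appears only once some test in it has succeeded. -/
theorem choice_mem_rz {A : Formula} {l : List (D × D)} (h : ∀ p ∈ l, p.2 ∈ A.ty)
    (h' : ∀ p ∈ l, p.1 = D.nil → p.2 ∈ A.rz) (hl : ∃ p ∈ l, p.1 = D.nil) :
    choice l ∈ (concStar A).rz := by
  induction l with
  | nil => simp at hl
  | cons p l ih =>
    have hl' := fun q hq => h q (List.mem_cons_of_mem p hq)
    refine concStar_rz_amb ?_ ?_ ?_ ?_ ?_
    · rcases guard_cases p.1 (D.left p.2) with h' | ⟨-, h'⟩ <;> rw [h']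
      · exact .inl rfl
      · exact .inr (.inl ⟨_, h p (by simp), rfl⟩)
    · rcases guard_cases (anyNil l) (D.right (choice l)) with h' | ⟨-, h'⟩ <;> rw [h']
      · exact .inl rfl
      · exact .inr (.inr ⟨_, choice_mem_ty hl', rfl⟩)
    · obtain ⟨q, hq, hq'⟩ := hl
      rcases List.mem_cons.1 hq with rfl | hq
      · left
        rw [hq', guard_nil]
        exact D.left_ne_bot _
      · right
        rw [anyNil_eq_nil.2 ⟨q, hq, hq'⟩, guard_nil]
        exact D.right_ne_bot _
    · intro h0
      rcases guard_cases p.1 (D.left p.2) with h1 | ⟨h1, h2⟩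
      · exact absurd h1 h0
      · rw [h2]
        exact .inl ⟨_, h' p (by simp) h1, rfl⟩
    · intro h0
      rcases guard_cases (anyNil l) (D.right (choice l)) with h1 | ⟨h1, h2⟩
      · exact absurd h1 h0
      · rw [h2]
        exact .inr ⟨_, ih hl' (fun q hq => h' q (List.mem_cons_of_mem p hq))
          (anyNil_eq_nil.1 h1), rfl⟩

end CFP

namespace CFP

open Formula
open scoped Pointwise

/-! ## Parts of compact sets -/

/-- The image of `K_d` under the inverse of the digit map. -/
def digitPart (K : Set ℝ) (d : ℝ) : Set ℝ := (fun x => 2 * x - d) '' cut K d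

/-- The Gray digits: `-1` for `true` and `1` for `false`. -/
def grayDigit : Bool → ℝ
  | true => -1
  | false => 1

/-- The image of `K_d` under the tent map, for a Gray digit `d`. -/
noncomputable def grayPart (b : Bool) (K : Set ℝ) : Set ℝ := tent '' cut K (grayDigit b)

/-- The minimum (`true`) or the maximum (`false`) of a set. -/
noncomputable def ends : Bool → Set ℝ → ℝ
  | true, K => sInf K
  | false, K => sSup K

theorem mem_digitRange {x d : ℝ} : x ∈ digitRange d ↔ -1 ≤ 2 * x - d ∧ 2 * x - d ≤ 1 := by
  rw [digitRange, Set.mem_ofPred_eq, abs_le]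

theorem continuous_tent : Continuous tent := by unfold tent; fun_prop

theorem tent_mem_Icc {x : ℝ} (h : x ∈ Set.Icc (-1 : ℝ) 1) : tent x ∈ Set.Icc (-1 : ℝ) 1 := by
  have h1 := abs_le.2 h
  have h2 := abs_nonneg x
  constructor <;> unfold tent <;> linarith

theorem tent_of_nonneg {x : ℝ} (h : 0 ≤ x) : tent x = 1 - 2 * x := by rw [tent, abs_of_nonneg h]

theorem tent_of_nonpos {x : ℝ} (h : x ≤ 0) : tent x = 1 + 2 * x := by
  rw [tent, abs_of_nonpos h]; ring

theorem tent_neg (x : ℝ) : tent (-x) = tent x := by rw [tent, tent, abs_neg]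

theorem tent_nonneg_iff {x : ℝ} : 0 ≤ tent x ↔ x ∈ digitRange 0 := by
  rw [mem_digitRange, tent]
  constructor
  · intro h
    have := abs_le.1 (show |x| ≤ 1 / 2 by linarith)
    constructor <;> linarith
  · rintro ⟨h1, h2⟩
    have := abs_le.2 (show -(1 / 2) ≤ x ∧ x ≤ 1 / 2 by constructor <;> linarith)
    linarith

theorem isCompact_cut {K : Set ℝ} (hK : IsNonemptyCompact K) (d : ℝ) : IsCompact (cut K d) :=
  hK.2.1.inter_right (isClosed_le (by fun_prop) continuous_const)

theorem IsNonemptyCompact.digitPart {K : Set ℝ} (hK : IsNonemptyCompact K) {d : ℝ}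
    (h : (cut K d).Nonempty) : IsNonemptyCompact (digitPart K d) := by
  refine ⟨h.image _, (isCompact_cut hK d).image (by fun_prop), ?_⟩
  rintro _ ⟨x, hx, rfl⟩
  exact abs_le.1 hx.2

theorem IsNonemptyCompact.grayPart {K : Set ℝ} (hK : IsNonemptyCompact K) {b : Bool}
    (h : (cut K (grayDigit b)).Nonempty) : IsNonemptyCompact (grayPart b K) := by
  refine ⟨h.image _, (isCompact_cut hK _).image continuous_tent, ?_⟩
  rintro _ ⟨x, hx, rfl⟩
  exact tent_mem_Icc (hK.2.2 hx.1)

theorem IsNonemptyCompact.neg {K : Set ℝ} (hK : IsNonemptyCompact K) : IsNonemptyCompact (-K) := by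
  refine ⟨hK.1.neg, hK.2.1.neg, fun x hx => ?_⟩
  have := hK.2.2 hx
  constructor <;> linarith [this.1, this.2]

theorem ends_mem {K : Set ℝ} (hK : IsNonemptyCompact K) : ∀ b, ends b K ∈ K
  | true => hK.2.1.sInf_mem hK.1
  | false => hK.2.1.sSup_mem hK.1

theorem le_ends {K : Set ℝ} (hK : IsNonemptyCompact K) :
    ∀ b, ∀ x ∈ K, grayDigit b * x ≤ grayDigit b * ends b K
  | true, x, hx => by
    have := csInf_le hK.2.1.bddBelow hx
    simp only [grayDigit, ends]; linarith
  | false, x, hx => by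
    have := le_csSup hK.2.1.bddAbove hx
    simp only [grayDigit, ends]; linarith

theorem ends_eq {K : Set ℝ} {a : ℝ} (ha : a ∈ K) :
    ∀ b, (∀ x ∈ K, grayDigit b * x ≤ grayDigit b * a) → ends b K = a
  | true, h => IsLeast.csInf_eq ⟨ha, fun x hx => by
      have := h x hx
      simp only [grayDigit] at this; linarith⟩
  | false, h => IsGreatest.csSup_eq ⟨ha, fun x hx => by
      have := h x hx
      simp only [grayDigit] at this; linarith⟩

theorem ends_neg (b : Bool) (K : Set ℝ) : ends b (-K) = -ends (!b) K := by
  cases b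
  · exact Real.sSup_neg K
  · exact Real.sInf_neg K

theorem ends_digitPart {K : Set ℝ} (hK : IsNonemptyCompact K) {b : Bool} {d : ℝ}
    (h : ends b K ∈ digitRange d) : ends b (digitPart K d) = 2 * ends b K - d := by
  refine ends_eq (K := digitPart K d) (Set.mem_image_of_mem _ ⟨ends_mem hK b, h⟩) b ?_
  rintro _ ⟨x, hx, rfl⟩
  have := le_ends hK b x hx.1
  simp only
  nlinarith

theorem mem_cut_grayDigit {K : Set ℝ} (hK : IsNonemptyCompact K) {b : Bool} {x : ℝ} :
    x ∈ cut K (grayDigit b) ↔ x ∈ K ∧ 0 ≤ grayDigit b * x := by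
  refine and_congr_right fun hx => ?_
  have := hK.2.2 hx
  rw [mem_digitRange]
  cases b <;> simp only [grayDigit]
  · exact ⟨fun h => by linarith [h.1], fun h => ⟨by linarith, by linarith [this.2]⟩⟩
  · exact ⟨fun h => by linarith [h.2], fun h => ⟨by linarith [this.1], by linarith⟩⟩

theorem cut_grayDigit_nonempty {K : Set ℝ} (hK : IsNonemptyCompact K) {b : Bool} :
    (cut K (grayDigit b)).Nonempty ↔ 0 ≤ grayDigit b * ends b K := by
  constructor
  · rintro ⟨x, hx⟩
    exact ((mem_cut_grayDigit hK).1 hx).2.trans (le_ends hK b x hx.1)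
  · exact fun h => ⟨_, (mem_cut_grayDigit hK).2 ⟨ends_mem hK b, h⟩⟩

theorem cut_neg (K : Set ℝ) (d : ℝ) : cut (-K) d = -cut K (-d) := by
  ext x
  simp only [cut, Set.mem_inter_iff, Set.mem_neg, mem_digitRange]
  refine and_congr_right fun _ => ?_
  constructor <;> rintro ⟨h1, h2⟩ <;> constructor <;> linarith

theorem grayDigit_not (b : Bool) : grayDigit (!b) = -grayDigit b := by
  cases b <;> simp [grayDigit]

theorem grayPart_neg (b : Bool) (K : Set ℝ) : grayPart b (-K) = grayPart (!b) K := by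
  rw [grayPart, grayPart, cut_neg, grayDigit_not]
  ext y
  constructor
  · rintro ⟨x, hx, rfl⟩
    exact ⟨-x, hx, tent_neg x⟩
  · rintro ⟨x, hx, rfl⟩
    exact ⟨-x, by simpa using hx, tent_neg x⟩

theorem grayPart_true {K : Set ℝ} (hK : IsNonemptyCompact K) : grayPart true K = digitPart K (-1) := by
  refine Set.image_congr fun x hx => ?_
  have := ((mem_cut_grayDigit (b := true) hK).1 hx).2
  simp only [grayDigit] at this
  rw [tent_of_nonpos (by linarith)]
  ring

theorem grayPart_false {K : Set ℝ} (hK : IsNonemptyCompact K) : grayPart false K = -digitPart K 1 := by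
  have h : digitPart K 1 = (fun x => -tent x) '' cut K 1 := by
    refine Set.image_congr fun x hx => ?_
    have := ((mem_cut_grayDigit (b := false) hK).1 hx).2
    simp only [grayDigit] at this
    rw [tent_of_nonneg (by linarith)]
    ring
  rw [h]
  ext y
  simp only [Set.mem_neg, Set.mem_image, neg_inj]
  rfl

/-- The tent map is non-negative exactly on the range of the digit 0, so digit 1 after a tent step
selects the middle of a half. -/
theorem cut_grayPart_one {K : Set ℝ} (hK : IsNonemptyCompact K) (b : Bool) :
    cut (grayPart b K) 1 = tent '' (cut K (grayDigit b) ∩ digitRange 0) := by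
  have key : ∀ x ∈ K, tent x ∈ digitRange 1 ↔ x ∈ digitRange 0 := by
    intro x hx
    have := (tent_mem_Icc (hK.2.2 hx)).2
    rw [← tent_nonneg_iff, mem_digitRange]
    exact ⟨fun h => by linarith [h.1], fun h => ⟨by linarith, by linarith⟩⟩
  ext y
  constructor
  · rintro ⟨⟨x, hx, rfl⟩, h⟩
    exact ⟨x, ⟨hx, (key x hx.1).1 h⟩, rfl⟩
  · rintro ⟨x, hx, rfl⟩
    exact ⟨⟨x, hx.1, rfl⟩, (key x hx.1.1).2 hx.2⟩

theorem cut_digitPart_zero {K : Set ℝ} (hK : IsNonemptyCompact K) (b : Bool) :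
    cut (digitPart K 0) (grayDigit b) =
      (fun x => 2 * x) '' (cut K (grayDigit b) ∩ digitRange 0) := by
  ext y
  constructor
  · rintro ⟨⟨x, hx, rfl⟩, h⟩
    simp only [sub_zero] at h ⊢
    refine ⟨x, ⟨(mem_cut_grayDigit hK).2 ⟨hx.1, ?_⟩, hx.2⟩, rfl⟩
    rw [mem_digitRange] at h
    cases b <;> simp only [grayDigit] at h ⊢ <;> linarith
  · rintro ⟨x, hx, rfl⟩
    have h1 := ((mem_cut_grayDigit hK).1 hx.1).2
    have h2 := mem_digitRange.1 hx.2
    refine ⟨⟨x, ⟨hx.1.1, hx.2⟩, by simp⟩, mem_digitRange.2 ?_⟩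
    cases b <;> simp only [grayDigit] at h1 ⊢ <;> constructor <;> linarith

/-- The identity t(2x) = 1 - 4|x| = 2t(x) - 1. It is the bridge between the digit 0 and Gray code,
used in both directions. -/
theorem grayPart_digitPart_zero {K : Set ℝ} (hK : IsNonemptyCompact K) (b : Bool) :
    grayPart b (digitPart K 0) = digitPart (grayPart b K) 1 := by
  rw [grayPart, cut_digitPart_zero hK, digitPart, cut_grayPart_one hK, Set.image_image,
    Set.image_image]
  refine Set.image_congr fun x _ => ?_
  simp only [tent, abs_mul, Nat.abs_ofNat]
  ring

theorem cut_digitPart_zero_nonempty {K : Set ℝ} (hK : IsNonemptyCompact K) (b : Bool) :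
    (cut (digitPart K 0) (grayDigit b)).Nonempty ↔ (cut (grayPart b K) 1).Nonempty := by
  rw [cut_digitPart_zero hK, cut_grayPart_one hK, Set.image_nonempty, Set.image_nonempty]

/-! ## Positions of queries -/

/-- What a query is about: iterations of the tent map on the minimum (`true`) or the maximum
(`false`), possibly of the image of a part. -/
inductive Pos
  | ext (b : Bool) (k : ℕ)
  | sub (b : Bool) (π : Pos)

namespace Pos

/-- The number that a query is about. -/
noncomputable def val : Pos → Set ℝ → ℝ
  | ext b k, K => tent^[k] (ends b K)
  | sub b π, K => π.val (grayPart b K)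

/-- The parts in question are non-empty. -/
def Dfd : Pos → Set ℝ → Prop
  | ext _ _, _ => True
  | sub b π, K => (cut K (grayDigit b)).Nonempty ∧ π.Dfd (grayPart b K)

/-- The length of a query. -/
def size : Pos → ℕ
  | ext _ k => k
  | sub _ π => π.size + 1

/-- The position corresponding to `-K`. -/
def neg : Pos → Pos
  | ext b k => ext (!b) k
  | sub b π => sub (!b) π

end Pos

/-- The query about the sign of `tent^[k] x`. -/
def encR : ℕ → Bool → D
  | 0, s => qSgn s
  | k + 1, s => qTail (encR k s)

/-- The query about the sign of the number at a position. -/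
def enc : Pos → Bool → D
  | .ext b k, s => qExt b (encR k s)
  | .sub b π, s => qSub b (enc π s)

@[simp] theorem caseR_sgn_true (n p : D) (t : D → D) : caseR (qSgn true) n p t = n := by
  simp [caseR, qSgn]
@[simp] theorem caseR_sgn_false (n p : D) (t : D → D) : caseR (qSgn false) n p t = p := by
  simp [caseR, qSgn]
@[simp] theorem caseR_tail (r n p : D) (t : D → D) : caseR (qTail r) n p t = t r := by
  simp [caseR, qTail]
@[simp] theorem caseS_ext_true (r : D) (mn mx sl sr : D → D) :
    caseS (qExt true r) mn mx sl sr = mn r := by simp [caseS, qExt]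
@[simp] theorem caseS_ext_false (r : D) (mn mx sl sr : D → D) :
    caseS (qExt false r) mn mx sl sr = mx r := by simp [caseS, qExt]
@[simp] theorem caseS_sub_true (q : D) (mn mx sl sr : D → D) :
    caseS (qSub true q) mn mx sl sr = sl q := by simp [caseS, qSub]
@[simp] theorem caseS_sub_false (q : D) (mn mx sl sr : D → D) :
    caseS (qSub false q) mn mx sl sr = sr q := by simp [caseS, qSub]

@[simp] theorem flipR_sgn (s : Bool) : flipR (qSgn s) = qSgn !s := by cases s <;> simp [flipR]
@[simp] theorem flipR_tail (r : D) : flipR (qTail r) = qTail r := by simp [flipR]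
@[simp] theorem flipS_ext (b : Bool) (r : D) : flipS (qExt b r) = qExt (!b) (flipR r) := by
  cases b <;> simp [flipS]
@[simp] theorem flipS_sub (b : Bool) (q : D) : flipS (qSub b q) = qSub (!b) q := by
  cases b <;> simp [flipS]

/-- The answers `ρ` are right about the sign of `tent^[k] x`. -/
abbrev OkR (x : ℝ) (ρ : D → D) (k : ℕ) : Prop :=
  SignTests (tent^[k] x) (ρ (encR k true)) (ρ (encR k false))

/-- The answers `κ` are right about the sign of the number at a position. -/
abbrev Ok (K : Set ℝ) (κ : D → D) (π : Pos) : Prop :=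
  SignTests (π.val K) (κ (enc π true)) (κ (enc π false))

/-- The answers `κ` are right about all queries of length less than `n`. -/
def ValidTo (n : ℕ) (K : Set ℝ) (κ : D → D) : Prop :=
  ∀ π : Pos, π.size < n → π.Dfd K → Ok K κ π

/-- The answers `κ` are right about all queries. -/
def Valid (K : Set ℝ) (κ : D → D) : Prop := ∀ π : Pos, π.Dfd K → Ok K κ π

/-! ### Validity of answers under negation and restriction to halves. -/

theorem signTests_neg {x : ℝ} {n p : D} (h : SignTests x n p) : SignTests (-x) p n :=
  ⟨fun e => by linarith [h.pos e], fun e => by linarith [h.neg e],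
    fun e => (h.total fun h0 => e (by simp [h0])).symm⟩

theorem signTests_of_neg {x : ℝ} (h : x ≤ 0) : SignTests x D.nil ⊥ :=
  ⟨fun _ => h, fun e => absurd e D.bot_ne_nil, fun _ => .inl rfl⟩

theorem signTests_of_pos {x : ℝ} (h : 0 ≤ x) : SignTests x ⊥ D.nil :=
  ⟨fun e => absurd e D.bot_ne_nil, fun _ => h, fun _ => .inr rfl⟩

theorem signTests_two_mul {x : ℝ} {n p : D} : SignTests (2 * x) n p ↔ SignTests x n p := by
  constructor <;> rintro ⟨h1, h2, h3⟩ <;>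
    exact ⟨fun e => by linarith [h1 e], fun e => by linarith [h2 e], fun e => h3 (by simpa using e)⟩

/-- The tent map is even, so negation changes only the question about the sign of the number itself.
-/
theorem OkR.flip {x y : ℝ} {ρ : D → D} {k : ℕ} (h : OkR x ρ k) (hy : y = -x) :
    OkR y (fun r => ρ (flipR r)) k := by
  subst hy
  cases k with
  | zero =>
    have h' : SignTests x (ρ (qSgn true)) (ρ (qSgn false)) := h
    simpa [OkR, encR] using signTests_neg h'
  | succ k =>
    have : tent^[k + 1] (-x) = tent^[k + 1] x := by
      rw [Function.iterate_succ_apply, Function.iterate_succ_apply, tent_neg]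
    simpa [OkR, this, encR] using h

theorem okR_tail {x : ℝ} {ρ : D → D} {k : ℕ} :
    OkR (tent x) (fun r => ρ (qTail r)) k ↔ OkR x ρ (k + 1) := Iff.rfl

/-- Negation swaps the ends and the two halves, but the tent images of the halves are unchanged;
thus only the outermost layer of a query is flipped. -/
theorem Ok.neg {K : Set ℝ} {κ : D → D} {π : Pos} (h : Ok K κ π.neg) :
    Ok (-K) (fun q => κ (flipS q)) π := by
  cases π with
  | ext b k =>
    have h' : OkR (ends (!b) K) (fun r => κ (qExt (!b) r)) k := h
    have := h'.flip (ends_neg b K)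
    simpa [Ok, enc, Pos.val] using this
  | sub b π => simpa [Ok, enc, Pos.neg, Pos.val, grayPart_neg] using h

theorem Pos.dfd_neg {K : Set ℝ} {π : Pos} (h : π.Dfd (-K)) : π.neg.Dfd K := by
  cases π with
  | ext b k => trivial
  | sub b π =>
    rw [Pos.Dfd, grayPart_neg, cut_neg, Set.nonempty_neg, ← grayDigit_not] at h
    exact h

theorem Pos.size_neg (π : Pos) : π.neg.size = π.size := by cases π <;> rfl

theorem ValidTo.neg {n : ℕ} {K : Set ℝ} {κ : D → D} (h : ValidTo n K κ) :
    ValidTo n (-K) fun q => κ (flipS q) := fun π hπ hd =>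
  Ok.neg (h π.neg (π.size_neg ▸ hπ) (Pos.dfd_neg hd))

theorem Valid.neg {K : Set ℝ} {κ : D → D} (h : Valid K κ) : Valid (-K) fun q => κ (flipS q) :=
  fun _ hd => Ok.neg (h _ (Pos.dfd_neg hd))

theorem Valid.sub {K : Set ℝ} {κ : D → D} (h : Valid K κ) {b : Bool}
    (hb : (cut K (grayDigit b)).Nonempty) : Valid (grayPart b K) fun q => κ (qSub b q) :=
  fun π hd => h (.sub b π) ⟨hb, hd⟩

end CFP

namespace CFP

open Formula
open scoped Pointwise

/-! ## Signed-digit trees answer queries -/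

/-- The codes of the signed digits. -/
inductive IsDigit : ℝ → D → Prop
  | neg : IsDigit (-1) dNeg
  | zero : IsDigit 0 dZero
  | pos : IsDigit 1 dPos

theorem isDigit_of_mem_rz {d : ℝ} {c : D} (h : c ∈ (SD d).rz) : IsDigit d c := by
  rcases h with ⟨_, ⟨_, ⟨rfl, rfl⟩, rfl⟩ | ⟨_, ⟨rfl, rfl⟩, rfl⟩, rfl⟩ | ⟨_, ⟨rfl, rfl⟩, rfl⟩
  · exact .neg
  · exact .pos
  · exact .zero

theorem IsDigit.mem_rz {d : ℝ} {c : D} (h : IsDigit d c) : c ∈ (SD d).rz := by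
  cases h
  · exact .inl ⟨_, .inl ⟨_, ⟨rfl, rfl⟩, rfl⟩, rfl⟩
  · exact .inr ⟨_, ⟨rfl, rfl⟩, rfl⟩
  · exact .inl ⟨_, .inr ⟨_, ⟨rfl, rfl⟩, rfl⟩, rfl⟩

/-- For d = -1 the sign is known and t(x) = 2x + 1; for d = 1 it is known and t(x) = -(2x - 1); for
d = 0 the sign of t(x) is known and t(t(x)) = -t(2x). The remaining case, the sign of x at d = 0,
passes to 2x without becoming shorter and has its own hypothesis `h0`. -/
theorem okR_nodeR {d x : ℝ} {c : D} {κ : D → D} {k : ℕ} (hd : IsDigit d c) (hx : x ∈ digitRange d)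
    (h : ∀ j < k, OkR (2 * x - d) κ j) (h0 : k = 0 → d = 0 → OkR (2 * x) κ 0) :
    OkR x (nodeR c κ) k := by
  rw [mem_digitRange] at hx
  cases hd with
  | neg =>
    cases k with
    | zero =>
      simp only [OkR, encR, nodeR, caseD_dNeg, caseR_sgn_true, caseR_sgn_false]
      exact signTests_of_neg (by simp; linarith)
    | succ k =>
      have hk := h k (by omega)
      rw [show 2 * x - -1 = tent x by rw [tent_of_nonpos (by linarith)]; ring] at hk
      simpa [OkR, encR, nodeR] using hk
  | zero =>
    cases k with
    | zero =>
      have hk : SignTests (2 * x) (κ (qSgn true)) (κ (qSgn false)) := h0 rfl rfl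
      simpa [OkR, encR, nodeR] using signTests_two_mul.1 hk
    | succ k =>
      cases k with
      | zero =>
        simp only [OkR, encR, nodeR, caseD_dZero, caseR_sgn_true, caseR_sgn_false, caseR_tail]
        exact signTests_of_pos (tent_nonneg_iff.2 (mem_digitRange.2 hx))
      | succ k =>
        have h1 : OkR (tent (2 * x)) (fun r => κ (qTail r)) k := by
          simpa using okR_tail.2 (h (k + 1) (by omega))
        have h2 : tent (tent x) = -tent (2 * x) := by
          rw [tent_of_nonneg (tent_nonneg_iff.2 (mem_digitRange.2 hx))]
          simp only [tent, abs_mul, Nat.abs_ofNat]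
          ring
        simpa [OkR, encR, nodeR] using h1.flip h2
  | pos =>
    cases k with
    | zero =>
      simp only [OkR, encR, nodeR, caseD_dPos, caseR_sgn_true, caseR_sgn_false]
      exact signTests_of_pos (by simp; linarith)
    | succ k =>
      have hk := (h k (by omega)).flip (y := tent x) (by rw [tent_of_nonneg (by linarith)]; ring)
      simpa [OkR, encR, nodeR] using hk

theorem grayPart_true_of_nonneg {T : Set ℝ} (hT : IsNonemptyCompact T) (h0 : ∀ x ∈ T, 0 ≤ x)
    (h : (cut T (grayDigit true)).Nonempty) : grayPart true T = {1} := by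
  have key : ∀ x ∈ cut T (grayDigit true), x = 0 := fun x hx => by
    have := ((mem_cut_grayDigit hT).1 hx).2
    simp only [grayDigit] at this
    linarith [h0 x hx.1]
  rw [Set.eq_singleton_iff_nonempty_unique_mem]
  refine ⟨h.image _, ?_⟩
  rintro _ ⟨x, hx, rfl⟩
  rw [key x hx]
  simp [tent]

/-- When `T` is non-negative the signs of its ends are known. Its non-positive half is at most {0},
with tent image {1}, and its non-negative half has as tent image the reflection of the digit-1 part.
-/
theorem validTo_nodeS {n : ℕ} {T : Set ℝ} {κ : D → D} (hT : IsNonemptyCompact T)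
    (h0 : ∀ x ∈ T, 0 ≤ x) (hone : ValidTo n {1} one) (h : ValidTo n (digitPart T 1) κ) :
    ValidTo (n + 1) T (nodeS one κ) := by
  intro π hπ hd
  cases π with
  | ext b k =>
    have hb := h0 _ (ends_mem hT b)
    cases k with
    | zero => cases b <;> simpa [Ok, enc, encR, nodeS, Pos.val] using signTests_of_pos hb
    | succ k =>
      have h1 : OkR (ends b (digitPart T 1)) (fun r => κ (qExt b r)) k :=
        h (.ext b k) (Nat.lt_of_succ_lt_succ hπ) trivial
      rw [ends_digitPart hT (mem_digitRange.2 ⟨by linarith,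
        by linarith [(hT.2.2 (ends_mem hT b)).2]⟩)] at h1
      have h2 := h1.flip (y := tent (ends b T)) (by rw [tent_of_nonneg hb]; ring)
      cases b <;> simpa [Ok, enc, encR, nodeS, Pos.val] using h2
  | sub b π =>
    have hπ' : π.size < n := Nat.lt_of_succ_lt_succ hπ
    cases b with
    | true =>
      have h1 := hd.2
      rw [grayPart_true_of_nonneg hT h0 hd.1] at h1
      simpa [Ok, enc, nodeS, Pos.val, grayPart_true_of_nonneg hT h0 hd.1] using hone π hπ' h1
    | false =>
      have h1 := hd.2
      rw [grayPart_false hT] at h1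
      simpa [Ok, enc, nodeS, Pos.val, grayPart_false hT] using h.neg π hπ' h1

theorem isNonemptyCompact_one : IsNonemptyCompact {1} :=
  ⟨Set.singleton_nonempty 1, isCompact_singleton, by simp⟩

theorem validTo_one (n : ℕ) : ValidTo n {1} one := by
  induction n with
  | zero => exact fun π hπ => absurd hπ (Nat.not_lt_zero _)
  | succ n ih =>
    have h1 : digitPart {1} 1 = {1} := by
      have h2 : (1 : ℝ) ∈ digitRange 1 := mem_digitRange.2 (by norm_num)
      rw [digitPart, cut, Set.inter_eq_left.2 (Set.singleton_subset_iff.2 h2), Set.image_singleton]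
      norm_num
    rw [show one = nodeS one one from funext one_eq]
    exact validTo_nodeS isNonemptyCompact_one (by simp) ih (h1.symm ▸ ih)

/-! ### Sets of digits -/

theorem isDigit_pick (b : Bool) {d d' : ℝ} {c c' : D} (h : IsDigit d c) (h' : IsDigit d' c') :
    IsDigit d (pick b c c') ∧ grayDigit b * d' ≤ grayDigit b * d ∨
      IsDigit d' (pick b c c') ∧ grayDigit b * d ≤ grayDigit b * d' := by
  cases b <;> cases h <;> cases h' <;>
    simp [pick, grayDigit, IsDigit.neg, IsDigit.zero, IsDigit.pos]

/-- The digit `d` with code `c` is the least (`true`) or greatest (`false`) one of `E`. -/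
structure IsExtremeDigit (b : Bool) (E : Set ℝ) (d : ℝ) (c : D) : Prop where
  isDigit : IsDigit d c
  mem : d ∈ E
  le : ∀ x ∈ E, grayDigit b * x ≤ grayDigit b * d

theorem isExtremeDigit_dig (b : Bool) {E : Set ℝ} {e : D} (h : e ∈ (PFin SD E).rz) :
    ∃ d, IsExtremeDigit b E d (dig b e) := by
  refine h (fun E => {e | ∃ d, IsExtremeDigit b E d (dig b e)}) ?_
  rintro E e (⟨c, ⟨d, rfl, hc⟩, rfl⟩ | ⟨_, ⟨v, e', ⟨d', hd'⟩, c, ⟨d, rfl, hc⟩, rfl⟩, rfl⟩)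
  · refine ⟨d, ⟨?_, rfl, fun x hx => hx ▸ le_rfl⟩⟩
    rw [dig_eq, caseLR_left]
    exact isDigit_of_mem_rz hc
  · change ∃ d'', IsExtremeDigit b (v ∪ {d}) d'' (dig b (D.right (D.pair e' c)))
    rw [dig_eq, caseLR_right, casePair_pair]
    rcases isDigit_pick b (isDigit_of_mem_rz hc) hd'.isDigit with ⟨h1, h2⟩ | ⟨h1, h2⟩
    · refine ⟨d, ⟨h1, .inr rfl, ?_⟩⟩
      rintro x (hx | rfl)
      · exact (hd'.le x hx).trans h2
      · exact le_rfl
    · refine ⟨d', ⟨h1, .inl hd'.mem, ?_⟩⟩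
      rintro x (hx | rfl)
      · exact hd'.le x hx
      · exact h2

/-- The content of a leaf `u` of a signed-digit tree for `K`. -/
structure IsLeaf (K : Set ℝ) (E : Set ℝ) (e h : D) : Prop where
  digits : e ∈ (PFin SD E).rz
  cover : K ⊆ ⋃ d ∈ E, digitRange d
  nonempty : ∀ d c, IsDigit d c → d ∈ E → (cut K d).Nonempty
  tree : ∀ d c, IsDigit d c → d ∈ E → D.app h c ∈ (SKstar (digitPart K d)).rz

/-- The formula `A` is left existential because it mentions the post-fixed point that witnesses
`hm`; all that matters is the description of its realisers as leaves. -/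
theorem exists_concStar_of_SKstar {K : Set ℝ} {m : D} (hm : m ∈ (SKstar K).rz) :
    IsNonemptyCompact K ∧ ∃ A : Formula, m ∈ (concStar A).rz ∧
      ∀ u ∈ A.rz, ∃ E e h, u = D.pair e h ∧ IsLeaf K E e h := by
  obtain ⟨r, hr, hmr⟩ := hm
  obtain ⟨hK, h⟩ := hr K hmr
  refine ⟨hK, _, h, ?_⟩
  rintro _ ⟨E, e, he, h, ⟨hcov, hh⟩, rfl⟩
  refine ⟨E, e, h, rfl, he, hcov, fun d c hc hd => ?_, fun d c hc hd => ?_⟩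
  · exact (((hh d).2 c hc.mem_rz).2 hd).1
  · exact ⟨r, hr, (((hh d).2 c hc.mem_rz).2 hd).2⟩

/-- For the minimum: some point of K_d lies above it, so 2 min K ≤ d + 1; and min K lies in the
range of some d' ≥ d, so 2 min K ≥ d - 1. -/
theorem IsLeaf.ends_mem_digitRange {K E : Set ℝ} {e h : D} (hK : IsNonemptyCompact K)
    (hl : IsLeaf K E e h) {b : Bool} {d : ℝ} {c : D} (hd : IsExtremeDigit b E d c) :
    ends b K ∈ digitRange d := by
  obtain ⟨x, hx, hxd⟩ := hl.nonempty d c hd.isDigit hd.mem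
  obtain ⟨d', hd', hdr⟩ := Set.mem_iUnion₂.1 (hl.cover (ends_mem hK b))
  have h1 := hd.le d' hd'
  have h2 := le_ends hK b x hx
  rw [mem_digitRange] at *
  cases b <;> simp only [grayDigit] at h1 h2 <;> constructor <;> linarith [hxd.1, hxd.2, hdr.1, hdr.2]

/-- The parts of `K` beyond the range of the extreme digit consist of at most one number. -/
theorem IsLeaf.mem_of_extreme {K E : Set ℝ} {e h : D} (hK : IsNonemptyCompact K)
    (hl : IsLeaf K E e h) {b : Bool} {d : ℝ} {c : D} (hd : IsExtremeDigit b E d c) {x : ℝ}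
    (hx : x ∈ K) : 2 * (grayDigit b * x) ≤ grayDigit b * d + 1 := by
  have h1 := mem_digitRange.1 (hl.ends_mem_digitRange hK hd)
  have h2 := le_ends hK b x hx
  cases b <;> simp only [grayDigit] at h2 ⊢ <;> linarith [h1.1, h1.2]

theorem ok_treeQ_of_leaf {K : Set ℝ} {m : D} (hm : m ∈ (SKstar K).rz) {π : Pos}
    (h : ∀ E e h, IsLeaf K E e h → SignTests (π.val K)
      (leafQ (rec2 treeF) (enc π true) (D.pair e h)) (leafQ (rec2 treeF) (enc π false) (D.pair e h))) :
    Ok K (treeQ m) π := by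
  obtain ⟨-, A, hA, hleaf⟩ := exists_concStar_of_SKstar hm
  rw [Ok, treeQ_eq, treeQ_eq]
  refine signTests_search (fun u hu => ?_) hA
  obtain ⟨E, e, h', rfl, hl⟩ := hleaf u hu
  rw [app_leafV, app_leafV]
  exact h E e h' hl

theorem leafQ_ext (b : Bool) (r e h : D) : leafQ (rec2 treeF) (qExt b r) (D.pair e h) =
    nodeR (dig b e) (fun r' => treeQ (D.app h (dig b e)) (qExt b r')) r := by
  cases b <;> simp [leafQ, treeQ]

theorem leafQ_sub_true (q e h : D) : leafQ (rec2 treeF) (qSub true q) (D.pair e h) =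
    caseD (dig true e) (treeQ (D.app h (dig true e)) q)
      (nodeS one (fun z => treeQ (D.app h (dig true e)) (qSub true z)) q) (one q) := by
  simp [leafQ, treeQ]

theorem leafQ_sub_false (q e h : D) : leafQ (rec2 treeF) (qSub false q) (D.pair e h) =
    caseD (dig false e) (one q)
      (nodeS one (fun z => treeQ (D.app h (dig false e)) (qSub false z)) q)
      (treeQ (D.app h (dig false e)) (flipS q)) := by
  simp [leafQ, treeQ]

theorem ok_treeQ_ext {K : Set ℝ} {m : D} (hm : m ∈ (SKstar K).rz) (b : Bool) (k : ℕ)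
    (h : ∀ K' m', m' ∈ (SKstar K').rz → ∀ j < k, Ok K' (treeQ m') (.ext b j))
    (h0 : k = 0 → ∀ m', ends b K ∈ digitRange 0 → m' ∈ (SKstar (digitPart K 0)).rz →
      Ok (digitPart K 0) (treeQ m') (.ext b 0)) : Ok K (treeQ m) (.ext b k) := by
  have hK := (exists_concStar_of_SKstar hm).1
  refine ok_treeQ_of_leaf hm fun E e g hl => ?_
  obtain ⟨d, hd⟩ := isExtremeDigit_dig b hl.digits
  have hdr := hl.ends_mem_digitRange hK hd
  have ht := hl.tree d _ hd.isDigit hd.mem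
  simp only [enc, leafQ_ext]
  refine okR_nodeR (κ := fun r' => treeQ (D.app g (dig b e)) (qExt b r')) hd.isDigit hdr
    (fun j hj => ?_) fun hk hd0 => ?_
  · rw [← ends_digitPart hK hdr]
    exact h _ _ ht j hj
  · subst hd0
    have := h0 hk _ hdr ht
    rw [Ok, Pos.val, ends_digitPart hK hdr, sub_zero] at this
    exact this

theorem ok_treeQ_sign {K : Set ℝ} {m : D} (hm : m ∈ (SKstar K).rz) (b : Bool) :
    Ok K (treeQ m) (.ext b 0) := by
  by_cases hx : ends b K = 0
  · have h0 : (Pos.ext b 0).val K = 0 := hx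
    rw [Ok, h0]
    exact ⟨fun _ => le_rfl, fun _ => le_rfl, fun h => absurd rfl h⟩
  -- Each digit 0 doubles the end, so `N` bounds the number of such steps; at `N = 0` the end would
  -- exceed 1 in absolute value, which the range of the digit 0 excludes.
  · obtain ⟨N, hN⟩ := pow_unbounded_of_one_lt (1 / |ends b K|) (one_lt_two (α := ℝ))
    rw [div_lt_iff₀ (abs_pos.2 hx)] at hN
    clear hx
    induction N generalizing K m with
    | zero =>
      refine ok_treeQ_ext hm b 0 (fun _ _ _ j hj => absurd hj (Nat.not_lt_zero j))
        fun _ m' hdr _ => ?_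
      rw [mem_digitRange] at hdr
      have := abs_le.2 (show -1 ≤ ends b K ∧ ends b K ≤ 1 by constructor <;> linarith)
      linarith
    | succ N ih =>
      have hK := (exists_concStar_of_SKstar hm).1
      refine ok_treeQ_ext hm b 0 (fun _ _ _ j hj => absurd hj (Nat.not_lt_zero j))
        fun _ m' hdr hm' => ih hm' ?_
      rw [ends_digitPart hK hdr, sub_zero, abs_mul, Nat.abs_ofNat]
      rw [pow_succ] at hN
      linarith

theorem grayPart_eq_one {K : Set ℝ} (hK : IsNonemptyCompact K) {b : Bool}
    (h : ∀ x ∈ K, grayDigit b * x ≤ 0) (hne : (cut K (grayDigit b)).Nonempty) :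
    grayPart b K = {1} := by
  cases b with
  | true =>
    refine grayPart_true_of_nonneg hK (fun x hx => ?_) hne
    have := h x hx
    simp only [grayDigit] at this
    linarith
  | false =>
    have h1 := grayPart_neg true K
    rw [Bool.not_true] at h1
    rw [← h1]
    refine grayPart_true_of_nonneg hK.neg (fun x hx => ?_) ?_
    · have := h (-x) hx
      simp only [grayDigit] at this
      linarith
    · rw [cut_neg, Set.nonempty_neg, ← grayDigit_not]
      exact hne

/-- Induction on the length of the query, simultaneously for all trees, with a case distinction on
the extreme digit. The sign question, whose length does not decrease, has already been settled by
`ok_treeQ_sign`. -/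
theorem validTo_treeQ (n : ℕ) : ∀ {K : Set ℝ} {m : D}, m ∈ (SKstar K).rz → ValidTo n K (treeQ m) := by
  induction n with
  | zero => exact fun _ π hπ => absurd hπ (Nat.not_lt_zero _)
  | succ n ih =>
    intro K m hm π hπ hdf
    have hK := (exists_concStar_of_SKstar hm).1
    cases π with
    | ext b k =>
      refine ok_treeQ_ext hm b k (fun K' m' hm' j hj => ih hm' (.ext b j) ?_ trivial)
        fun _ m' _ hm' => ok_treeQ_sign hm' b
      exact lt_of_lt_of_le hj (Nat.le_of_lt_succ hπ)
    | sub b π =>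
      have hπ' : π.size < n := Nat.lt_of_succ_lt_succ hπ
      obtain ⟨hne, hdf⟩ := hdf
      have hone : (∀ x ∈ K, grayDigit b * x ≤ 0) →
          SignTests (π.val (grayPart b K)) (one (enc π true)) (one (enc π false)) := by
        intro h
        rw [grayPart_eq_one hK h hne] at hdf ⊢
        exact validTo_one n π hπ' hdf
      have hzero : ∀ m', m' ∈ (SKstar (digitPart K 0)).rz →
          (∀ x ∈ cut K (grayDigit b), x ∈ digitRange 0) →
          Ok (grayPart b K) (nodeS one fun z => treeQ m' (qSub b z)) π := by
        intro m' hm' h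
        have hT := hK.grayPart hne
        have hT0 : ∀ y ∈ grayPart b K, 0 ≤ y := by
          rintro _ ⟨x, hx, rfl⟩
          exact tent_nonneg_iff.2 (h x hx)
        -- `nodeS` removes one layer of the query and `qSub` puts one back, so the induction
        -- hypothesis still applies to the tree for the digit 0.
        obtain ⟨n, rfl⟩ : ∃ k, n = k + 1 := ⟨n - 1, by omega⟩
        refine validTo_nodeS hT hT0 (validTo_one n) (fun π' hπ'' hdf' => ?_) π hπ' hdf
        have h1 : (cut (grayPart b K) 1).Nonempty := by
          obtain ⟨x, hx⟩ := hne
          exact cut_grayPart_one hK b ▸ ⟨_, x, ⟨hx, h x hx⟩, rfl⟩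
        have h2 := ih hm' (.sub b π') (Nat.succ_lt_succ hπ'')
          ⟨(cut_digitPart_zero_nonempty hK b).2 h1, by rwa [grayPart_digitPart_zero hK]⟩
        rwa [Ok, Pos.val, grayPart_digitPart_zero hK] at h2
      refine ok_treeQ_of_leaf hm fun E e g hl => ?_
      obtain ⟨d, hd⟩ := isExtremeDigit_dig b hl.digits
      have ht := hl.tree d _ hd.isDigit hd.mem
      have hle := fun x hx => hl.mem_of_extreme hK hd (x := x) hx
      have hmid : d = 0 → ∀ x ∈ cut K (grayDigit b), x ∈ digitRange 0 := by
        rintro rfl x hx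
        have h1 := hle x hx.1
        have h2 := ((mem_cut_grayDigit hK).1 hx).2
        rw [mem_digitRange]
        cases b <;> simp only [grayDigit] at h1 h2 <;> constructor <;> linarith
      have hdig := hd.isDigit
      cases b with
      | true =>
        simp only [enc, leafQ_sub_true]
        generalize dig true e = c at hdig ht
        cases hdig with
        | neg =>
          simp only [caseD_dNeg]
          simp only [Pos.val, grayPart_true hK] at hdf ⊢
          exact ih ht π hπ' hdf
        | zero =>
          simp only [caseD_dZero]
          exact hzero _ ht (hmid rfl)
        | pos =>
          simp only [caseD_dPos]
          exact hone fun x hx => by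
            have := hle x hx
            simp only [grayDigit] at this ⊢
            linarith
      | false =>
        simp only [enc, leafQ_sub_false]
        generalize dig false e = c at hdig ht
        cases hdig with
        | neg =>
          simp only [caseD_dNeg]
          exact hone fun x hx => by
            have := hle x hx
            simp only [grayDigit] at this ⊢
            linarith
        | zero =>
          simp only [caseD_dZero]
          exact hzero _ ht (hmid rfl)
        | pos =>
          simp only [caseD_dPos]
          simp only [Pos.val, grayPart_false hK] at hdf ⊢
          exact (ih ht).neg π hπ' hdf

theorem valid_treeQ {K : Set ℝ} {m : D} (hm : m ∈ (SKstar K).rz) : Valid K (treeQ m) :=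
  fun π hd => validTo_treeQ (π.size + 1) hm π (Nat.lt_succ_self _) hd

end CFP

namespace CFP

open Formula
open scoped Pointwise

/-! ## Gray code trees from answers -/

theorem app_comp {c : D → D} (hc : Def1 fun _ q => c q) (κ q : D) :
    D.app (D.fn fun q => D.app κ (c q)) q = D.app κ (c q) :=
  Def1.beta (F := fun κ q => D.app κ (c q)) (fun Γ _ => Def.app Def.var1 (hc Γ)) κ q

theorem def1_qTail : Def1 fun _ r => qTail r := fun _ _ => Def.pair Def.var0 Def.nil

theorem def1_qExt (b : Bool) : Def1 fun _ r => qExt b r := fun _ _ => by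
  cases b
  · exact Def.right Def.var0
  · exact Def.left Def.var0

theorem def1_qSub (b : Bool) : Def1 fun _ q => qSub b q := fun _ _ => by
  cases b
  · exact Def.amb Def.var0 Def.nil
  · exact Def.pair Def.var0 Def.nil

theorem guard_left_mem_ty {A B : Formula} {t a : D} (h : a ∈ A.ty) :
    guard t (D.left a) ∈ (or A B).ty := by
  rcases guard_cases t (D.left a) with h' | ⟨-, h'⟩ <;> rw [h']
  · exact .inl rfl
  · exact .inr (.inl ⟨_, h, rfl⟩)

theorem signs_mem_ty (x : ℝ) (n p : D) :
    D.amb (guard n (D.left (D.left D.nil))) (guard p (D.left (D.right D.nil))) ∈ (Dstar x).ty :=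
  concStar_ty_amb (A := or (nc (x ≤ 0)) (nc (x ≥ 0)))
    (guard_left_mem_ty (.inr (.inl ⟨_, .inr rfl, rfl⟩)))
    (guard_left_mem_ty (.inr (.inr ⟨_, .inr rfl, rfl⟩)))

theorem signs_mem_rz {x : ℝ} {n p : D} (h : SignTests x n p) :
    D.amb (guard n (D.left (D.left D.nil))) (guard p (D.left (D.right D.nil))) ∈ (Dstar x).rz := by
  refine ⟨signs_mem_ty x n p, fun hx => concStar_rz_amb (A := or (nc (x ≤ 0)) (nc (x ≥ 0)))
    (guard_left_mem_ty (.inr (.inl ⟨_, .inr rfl, rfl⟩)))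
    (guard_left_mem_ty (.inr (.inr ⟨_, .inr rfl, rfl⟩))) ?_ (fun h0 => ?_) fun h0 => ?_⟩
  · refine (h.total hx).imp (fun e => ?_) fun e => ?_ <;> rw [e, guard_nil] <;>
      exact D.left_ne_bot _
  · rcases guard_cases n (D.left (D.left D.nil)) with h1 | ⟨h1, h2⟩
    · exact absurd h1 h0
    · rw [h2]
      exact .inl ⟨_, .inl ⟨_, ⟨rfl, h.neg h1⟩, rfl⟩, rfl⟩
  · rcases guard_cases p (D.left (D.right D.nil)) with h1 | ⟨h1, h2⟩
    · exact absurd h1 h0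
    · rw [h2]
      exact .inl ⟨_, .inr ⟨_, ⟨rfl, h.pos h1⟩, rfl⟩, rfl⟩

theorem gray_mem_ty (x : ℝ) (ρ : D) : gray ρ ∈ (Gstar x).ty := by
  unfold Gstar
  refine mem_nu_ty (t := Set.range gray) ?_ ⟨ρ, rfl⟩
  rintro _ ⟨ρ, rfl⟩
  rw [gray_eq]
  exact Set.mem_iUnion.2 ⟨0, .inr ⟨_, signs_mem_ty 0 _ _, _, ⟨_, rfl⟩, rfl⟩⟩

/-- Coinduction with the codes built from right answers as post-fixed point. At 0 both tests may
fail forever, but there only the type of the sign realiser is required. -/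
theorem gray_mem_rz {x : ℝ} (hx : -1 ≤ x ∧ x ≤ 1) {ρ : D} (h : ∀ k, OkR x (D.app ρ) k) :
    gray ρ ∈ (Gstar x).rz := by
  refine ⟨fun x => {g | (-1 ≤ x ∧ x ≤ 1) ∧ ∃ ρ, g = gray ρ ∧ ∀ k, OkR x (D.app ρ) k}, ?_,
    hx, ρ, rfl, h⟩
  rintro x _ ⟨hx, ρ, rfl, h⟩
  rw [gray_eq]
  refine ⟨hx, _, signs_mem_rz (h 0), _, ⟨tent_mem_Icc hx, _, rfl, fun k => ?_⟩, rfl⟩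
  rw [funext (app_comp def1_qTail ρ)]
  exact h (k + 1)

theorem grayTree_mem_ty (K : Set ℝ) (κ : D) : grayTree κ ∈ (GKstar K).ty := by
  unfold GKstar
  -- `⊥` is added because the function component returns it at arguments that are not digits.
  refine mem_nu_ty (t := {⊥} ∪ Set.range grayTree) ?_ (.inr ⟨κ, rfl⟩)
  rintro _ (rfl | ⟨κ, rfl⟩)
  · exact Set.mem_iUnion.2 ⟨∅, .inl rfl⟩
  · rw [grayTree_eq]
    refine Set.mem_iUnion.2 ⟨∅, .inr ⟨_, gray_mem_ty _ _, _, .inr ⟨_, gray_mem_ty _ _, _, ?_, rfl⟩,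
      rfl⟩⟩
    refine Set.mem_iUnion.2 ⟨0, .inr ⟨_, def2_grayFun.scottContinuous _ _, rfl, fun a _ => ?_⟩⟩
    unfold grayFun
    rcases caseLR_cases a _ _ with h | ⟨_, h⟩ | ⟨_, h⟩ <;> rw [h]
    · exact .inl rfl
    · exact .inr ⟨_, rfl⟩
    · exact .inr ⟨_, rfl⟩

theorem grayFun_mem_ty (K : Set ℝ) (κ d : D) :
    grayFun (rec1 grayTreeF) κ d ∈ (GKstar K).ty := by
  unfold grayFun
  rcases caseLR_cases d _ _ with h | ⟨_, h⟩ | ⟨_, h⟩ <;> rw [h]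
  · unfold GKstar
    refine mem_nu_ty (t := {⊥}) (fun _ h => ?_) rfl
    exact Set.mem_iUnion.2 ⟨∅, .inl h⟩
  · exact grayTree_mem_ty K _
  · exact grayTree_mem_ty K _

theorem ends_bounds {K : Set ℝ} (hK : IsNonemptyCompact K) (b : Bool) :
    -1 ≤ ends b K ∧ ends b K ≤ 1 := hK.2.2 (ends_mem hK b)

theorem grayTree_mem_rz {K : Set ℝ} (hK : IsNonemptyCompact K) {κ : D} (h : Valid K (D.app κ)) :
    grayTree κ ∈ (GKstar K).rz := by
  refine ⟨fun K => {g | IsNonemptyCompact K ∧ ∃ κ, g = grayTree κ ∧ Valid K (D.app κ)}, ?_,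
    hK, κ, rfl, h⟩
  rintro K _ ⟨hK, κ, rfl, h⟩
  rw [grayTree_eq]
  have hends : ∀ b, gray (D.fn fun r => D.app κ (qExt b r)) ∈ (Gstar (ends b K)).rz := by
    intro b
    refine gray_mem_rz (ends_bounds hK b) fun k => ?_
    rw [funext (app_comp (def1_qExt b) κ)]
    exact h (.ext b k) trivial
  have hsub : ∀ b, (cut K (grayDigit b)).Nonempty →
      Valid (grayPart b K) (D.app (D.fn fun q => D.app κ (qSub b q))) := by
    intro b hb
    rw [funext (app_comp (def1_qSub b) κ)]
    exact h.sub hb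
  refine ⟨hK, _, hends true, _, ⟨_, hends false, _, fun d => ⟨?_, ?_⟩, rfl⟩, rfl⟩
  · exact .inr ⟨_, def2_grayFun.scottContinuous _ _, rfl, fun a _ => grayFun_mem_ty ∅ _ _⟩
  · intro a ha
    rw [def2_grayFun.beta]
    refine ⟨grayFun_mem_ty ∅ _ _, fun hd => ?_⟩
    rcases ha with ⟨_, ⟨-, rfl⟩, rfl⟩ | ⟨_, ⟨-, rfl⟩, rfl⟩
    · rw [grayFun, caseLR_left]
      exact ⟨hK.grayPart (b := true) hd, _, rfl, hsub true hd⟩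
    · rw [grayFun, caseLR_right]
      exact ⟨hK.grayPart (b := false) hd, _, rfl, hsub false hd⟩

/-! ## Gray code trees answer queries -/

theorem app_isSgn (s : Bool) (u : D) : D.app (D.fn fun u => isSgn s u) u = isSgn s u := by
  refine Def1.beta (F := fun _ u => isSgn s u) (fun Γ _ => ?_) ⊥ u
  cases s <;> simp only [isSgn, caseLR] <;>
  repeat' with_reducible first
    | exact Def.var0 | exact Def.bot | exact Def.nil | apply Def.cases

theorem signTests_isSgn {x : ℝ} {m : D} (hm : m ∈ (Dstar x).rz) :
    SignTests x (search (D.fn fun u => isSgn true u) m) (search (D.fn fun u => isSgn false u) m) := by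
  by_cases hx : x = 0
  · subst hx
    exact ⟨fun _ => le_rfl, fun _ => le_rfl, fun h => absurd rfl h⟩
  · refine signTests_search (fun u hu => ?_) (hm.2 hx)
    rw [app_isSgn, app_isSgn]
    rcases hu with ⟨_, ⟨-, h⟩, rfl⟩ | ⟨_, ⟨-, h⟩, rfl⟩
    · simpa [isSgn] using signTests_of_neg h
    · simpa [isSgn] using signTests_of_pos h

theorem okR_grayAns {x : ℝ} {g : D} (hg : g ∈ (Gstar x).rz) (k : ℕ) : OkR x (grayAns g) k := by
  obtain ⟨r, hr, hg⟩ := hg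
  induction k generalizing x g with
  | zero =>
    obtain ⟨-, m, hm, g', -, rfl⟩ := hr x hg
    simpa [OkR, encR, grayAns_pair] using signTests_isSgn hm
  | succ k ih =>
    obtain ⟨-, m, -, g', hg', rfl⟩ := hr x hg
    have := ih hg'
    rw [← okR_tail]
    simpa [OkR, grayAns_pair] using this

theorem isNonemptyCompact_of_GKstar {K : Set ℝ} {g : D} (hg : g ∈ (GKstar K).rz) :
    IsNonemptyCompact K := by
  obtain ⟨r, hr, hg⟩ := hg
  exact (hr K hg).1

theorem valid_grayTreeAns {K : Set ℝ} {g : D} (hg : g ∈ (GKstar K).rz) :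
    Valid K (grayTreeAns g) := by
  obtain ⟨r, hr, hg⟩ := hg
  intro π
  induction π generalizing K g with
  | ext b k =>
    intro _
    obtain ⟨-, g1, h1, _, ⟨g2, h2, f, -, rfl⟩, rfl⟩ := hr K hg
    cases b with
    | true =>
      have : OkR (ends true K) (grayAns g1) k := okR_grayAns h1 k
      simpa [Ok, enc, Pos.val, grayTreeAns_pair] using this
    | false =>
      have : OkR (ends false K) (grayAns g2) k := okR_grayAns h2 k
      simpa [Ok, enc, Pos.val, grayTreeAns_pair] using this
  | sub b π ih =>
    rintro ⟨hne, hd⟩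
    obtain ⟨-, g1, -, _, ⟨g2, -, f, hf, rfl⟩, rfl⟩ := hr K hg
    cases b with
    | true =>
      have h1 := ((hf (-1)).2 (D.left D.nil) (.inl ⟨_, ⟨rfl, rfl⟩, rfl⟩)).2 hne
      have := ih h1 hd
      simp only [Ok, enc, grayTreeAns_pair, caseS_sub_true]
      exact this
    | false =>
      have h1 := ((hf 1).2 (D.right D.nil) (.inr ⟨_, ⟨rfl, rfl⟩, rfl⟩)).2 hne
      have := ih h1 hd
      simp only [Ok, enc, grayTreeAns_pair, caseS_sub_false]
      exact this

end CFP

namespace CFP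

open Formula
open scoped Pointwise

/-! ## Signed-digit trees from answers -/

/-- The operator whose least fixed point is `PFin SD`. -/
def pFinOp (Z : Set ℝ → Formula) (E : Set ℝ) : Formula :=
  or (ex fun x => ncAnd (E = {x}) (SD x))
    (ex fun v => and (Z v) (ex fun y => ncAnd (E = v ∪ {y}) (SD y)))

theorem PFin_SD_eq : PFin SD = mu pFinOp := rfl

theorem pFinOp_ty_mono (s t : Set D) (h : s ⊆ t) :
    (⋃ E, (pFinOp (fun _ => ⟨True, s, ∅⟩) E).ty) ⊆ ⋃ E, (pFinOp (fun _ => ⟨True, t, ∅⟩) E).ty := by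
  refine Set.iUnion_mono fun E => or_ty_mono le_rfl (Set.iUnion_mono fun v => ?_)
  rintro c (hc | ⟨a, ha, b, hb, rfl⟩)
  · exact .inl hc
  · exact .inr ⟨a, h ha, b, hb, rfl⟩

theorem IsDigit.mem_ty {d : ℝ} {c : D} (h : IsDigit d c) (d' : ℝ) : c ∈ (SD d').ty := by
  cases h
  · exact .inr (.inl ⟨_, .inr (.inl ⟨_, .inr rfl, rfl⟩), rfl⟩)
  · exact .inr (.inr ⟨_, .inr rfl, rfl⟩)
  · exact .inr (.inl ⟨_, .inr (.inr ⟨_, .inr rfl, rfl⟩), rfl⟩)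

theorem left_mem_PFin_ty {d : ℝ} {c : D} (h : IsDigit d c) (E : Set ℝ) :
    D.left c ∈ (PFin SD E).ty := by
  rw [PFin_SD_eq]
  refine fixTy_fold pFinOp_ty_mono (Set.mem_iUnion.2 ⟨E, ?_⟩)
  exact .inr (.inl ⟨c, Set.mem_iUnion.2 ⟨d, h.mem_ty d⟩, rfl⟩)

theorem right_mem_PFin_ty {d : ℝ} {c e : D} (h : IsDigit d c) {E : Set ℝ}
    (he : e ∈ (PFin SD E).ty) : D.right (D.pair e c) ∈ (PFin SD E).ty := by
  rw [PFin_SD_eq] at he ⊢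
  refine fixTy_fold pFinOp_ty_mono (Set.mem_iUnion.2 ⟨E, ?_⟩)
  exact .inr (.inr ⟨_, Set.mem_iUnion.2 ⟨E, .inr ⟨e, he, c,
    Set.mem_iUnion.2 ⟨d, h.mem_ty d⟩, rfl⟩⟩, rfl⟩)

theorem left_mem_PFin_rz {d : ℝ} {c : D} (h : IsDigit d c) : D.left c ∈ (PFin SD {d}).rz :=
  fun _ hr => hr {d} (.inl ⟨c, ⟨d, rfl, h.mem_rz⟩, rfl⟩)

theorem right_mem_PFin_rz {d : ℝ} {c e : D} (h : IsDigit d c) {v : Set ℝ}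
    (he : e ∈ (PFin SD v).rz) : D.right (D.pair e c) ∈ (PFin SD (v ∪ {d})).rz :=
  fun r hr => hr (v ∪ {d}) (.inr ⟨_, ⟨v, e, he r hr, c, ⟨d, rfl, h.mem_rz⟩, rfl⟩, rfl⟩)

/-- The formula under the concurrency modality in the definition of `SKstar`. -/
def skBody (Y : Set ℝ → Formula) (K : Set ℝ) : Formula :=
  ex fun E : Set ℝ => and (PFin SD E) (ncAnd (K ⊆ ⋃ d ∈ E, digitRange d)
    (all fun d => imp (SD d) (ncImp (d ∈ E)
      (ncAnd (cut K d).Nonempty (Y (digitPart K d))))))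

/-- The operator whose greatest fixed point is `SKstar`. -/
def skOp (Y : Set ℝ → Formula) (K : Set ℝ) : Formula :=
  ncAnd (IsNonemptyCompact K) (concStar (skBody Y K))

theorem SKstar_eq : SKstar = nu skOp := rfl

theorem digitFun_cases (bmin bmax : Bool) (κ d : D) :
    digitFun bmin bmax (rec1 digitTreeF) κ d = ⊥ ∨
      ∃ κ', digitFun bmin bmax (rec1 digitTreeF) κ d = digitTree κ' := by
  unfold digitFun
  rcases caseD_cases d _ _ _ with h | h | h | h <;> rw [h]
  · exact .inl rfl
  · exact .inr ⟨_, rfl⟩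
  · exact .inr ⟨_, rfl⟩
  · exact .inr ⟨_, rfl⟩

theorem digitChoices_mem_ty {Y : Set ℝ → Formula} (h0 : ∀ K, ⊥ ∈ (Y K).ty)
    (h1 : ∀ K κ, digitTree κ ∈ (Y K).ty) (K : Set ℝ) (κ : D) :
    ∀ p ∈ digitChoices (rec1 digitTreeF) κ, p.2 ∈ (skBody Y K).ty := by
  -- Types ignore the set of digits and the digit, so the empty set and 0 serve as dummies.
  have hf : ∀ bmin bmax, (D.fn fun d => digitFun bmin bmax (rec1 digitTreeF) κ d) ∈
      (ncAnd (K ⊆ ⋃ d ∈ (∅ : Set ℝ), digitRange d) (all fun d => imp (SD d) (ncImp (d ∈ (∅ : Set ℝ))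
        (ncAnd (cut K d).Nonempty (Y (digitPart K d)))))).ty := by
    refine fun bmin bmax => Set.mem_iUnion.2 ⟨0, .inr ⟨_,
      (def2_digitFun bmin bmax).scottContinuous _ _, rfl, fun a _ => ?_⟩⟩
    rcases digitFun_cases bmin bmax κ a with h | ⟨κ', h⟩ <;> rw [h]
    · exact h0 _
    · exact h1 _ _
  have hp : ∀ e bmin bmax, e ∈ (PFin SD ∅).ty →
      D.pair e (D.fn fun d => digitFun bmin bmax (rec1 digitTreeF) κ d) ∈ (skBody Y K).ty :=
    fun e bmin bmax he => Set.mem_iUnion.2 ⟨∅, .inr ⟨e, he, _, hf bmin bmax, rfl⟩⟩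
  intro p hp'
  simp only [digitChoices, List.mem_cons, List.not_mem_nil, or_false] at hp'
  rcases hp' with rfl | rfl | rfl | rfl | rfl | rfl
  · exact hp _ _ _ (left_mem_PFin_ty .neg _)
  · exact hp _ _ _ (left_mem_PFin_ty .pos _)
  · exact hp _ _ _ (right_mem_PFin_ty .pos (left_mem_PFin_ty .neg _))
  · exact hp _ _ _ (left_mem_PFin_ty .zero _)
  · exact hp _ _ _ (right_mem_PFin_ty .zero (left_mem_PFin_ty .neg _))
  · exact hp _ _ _ (right_mem_PFin_ty .pos (left_mem_PFin_ty .zero _))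

theorem bot_mem_fixTy_skOp : ⊥ ∈ fixTy skOp :=
  subset_fixTy (t := {⊥}) (fun _ h => Set.mem_iUnion.2 ⟨∅, by
    rw [Set.mem_singleton_iff.1 h]
    exact bot_mem_concStar_ty _⟩) rfl

theorem digitTree_mem_fixTy (κ : D) : digitTree κ ∈ fixTy skOp := by
  refine subset_fixTy (t := {⊥} ∪ Set.range digitTree) ?_ (.inr ⟨κ, rfl⟩)
  rintro _ (rfl | ⟨κ, rfl⟩)
  · exact Set.mem_iUnion.2 ⟨∅, bot_mem_concStar_ty _⟩
  · rw [digitTree_eq]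
    refine Set.mem_iUnion.2 ⟨∅, choice_mem_ty (digitChoices_mem_ty ?_ ?_ ∅ κ)⟩
    · exact fun _ => .inl rfl
    · exact fun _ κ => .inr ⟨κ, rfl⟩

/-! ### The middle part -/

/-- The end of `K` on side `b` has the greatest absolute value in that half, and the tent map
decreases in |x|. -/
theorem ends_grayPart {K : Set ℝ} (hK : IsNonemptyCompact K) {b : Bool}
    (h : (cut K (grayDigit b)).Nonempty) : ends true (grayPart b K) = tent (ends b K) := by
  have h0 := (cut_grayDigit_nonempty hK).1 h
  have habs : ∀ x, 0 ≤ grayDigit b * x → |x| = grayDigit b * x := by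
    intro x hx
    cases b <;> simp only [grayDigit] at hx ⊢
    · rw [abs_of_nonneg (by linarith), one_mul]
    · rw [abs_of_nonpos (by linarith), neg_one_mul]
  refine ends_eq (K := grayPart b K)
    (Set.mem_image_of_mem _ ((mem_cut_grayDigit hK).2 ⟨ends_mem hK b, h0⟩)) true ?_
  rintro _ ⟨x, hx, rfl⟩
  have h1 := ((mem_cut_grayDigit hK).1 hx).2
  have h2 := le_ends hK b x hx.1
  rw [tent, tent, habs _ h0, habs _ h1, show grayDigit true = -1 from rfl]
  linarith

theorem digitPart_one {K : Set ℝ} (hK : IsNonemptyCompact K) :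
    digitPart K 1 = -grayPart false K := by rw [grayPart_false hK, neg_neg]

/-- The extremal element of `K_0` can be found: it is that of `K`, or it belongs to the
non-positive (`b = true`) or non-negative (`b = false`) part. -/
def MidOk (b : Bool) (K : Set ℝ) : Bool → Prop
  | true => ends b K ∈ digitRange 0
  | false => (cut (grayPart b K) 1).Nonempty

theorem nonempty_of_cut_grayPart {K : Set ℝ} {b : Bool} {d : ℝ}
    (h : (cut (grayPart b K) d).Nonempty) : (cut K (grayDigit b)).Nonempty :=
  Set.image_nonempty.1 (h.mono Set.inter_subset_left)

theorem okR_dblR {x : ℝ} {ρ : D → D} (hx : x ∈ digitRange 0) (h : ∀ k, OkR x ρ k) (k : ℕ) :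
    OkR (2 * x) (dblR ρ) k := by
  cases k with
  | zero =>
    have h0 : SignTests x (ρ (qSgn true)) (ρ (qSgn false)) := h 0
    simpa [OkR, encR, dblR] using signTests_two_mul.2 h0
  | succ k =>
    have h1 : OkR (tent (tent x)) (fun r => ρ (qTail (qTail r))) k := h (k + 2)
    have h2 : tent (2 * x) = -tent (tent x) := by
      rw [tent_of_nonneg (tent_nonneg_iff.2 hx)]
      simp only [tent, abs_mul, Nat.abs_ofNat]
      ring
    simpa [OkR, encR, dblR] using h1.flip h2

/-- Halves of 2K_0: their tent images are the digit-1 parts of the tent images of the halves of K,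
that is, reflected second tent images. Ends of 2K_0: twice the end of K if that lies in K_0;
otherwise the sign is known from the half in question, and the tent image of the end is the minimum
of the tent image of that half, hence minus a maximum that κ can be asked about. -/
theorem valid_midQ {K : Set ℝ} (hK : IsNonemptyCompact K) (h0 : (cut K 0).Nonempty) {κ : D}
    (h : Valid K (D.app κ)) {bmin bmax : Bool} (hmin : MidOk true K bmin)
    (hmax : MidOk false K bmax) : Valid (digitPart K 0) (midQ bmin bmax κ) := by
  have hK0 := hK.digitPart h0
  have hsub : ∀ b π, (cut (digitPart K 0) (grayDigit b)).Nonempty →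
      π.Dfd (grayPart b (digitPart K 0)) → Ok (grayPart b (digitPart K 0))
        (fun q => D.app κ (qSub b (qSub false (flipS q)))) π := by
    intro b π hb hd
    rw [cut_digitPart_zero_nonempty hK] at hb
    have hL := nonempty_of_cut_grayPart hb
    rw [grayPart_digitPart_zero hK, digitPart_one (hK.grayPart hL)] at hd ⊢
    exact ((h.sub hL).sub (b := false) hb).neg π hd
  have hind : ∀ b k, MidOk b K false → OkR (tent (ends b (digitPart K 0)))
      (fun r => D.app κ (qSub b (qSub false (qExt false (flipR r))))) k := by
    intro b k hb
    have hL := nonempty_of_cut_grayPart hb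
    have h1 : OkR (ends false (grayPart false (grayPart b K)))
      (fun r => D.app κ (qSub b (qSub false (qExt false r)))) k :=
        ((h.sub hL).sub (b := false) hb) (.ext false k) trivial
    refine h1.flip ?_
    rw [← ends_grayPart hK0 ((cut_digitPart_zero_nonempty hK b).2 hb),
      grayPart_digitPart_zero hK, digitPart_one (hK.grayPart hL), ends_neg, Bool.not_true]
  have hdir : ∀ b k, MidOk b K true → OkR (ends b (digitPart K 0))
      (dblR fun z => D.app κ (qExt b z)) k := by
    intro b k hb
    rw [ends_digitPart hK hb, sub_zero]
    exact okR_dblR (ρ := fun z => D.app κ (qExt b z)) hb (fun k => h (.ext b k) trivial) k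
  rintro (⟨b, k⟩ | ⟨b, π⟩) hd
  · cases b with
    | true =>
      cases bmin with
      | true => simpa [Ok, enc, Pos.val, midQ] using hdir true k hmin
      | false =>
        cases k with
        | zero =>
          have h1 := (cut_grayDigit_nonempty hK0).1 ((cut_digitPart_zero_nonempty hK true).2 hmin)
          simp only [grayDigit] at h1
          simpa [Ok, enc, encR, Pos.val, midQ] using
            signTests_of_neg (show ends true (digitPart K 0) ≤ 0 by linarith)
        | succ k => simpa [Ok, enc, encR, Pos.val, midQ] using hind true k hmin
    | false =>
      cases bmax with
      | true => simpa [Ok, enc, Pos.val, midQ] using hdir false k hmax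
      | false =>
        cases k with
        | zero =>
          have h1 := (cut_grayDigit_nonempty hK0).1 ((cut_digitPart_zero_nonempty hK false).2 hmax)
          simp only [grayDigit] at h1
          simpa [Ok, enc, encR, Pos.val, midQ] using
            signTests_of_pos (show 0 ≤ ends false (digitPart K 0) by linarith)
        | succ k => simpa [Ok, enc, encR, Pos.val, midQ] using hind false k hmax
  · cases b
    · simpa [Ok, enc, Pos.val, midQ] using hsub false π hd.1 hd.2
    · simpa [Ok, enc, Pos.val, midQ] using hsub true π hd.1 hd.2

/-! ### The choice of the digits -/

/-- The trees that are built from right answers. -/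
def treeRz (K : Set ℝ) : Set D := {m | IsNonemptyCompact K ∧ ∃ κ, m = digitTree κ ∧ Valid K (D.app κ)}

/-- Valid answers for K yield valid answers for every digit part: directly for -1, up to reflection
for 1, and by `valid_midQ` for 0. The flags therefore matter only when 0 is among the digits. -/
theorem leaf_mem_rz {K : Set ℝ} (hK : IsNonemptyCompact K) {κ : D} (h : Valid K (D.app κ))
    {E : Set ℝ} {e : D} (he : e ∈ (PFin SD E).rz) (hcov : K ⊆ ⋃ d ∈ E, digitRange d)
    (hne : ∀ d ∈ E, (cut K d).Nonempty) {bmin bmax : Bool}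
    (hmid : 0 ∈ E → MidOk true K bmin ∧ MidOk false K bmax) :
    D.pair e (D.fn fun d => digitFun bmin bmax (rec1 digitTreeF) κ d) ∈
      (skBody (fun K => ⟨True, fixTy skOp, treeRz K⟩) K).rz := by
  have hty : ∀ a, digitFun bmin bmax (rec1 digitTreeF) κ a ∈ fixTy skOp := by
    intro a
    rcases digitFun_cases bmin bmax κ a with h | ⟨κ', h⟩ <;> rw [h]
    · exact bot_mem_fixTy_skOp
    · exact digitTree_mem_fixTy _
  refine ⟨E, e, he, _, ⟨hcov, fun d => ⟨?_, fun c hc => ?_⟩⟩, rfl⟩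
  · exact .inr ⟨_, (def2_digitFun bmin bmax).scottContinuous _ _, rfl, fun a _ => hty a⟩
  · rw [(def2_digitFun bmin bmax).beta]
    refine ⟨hty c, fun hd => ⟨hne d hd, hK.digitPart (hne d hd), ?_⟩⟩
    have hc' := isDigit_of_mem_rz hc
    cases hc' with
    | neg =>
      refine ⟨_, by rw [digitFun, caseD_dNeg]; rfl, ?_⟩
      rw [← grayPart_true hK, funext (app_comp (def1_qSub true) κ)]
      exact h.sub (b := true) (hne _ hd)
    | zero =>
      refine ⟨_, by rw [digitFun, caseD_dZero]; rfl, ?_⟩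
      rw [funext (app_midV bmin bmax κ)]
      exact valid_midQ hK (hne _ hd) h (hmid hd).1 (hmid hd).2
    | pos =>
      refine ⟨_, by rw [digitFun, caseD_dPos]; rfl, ?_⟩
      rw [funext (app_comp (c := fun q => qSub false (flipS q)) ?_ κ), digitPart_one hK]
      · exact (h.sub (b := false) (hne _ hd)).neg
      · intro Γ _
        simp only [flipS, flipR, caseS, caseR, qSub, qExt, qSgn, qTail]
        repeat' with_reducible first
          | exact Def.var0 | exact Def.var1 | exact Def.var2 | exact Def.var3 | exact Def.bot
          | exact Def.nil | apply Def.cases | apply Def.left | apply Def.right | apply Def.pair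
          | apply Def.amb

theorem SignTests.pos_of_pos {x : ℝ} {n p : D} (h : SignTests x n p) (hx : 0 < x) : p = D.nil :=
  (h.total hx.ne').resolve_left fun e => absurd (h.neg e) (not_le.2 hx)

theorem tent_eq_one {x : ℝ} (h : x = 0) : tent x = 1 := by simp [tent, h]

/-- If `0` belongs to `K`, then the maximum of the image of either part under the tent map is
positive. -/
theorem ends_grayPart_pos {K : Set ℝ} (hK : IsNonemptyCompact K) (h : (0 : ℝ) ∈ K) (b : Bool) :
    (cut K (grayDigit b)).Nonempty ∧ 0 < ends false (grayPart b K) := by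
  have h1 : (0 : ℝ) ∈ cut K (grayDigit b) := (mem_cut_grayDigit hK).2 ⟨h, by simp⟩
  refine ⟨⟨0, h1⟩, ?_⟩
  have h2 := le_ends (hK.grayPart ⟨0, h1⟩) false (tent 0) (Set.mem_image_of_mem _ h1)
  simp only [grayDigit, tent_eq_one rfl] at h2
  linarith

/-- Which guard succeeds depends on which ends vanish. A non-zero end reveals its sign; an end equal
to 0 may not, but then its tent value 1 is seen to be positive, and so is the maximum of the tent
image of either half, which contains 1. -/
theorem exists_digitChoice {K : Set ℝ} (hK : IsNonemptyCompact K) {κ : D} (h : Valid K (D.app κ))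
    (s : D) : ∃ p ∈ digitChoices s κ, p.1 = D.nil := by
  have hA : SignTests (ends true K) (D.app κ (qExt true (qSgn true)))
    (D.app κ (qExt true (qSgn false))) := h (.ext true 0) trivial
  have hB : SignTests (ends false K) (D.app κ (qExt false (qSgn true)))
    (D.app κ (qExt false (qSgn false))) := h (.ext false 0) trivial
  have htent : ∀ b, ends b K = 0 → D.app κ (qExt b (qTail (qSgn false))) = D.nil := by
    intro b hb
    have h1 : SignTests (tent (ends b K)) (D.app κ (qExt b (qTail (qSgn true))))
      (D.app κ (qExt b (qTail (qSgn false)))) := h (.ext b 1) trivial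
    exact h1.pos_of_pos (by rw [tent_eq_one hb]; norm_num)
  have hpart : ∀ b b', ends b K = 0 → D.app κ (qSub b' (qExt false (qSgn false))) = D.nil := by
    intro b b' hb
    obtain ⟨h1, h2⟩ := ends_grayPart_pos hK (hb ▸ ends_mem hK b) b'
    have h3 : SignTests (ends false (grayPart b' K)) (D.app κ (qSub b' (qExt false (qSgn true))))
      (D.app κ (qSub b' (qExt false (qSgn false)))) := h (.sub b' (.ext false 0)) ⟨h1, trivial⟩
    exact h3.pos_of_pos h2
  simp only [digitChoices, List.exists_mem_cons_iff, guard_eq_nil]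
  by_cases h1 : D.app κ (qExt false (qSgn true)) = D.nil
  · exact .inl h1
  by_cases h2 : D.app κ (qExt true (qSgn false)) = D.nil
  · exact .inr (.inl h2)
  -- The tests for a one-sided `K` have failed, so a non-zero end must have answered with the other
  -- sign.
  by_cases ha : ends true K = 0 <;> by_cases hb : ends false K = 0
  · exact .inr (.inr (.inr (.inl ⟨htent _ ha, htent _ hb⟩)))
  · exact .inr (.inr (.inr (.inr (.inr (.inl
      ⟨(hB.total hb).resolve_left h1, htent _ ha, hpart _ _ ha⟩)))))
  · exact .inr (.inr (.inr (.inr (.inl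
      ⟨(hA.total ha).resolve_right h2, htent _ hb, hpart _ _ hb⟩))))
  · exact .inr (.inr (.inl ⟨(hA.total ha).resolve_right h2, (hB.total hb).resolve_left h1⟩))

theorem cut_zero_nonempty {K : Set ℝ} (hK : IsNonemptyCompact K) {b : Bool}
    (h : ends b K ∈ digitRange 0) : (cut K 0).Nonempty := ⟨_, ends_mem hK b, h⟩

theorem mem_of_le_ends {K : Set ℝ} (hK : IsNonemptyCompact K) {x : ℝ} (hx : x ∈ K) :
    (ends true K ≤ x ∧ x ≤ ends false K) ∧ -1 ≤ x ∧ x ≤ 1 := by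
  have h1 := le_ends hK true x hx
  have h2 := le_ends hK false x hx
  simp only [grayDigit] at h1 h2
  exact ⟨⟨by linarith, by linarith⟩, hK.2.2 hx⟩

theorem cut_neg_one_nonempty {K : Set ℝ} (hK : IsNonemptyCompact K) (h : ends true K ≤ 0) :
    (cut K (-1)).Nonempty :=
  (cut_grayDigit_nonempty (b := true) hK).2 (by simp only [grayDigit]; linarith)

theorem cut_one_nonempty {K : Set ℝ} (hK : IsNonemptyCompact K) (h : 0 ≤ ends false K) :
    (cut K 1).Nonempty :=
  (cut_grayDigit_nonempty (b := false) hK).2 (by simp only [grayDigit]; linarith)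

theorem digitChoices_mem_rz {K : Set ℝ} (hK : IsNonemptyCompact K) {κ : D}
    (h : Valid K (D.app κ)) : ∀ p ∈ digitChoices (rec1 digitTreeF) κ, p.1 = D.nil →
      p.2 ∈ (skBody (fun K => ⟨True, fixTy skOp, treeRz K⟩) K).rz := by
  have hA : SignTests (ends true K) (D.app κ (qExt true (qSgn true)))
    (D.app κ (qExt true (qSgn false))) := h (.ext true 0) trivial
  have hB : SignTests (ends false K) (D.app κ (qExt false (qSgn true)))
    (D.app κ (qExt false (qSgn false))) := h (.ext false 0) trivial
  have htent : ∀ b, D.app κ (qExt b (qTail (qSgn false))) = D.nil → ends b K ∈ digitRange 0 := by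
    intro b hb
    have h1 : SignTests (tent (ends b K)) (D.app κ (qExt b (qTail (qSgn true))))
      (D.app κ (qExt b (qTail (qSgn false)))) := h (.ext b 1) trivial
    exact tent_nonneg_iff.1 (h1.pos hb)
  have hpart : ∀ b, (cut K (grayDigit b)).Nonempty →
      D.app κ (qSub b (qExt false (qSgn false))) = D.nil → (cut (grayPart b K) 1).Nonempty := by
    intro b h1 hb
    have h3 : SignTests (ends false (grayPart b K)) (D.app κ (qSub b (qExt false (qSgn true))))
      (D.app κ (qSub b (qExt false (qSgn false)))) := h (.sub b (.ext false 0)) ⟨h1, trivial⟩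
    exact cut_one_nonempty (hK.grayPart h1) (h3.pos hb)
  have hends := (mem_of_le_ends hK (ends_mem hK true)).1.2
  intro p hp
  simp only [digitChoices, List.mem_cons, List.not_mem_nil, or_false] at hp
  rcases hp with rfl | rfl | rfl | rfl | rfl | rfl <;> simp only [guard_eq_nil] <;> intro hp
  · have hb := hB.neg hp
    -- The last argument is vacuous, as 0 is not among the digits.
    refine leaf_mem_rz hK h (left_mem_PFin_rz .neg) (fun x hx => ?_) ?_ (by norm_num)
    · have := mem_of_le_ends hK hx
      exact Set.mem_iUnion₂.2 ⟨-1, rfl, mem_digitRange.2 ⟨by linarith, by linarith⟩⟩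
    · rintro _ rfl
      exact cut_neg_one_nonempty hK (by linarith)
  · have ha := hA.pos hp
    refine leaf_mem_rz hK h (left_mem_PFin_rz .pos) (fun x hx => ?_) ?_ (by norm_num)
    · have := mem_of_le_ends hK hx
      exact Set.mem_iUnion₂.2 ⟨1, rfl, mem_digitRange.2 ⟨by linarith, by linarith⟩⟩
    · rintro _ rfl
      exact cut_one_nonempty hK (by linarith)
  · have ha := hA.neg hp.1
    have hb := hB.pos hp.2
    refine leaf_mem_rz hK h (right_mem_PFin_rz .pos (left_mem_PFin_rz .neg)) (fun x hx => ?_) ?_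
      (by norm_num)
    · have := mem_of_le_ends hK hx
      rcases le_total x 0 with hx0 | hx0
      · exact Set.mem_iUnion₂.2 ⟨-1, .inl rfl, mem_digitRange.2 ⟨by linarith, by linarith⟩⟩
      · exact Set.mem_iUnion₂.2 ⟨1, .inr rfl, mem_digitRange.2 ⟨by linarith, by linarith⟩⟩
    · rintro _ (rfl | rfl)
      · exact cut_neg_one_nonempty hK ha
      · exact cut_one_nonempty hK hb
  · have ha := htent _ hp.1
    have hb := htent _ hp.2
    refine leaf_mem_rz hK h (left_mem_PFin_rz .zero) (fun x hx => ?_) ?_ fun _ => ⟨ha, hb⟩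
    · have := mem_of_le_ends hK hx
      rw [mem_digitRange] at ha hb
      exact Set.mem_iUnion₂.2 ⟨0, rfl, mem_digitRange.2 ⟨by linarith, by linarith⟩⟩
    · rintro _ rfl
      exact cut_zero_nonempty hK ha
  · have ha := hA.neg hp.1
    have hb := htent _ hp.2.1
    have hne := cut_neg_one_nonempty hK ha
    refine leaf_mem_rz hK h (right_mem_PFin_rz .zero (left_mem_PFin_rz .neg)) (fun x hx => ?_) ?_
      fun _ => ⟨hpart true hne hp.2.2, hb⟩
    · have := mem_of_le_ends hK hx
      rw [mem_digitRange] at hb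
      rcases le_total x 0 with hx0 | hx0
      · exact Set.mem_iUnion₂.2 ⟨-1, .inl rfl, mem_digitRange.2 ⟨by linarith, by linarith⟩⟩
      · exact Set.mem_iUnion₂.2 ⟨0, .inr rfl, mem_digitRange.2 ⟨by linarith, by linarith⟩⟩
    · rintro _ (rfl | rfl)
      · exact hne
      · exact cut_zero_nonempty hK hb
  · have hb := hB.pos hp.1
    have ha := htent _ hp.2.1
    have hne := cut_one_nonempty hK hb
    refine leaf_mem_rz hK h (right_mem_PFin_rz .pos (left_mem_PFin_rz .zero)) (fun x hx => ?_) ?_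
      fun _ => ⟨ha, hpart false hne hp.2.2⟩
    · have := mem_of_le_ends hK hx
      rw [mem_digitRange] at ha
      rcases le_total x 0 with hx0 | hx0
      · exact Set.mem_iUnion₂.2 ⟨0, .inl rfl, mem_digitRange.2 ⟨by linarith, by linarith⟩⟩
      · exact Set.mem_iUnion₂.2 ⟨1, .inr rfl, mem_digitRange.2 ⟨by linarith, by linarith⟩⟩
    · rintro _ (rfl | rfl)
      · exact cut_zero_nonempty hK ha
      · exact hne

theorem digitTree_mem_rz {K : Set ℝ} (hK : IsNonemptyCompact K) {κ : D} (h : Valid K (D.app κ)) :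
    digitTree κ ∈ (SKstar K).rz := by
  rw [SKstar_eq]
  refine ⟨treeRz, ?_, hK, κ, rfl, h⟩
  rintro K _ ⟨hK, κ, rfl, h⟩
  rw [digitTree_eq]
  exact ⟨hK, choice_mem_rz (digitChoices_mem_ty (fun _ => bot_mem_fixTy_skOp)
    (fun _ => digitTree_mem_fixTy) K κ) (digitChoices_mem_rz hK h) (exists_digitChoice hK h _)⟩

/-! ## Truth -/

theorem concStar_tr {A : Formula} (h : A.tr) : (concStar A).tr := fun _ hp => hp () (.inl h)

theorem Gstar_tr {x : ℝ} (hx : -1 ≤ x ∧ x ≤ 1) : (Gstar x).tr := by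
  refine ⟨fun x => -1 ≤ x ∧ x ≤ 1, fun y hy => ⟨hy, fun _ => ?_, tent_mem_Icc hy⟩, hx⟩
  exact concStar_tr (le_total y 0)

theorem GKstar_tr_iff {K : Set ℝ} : (GKstar K).tr ↔ IsNonemptyCompact K := by
  constructor
  · rintro ⟨p, hp, hK⟩
    exact (hp K hK).1
  · intro hK
    refine ⟨IsNonemptyCompact, fun K hK => ⟨hK, Gstar_tr (ends_bounds hK true),
      Gstar_tr (ends_bounds hK false), fun d hd hne => ?_⟩, hK⟩
    rcases hd with rfl | rfl
    · exact hK.grayPart (b := true) hne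
    · exact hK.grayPart (b := false) hne

/-- Classically the signs of the ends can be decided, so the digits -1 and 1 suffice. -/
theorem SKstar_tr_iff {K : Set ℝ} : (SKstar K).tr ↔ IsNonemptyCompact K := by
  constructor
  · rintro ⟨p, hp, hK⟩
    exact (hp K hK).1
  · intro hK
    refine ⟨IsNonemptyCompact, fun K hK => ⟨hK, concStar_tr ?_⟩, hK⟩
    have key : ∀ E : Set ℝ, (PFin SD E).tr → K ⊆ ⋃ d ∈ E, digitRange d →
        (∀ d ∈ E, (cut K d).Nonempty) → (skBody (fun K => ⟨IsNonemptyCompact K, fixTy skOp, ∅⟩) K).tr :=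
      fun E h1 h2 h3 => ⟨E, h1, h2, fun d _ hd => ⟨h3 d hd, hK.digitPart (h3 d hd)⟩⟩
    have hneg : (PFin SD {-1}).tr := fun p hp => hp _ (.inl ⟨-1, rfl, .inl (.inl rfl)⟩)
    have hpos : (PFin SD {1}).tr := fun p hp => hp _ (.inl ⟨1, rfl, .inl (.inr rfl)⟩)
    have hboth : (PFin SD ({-1} ∪ {1})).tr := fun p hp =>
      hp _ (.inr ⟨{-1}, hneg p hp, 1, rfl, .inl (.inr rfl)⟩)
    have hends := (mem_of_le_ends hK (ends_mem hK true)).1.2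
    rcases le_total (ends false K) 0 with hb | hb
    · refine key {-1} hneg (fun x hx => ?_) ?_
      · have := mem_of_le_ends hK hx
        exact Set.mem_iUnion₂.2 ⟨-1, rfl, mem_digitRange.2 ⟨by linarith, by linarith⟩⟩
      · rintro _ rfl
        exact cut_neg_one_nonempty hK (by linarith)
    · rcases le_total (ends true K) 0 with ha | ha
      · refine key _ hboth (fun x hx => ?_) ?_
        · have := mem_of_le_ends hK hx
          rcases le_total x 0 with hx0 | hx0
          · exact Set.mem_iUnion₂.2 ⟨-1, .inl rfl, mem_digitRange.2 ⟨by linarith, by linarith⟩⟩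
          · exact Set.mem_iUnion₂.2 ⟨1, .inr rfl, mem_digitRange.2 ⟨by linarith, by linarith⟩⟩
        · rintro _ (rfl | rfl)
          · exact cut_neg_one_nonempty hK ha
          · exact cut_one_nonempty hK hb
      · refine key {1} hpos (fun x hx => ?_) ?_
        · have := mem_of_le_ends hK hx
          exact Set.mem_iUnion₂.2 ⟨1, rfl, mem_digitRange.2 ⟨by linarith, by linarith⟩⟩
        · rintro _ rfl
          exact cut_one_nonempty hK (by linarith)

/-! ## The translations realise the inclusions -/

theorem toGray_mem_rz : toGray ∈ (incl SKstar GKstar).rz := by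
  refine fun K => ⟨.inr ⟨_, scottContinuous_toGray, rfl, fun m _ => grayTree_mem_ty K _⟩,
    fun m hm => ?_⟩
  rw [toGray, D.app_fn scottContinuous_toGray]
  refine grayTree_mem_rz (exists_concStar_of_SKstar hm).1 ?_
  rw [funext (def1_treeQ.beta m)]
  exact valid_treeQ hm

theorem toDigit_mem_rz : toDigit ∈ (incl GKstar SKstar).rz := by
  refine fun K => ⟨.inr ⟨_, scottContinuous_toDigit, rfl, fun g _ => digitTree_mem_fixTy _⟩,
    fun g hg => ?_⟩
  rw [toDigit, D.app_fn scottContinuous_toDigit]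
  refine digitTree_mem_rz (isNonemptyCompact_of_GKstar hg) ?_
  rw [funext (def1_grayTreeAns.beta g)]
  exact valid_grayTreeAns hg

end CFP

theorem mainTheorem2 :
    {K : Set ℝ | (CFP.SKstar K).tr} = {K : Set ℝ | (CFP.GKstar K).tr} ∧
    (∃ M : CFP.Program 0, M.val ∈ (CFP.Formula.incl CFP.SKstar CFP.GKstar).rz) ∧
    (∃ N : CFP.Program 0, N.val ∈ (CFP.Formula.incl CFP.GKstar CFP.SKstar).rz) := by
  refine ⟨Set.ext fun K => CFP.SKstar_tr_iff.trans CFP.GKstar_tr_iff.symm, ?_, ?_⟩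
  · obtain ⟨M, hM⟩ := CFP.closed_toGray.exists_val
    exact ⟨M, hM ▸ CFP.toGray_mem_rz⟩
  · obtain ⟨N, hN⟩ := CFP.closed_toDigit.exists_val
    exact ⟨N, hN ▸ CFP.toDigit_mem_rz⟩
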